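/- C*-algebras are complex and not assumed unital. A C*-algebra $A$ is *AF* (approximately finite-dimensional) if it has a family of finite-dimensional C*-subalgebras, directed by inclusion, with dense union. It is *LF* (locally finite-dimensional) if for every finite $F\subseteq A$ and every $\varepsilon>0$ there is a finite-dimensional C*-subalgebra $B\subseteq A$ such that every $f\in F$ satisfies $\|f-b\|<\varepsilon$ for some $b\in B$. It is *scattered* if every nonzero quotient of $A$ contains a nonzero projection $p$ that is minimal, i.e. $p\,(\cdot)\,p$ maps that quotient into $\mathbb{C}p$. $A$ is an *extension* of $Q$ by $I$ if there is a short exact sequence $0\to I\to A\to Q\to 0$ of C*-algebras and $*$-homomorphisms. For $\theta\in\mathbb{R}$ let $P_\theta\in M_2=M_2(\mathbb{C})$ be the projection onto $\mathbb{C}(\sin\theta,\cos\theta)$, let $D=\{(a_n)_{n\ge1}\in\ell_\infty(M_2):\lim_n a_n\in\mathbb{C}P_0\}$, and let $p=(P_0)_{n\ge1}$ and $q=(P_{1/n})_{n\ge1}$, which are projections in $D$. For a set $X$ and a family $\mathcal{F}=(A_i,B_i)_{i\in\mathcal{I}}$ of pairs of disjoint subsets of $X$, let $A_{\mathcal{F}}$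 be the C*-subalgebra generated by $(\mathsf{P}_i)_{i\in\mathcal{I}}$ in the C*-algebra $\ell_\infty^X(D)$ of bounded functions $X\to D$, where $\mathsf{P}_i$ equals $p$ on $A_i$, $q$ on $B_i$ and $0$ elsewhere. **Theorem.** There are extensions of AF algebras by AF algebras that are not AF. More precisely, there are a set $X$ and a family $\mathcal{F}$ of pairs of disjoint subsets of $X$ such that $A_{\mathcal{F}}$ is scattered, $A_{\mathcal{F}}$ is an extension of an AF algebra by an AF algebra, and $A_{\mathcal{F}}$ is not AF. On the other hand, every extension of an LF algebra by an LF algebra is LF. -/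

import Mathlib

open Filter Topology
open scoped ENNReal Matrix.Norms.L2Operator

noncomputable section

/-! ### AF, LF and scattered C*-algebras, extensions

C*-algebras are complex and not assumed unital. A finite-dimensional `*`-subalgebra of a
C*-algebra is closed, hence a C*-subalgebra. -/

/-- `A` is approximately finite-dimensional (AF): there is a (nonempty) family of
finite-dimensional C*-subalgebras of `A`, directed by inclusion, with dense union. -/
def IsAF (A : Type*) [NonUnitalCStarAlgebra A] : Prop :=
  ∃ S : Set (NonUnitalStarSubalgebra ℂ A), S.Nonempty ∧ DirectedOn (· ≤ ·) S ∧
    (∀ B ∈ S, FiniteDimensional ℂ B) ∧ Dense (⋃ B ∈ S, (B : Set A))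

/-- `A` is locally finite-dimensional (LF): for every finite `F ⊆ A` and every `ε > 0` there is a
finite-dimensional C*-subalgebra `B` of `A` such that every element of `F` is at distance less
than `ε` from some element of `B`. -/
def IsLF (A : Type*) [NonUnitalCStarAlgebra A] : Prop :=
  ∀ (F : Finset A) (ε : ℝ), 0 < ε → ∃ B : NonUnitalStarSubalgebra ℂ A,
    FiniteDimensional ℂ B ∧ ∀ f ∈ F, ∃ b ∈ B, ‖f - b‖ < ε

/-- `p` is a nonzero minimal projection of `A`: `p` is a projection, `p ≠ 0` and `p A p = ℂ p`. -/
def IsMinimalProjection {A : Type*} [NonUnitalCStarAlgebra A] (p : A) : Prop :=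
  IsStarProjection p ∧ p ≠ 0 ∧ ∀ a : A, ∃ z : ℂ, p * a * p = z • p

/-- `A` is scattered: every nonzero quotient of `A` contains a nonzero minimal projection.
The quotients of `A` are, up to isomorphism, the C*-algebras onto which `A` is mapped by a
`*`-homomorphism. -/
def IsScattered.{u} (A : Type u) [NonUnitalCStarAlgebra A] : Prop :=
  ∀ (Q : Type u) [NonUnitalCStarAlgebra Q] (π : A →⋆ₙₐ[ℂ] Q), Function.Surjective π →
    Nontrivial Q → ∃ p : Q, IsMinimalProjection p

/-- `A` is an extension of `Q` by `I`: there is a short exact sequence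
`0 → I → A → Q → 0` of C*-algebras and `*`-homomorphisms. Equivalently, `I` is (isomorphic to) a
closed two-sided ideal of `A` with `A / I` isomorphic to `Q`. -/
def IsExtension (I A Q : Type*) [NonUnitalCStarAlgebra I] [NonUnitalCStarAlgebra A]
    [NonUnitalCStarAlgebra Q] : Prop :=
  ∃ (i : I →⋆ₙₐ[ℂ] A) (π : A →⋆ₙₐ[ℂ] Q),
    Function.Injective i ∧ Function.Surjective π ∧ ∀ a : A, π a = 0 ↔ a ∈ Set.range i

/-! ### The algebra `D` of matrix sequences with a dimension drop at infinity -/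

/-- The C*-algebra `M₂` of complex `2 × 2` matrices, with the operator norm. -/
abbrev M2 : Type := Matrix (Fin 2) (Fin 2) ℂ

/-- The projection `P_θ ∈ M₂` onto the line spanned by `(sin θ, cos θ)`. -/
def lineProj (θ : ℝ) : M2 :=
  !![((Real.sin θ ^ 2 : ℝ) : ℂ), ((Real.sin θ * Real.cos θ : ℝ) : ℂ);
    ((Real.sin θ * Real.cos θ : ℝ) : ℂ), ((Real.cos θ ^ 2 : ℝ) : ℂ)]

/-- The C*-algebra `ℓ_∞(M₂)` of bounded sequences in `M₂`. -/
abbrev SeqM2 : Type := lp (fun _ : ℕ => M2) ∞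

theorem lineProj_zero_mul : lineProj 0 * lineProj 0 = lineProj 0 := by
  ext i j
  fin_cases i <;> fin_cases j <;> simp [lineProj, Matrix.mul_apply]

theorem lineProj_star (θ : ℝ) : star (lineProj θ) = lineProj θ := by
  ext i j
  fin_cases i <;> fin_cases j <;> simp [lineProj, Matrix.star_apply] <;>
    simp [← Complex.ofReal_sin, ← Complex.ofReal_cos]

/-- `D = {a ∈ ℓ_∞(M₂) : lim a_n ∈ ℂ P_0}`. -/
def dimDrop : NonUnitalStarSubalgebra ℂ SeqM2 where
  carrier := {a | ∃ z : ℂ, Tendsto (fun n => a n) atTop (𝓝 (z • lineProj 0))}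
  add_mem' := by
    rintro a b ⟨z, hz⟩ ⟨w, hw⟩
    refine ⟨z + w, ?_⟩
    rw [add_smul]
    exact hz.add hw
  zero_mem' := ⟨0, by simp⟩
  mul_mem' := by
    rintro a b ⟨z, hz⟩ ⟨w, hw⟩
    refine ⟨z * w, ?_⟩
    have h := hz.mul hw
    rw [smul_mul_smul_comm, lineProj_zero_mul] at h
    exact h
  smul_mem' := by
    rintro c a ⟨z, hz⟩
    refine ⟨c * z, ?_⟩
    rw [mul_smul]
    exact hz.const_smul c
  star_mem' := by
    rintro a ⟨z, hz⟩
    refine ⟨star z, ?_⟩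
    have h := hz.star
    rw [star_smul, lineProj_star] at h
    exact h

theorem isClosed_dimDrop : IsClosed (dimDrop : Set SeqM2) := by
  refine isClosed_of_closure_subset fun a ha => ?_
  rw [Metric.mem_closure_iff] at ha
  have key : ∀ ε > 0, ∃ w ∈ Submodule.span ℂ {lineProj 0}, ∃ N, ∀ n ≥ N, dist (a n) w < ε := by
    intro ε hε
    obtain ⟨b, ⟨z, hz⟩, hab⟩ := ha (ε / 2) (half_pos hε)
    obtain ⟨N, hN⟩ := Metric.tendsto_atTop.1 hz (ε / 2) (half_pos hε)
    refine ⟨z • lineProj 0, Submodule.smul_mem _ _ (Submodule.mem_span_singleton_self _), N,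
      fun n hn => ?_⟩
    have h1 : dist (a n) (b n) ≤ dist a b := by
      rw [dist_eq_norm, dist_eq_norm]
      exact lp.norm_apply_le_norm ENNReal.top_ne_zero (a - b) n
    have h2 := hN n hn
    have h3 := dist_triangle (a n) (b n) (z • lineProj 0)
    linarith
  have hc : CauchySeq (fun n => a n) := by
    rw [Metric.cauchySeq_iff']
    intro ε hε
    obtain ⟨w, -, N, hN⟩ := key (ε / 2) (half_pos hε)
    refine ⟨N, fun n hn => ?_⟩
    have h1 := hN n hn
    have h2 := hN N le_rfl
    have h3 := dist_triangle_right (a n) (a N) w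
    linarith
  obtain ⟨L, hL⟩ := cauchySeq_tendsto_of_complete hc
  have hLmem : L ∈ Submodule.span ℂ {lineProj 0} := by
    have hcl : IsClosed ((Submodule.span ℂ {lineProj 0} : Submodule ℂ M2) : Set M2) :=
      Submodule.closed_of_finiteDimensional _
    rw [← SetLike.mem_coe, ← hcl.closure_eq, Metric.mem_closure_iff]
    intro ε hε
    obtain ⟨w, hw, N, hN⟩ := key (ε / 2) (half_pos hε)
    refine ⟨w, hw, ?_⟩
    have h : dist L w ≤ ε / 2 :=
      le_of_tendsto (hL.dist tendsto_const_nhds)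
        (eventually_atTop.2 ⟨N, fun n hn => (hN n hn).le⟩)
    linarith
  obtain ⟨z, hz⟩ := Submodule.mem_span_singleton.1 hLmem
  exact ⟨z, hz ▸ hL⟩

instance instIsClosedDimDrop : IsClosed (dimDrop : Set SeqM2) := isClosed_dimDrop

/-- `D` as a C*-algebra. -/
abbrev DimDrop : Type := dimDrop

theorem continuous_lineProj : Continuous lineProj := by
  have h : Continuous fun θ : ℝ =>
      (!![((Real.sin θ ^ 2 : ℝ) : ℂ), ((Real.sin θ * Real.cos θ : ℝ) : ℂ);
        ((Real.sin θ * Real.cos θ : ℝ) : ℂ), ((Real.cos θ ^ 2 : ℝ) : ℂ)] :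
          Matrix (Fin 2) (Fin 2) ℂ) := by
    refine continuous_matrix fun i j => ?_
    fin_cases i <;> fin_cases j <;> simp <;> fun_prop
  exact h

theorem memℓp_lineProj {u : ℕ → ℝ} (hu : Tendsto u atTop (𝓝 0)) :
    Memℓp (fun n => lineProj (u n)) ∞ := by
  refine memℓp_infty ?_
  have h : Tendsto (fun n => ‖lineProj (u n)‖) atTop (𝓝 ‖lineProj 0‖) :=
    ((continuous_lineProj.tendsto 0).comp hu).norm
  exact h.bddAbove_range

/-- For a real sequence `u` tending to `0`, the element `(P_{u_n})_n` of `D`. -/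
def lineProjSeq (u : ℕ → ℝ) (hu : Tendsto u atTop (𝓝 0)) : DimDrop :=
  ⟨⟨fun n => lineProj (u n), memℓp_lineProj hu⟩, 1, by
    rw [one_smul]
    exact (continuous_lineProj.tendsto 0).comp hu⟩

/-- The projection `p = (P_0)_n` of `D`. -/
def projP : DimDrop := lineProjSeq (fun _ => 0) tendsto_const_nhds

/-- The projection `q = (P_{1/n})_{n ≥ 1}` of `D` (the index set `{1, 2, …}` is shifted to `ℕ`). -/
def projQ : DimDrop := lineProjSeq (fun n => 1 / ((n : ℝ) + 1)) tendsto_one_div_add_atTop_nhds_zero_nat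

/-! ### The algebra of a family of pairs of subsets of a set -/

/-- The C*-algebra `ℓ_∞^X(D)` of bounded functions from `X` to `D`. -/
abbrev BoundedFun (X : Type*) : Type _ := lp (fun _ : X => DimDrop) ∞

open Classical in
/-- The projection of `ℓ_∞^X(D)` which is `p` on `A`, `q` on `B` and `0` elsewhere
(used for disjoint `A` and `B`). -/
def pairProj {X : Type*} (A B : Set X) : BoundedFun X :=
  ⟨fun t => if t ∈ A then projP else if t ∈ B then projQ else 0, by
    refine memℓp_infty ⟨max ‖projP‖ ‖projQ‖, ?_⟩
    rintro _ ⟨t, rfl⟩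
    dsimp only
    split_ifs
    · exact le_max_left _ _
    · exact le_max_right _ _
    · simp⟩

/-- The C*-subalgebra of `ℓ_∞^X(D)` generated by the projections of the pairs `(A i, B i)`. -/
def familyAlgebra {X ι : Type*} (A B : ι → Set X) : NonUnitalStarSubalgebra ℂ (BoundedFun X) :=
  (NonUnitalStarAlgebra.adjoin ℂ
    (Set.range fun i => pairProj (A i) (B i))).topologicalClosure

instance instIsClosedFamilyAlgebra {X ι : Type*} (A B : ι → Set X) :
    IsClosed (familyAlgebra A B : Set (BoundedFun X)) :=
  NonUnitalStarSubalgebra.isClosed_topologicalClosure _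

end

/-! The counterexample lives on a grid `Y × Z` with `Y` uncountable and `Z` of larger cardinality.
The family of pairs puts `p` on each row, `q` on each column, and both `p` and `q` on each single
point. Since `p` and `q` generate `D`, the points yield the whole `c₀`-sum of copies of `D`. A row
meets a column in one point, so modulo this ideal the row and column projections are orthogonal, and
the algebra consists of the families `c_y p + c_z q` plus a family vanishing at infinity
(`mem_familyAlgebra_iff`). It is therefore an extension of `c₀(Y ⊔ Z)` by `c₀(Y × Z, D)`, both AF.

It is not AF by counting (`not_isAF_of_isSymbol`). In a directed dense family of finite-dimensional
subalgebras, choose for each row and each column a member whose symbol there is nonzero. An element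
with symbol `c` equals `c_y p` exactly at all but countably many points of row `y`, and `c_z q` at
all but countably many points of column `z`. The cardinalities give a point `(y, z)` good for both.
A common finite-dimensional member then has values at `(y, z)` that contain `p` and `q`, which
generate the infinite-dimensional `D`. Scatteredness follows by exhausting the algebra with
projections, each having a one-dimensional corner modulo what has already been killed
(`mem_kerSubmodule_of_corner`).

For the LF statement pass to unitizations, so that `π` is unital with LF kernel. The heart is that a
self-adjoint `c` with `π c` invertible becomes invertible after an arbitrarily small perturbation
from the kernel (`IsLFKer.exists_isUnit_add`). Hence self-adjoint lifts can be given spectral gaps,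
and orthogonal projections lift (`IsLFKer.exists_lift_projections`). Matrix units of a
finite-dimensional subalgebra of the quotient then lift as well, once they are cut down by
projections that nearly exhaust the relevant elements of the ideal
(`IsLFKer.exists_lift_matrixUnits`). What remains lies in a corner of the ideal, which is LF again
(`IsLFKer.exists_corner`). The lifted matrix units and a finite-dimensional subalgebra of this
corner together approximate the given elements (`IsLFKer.exists_approx`). -/

/-! ### Finite-dimensional subalgebras and finite spectra. -/

section FiniteSpectrum

variable {A : Type*} [CStarAlgebra A]

/-- The star subalgebra spanned by `1` and a non-unital star subalgebra. -/
def adjoinOne (B : NonUnitalStarSubalgebra ℂ A) : StarSubalgebra ℂ A where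
  carrier := {x | ∃ z : ℂ, ∃ b ∈ B, x = z • (1 : A) + b}
  mul_mem' := by
    rintro _ _ ⟨z, b, hb, rfl⟩ ⟨w, c, hc, rfl⟩
    refine ⟨z * w, z • c + w • b + b * c, add_mem (add_mem (SMulMemClass.smul_mem z hc)
      (SMulMemClass.smul_mem w hb)) (mul_mem hb hc), ?_⟩
    simp only [add_mul, mul_add, mul_one, smul_mul_assoc, one_mul, mul_smul_comm, smul_add,
      smul_smul, mul_comm w z]
    abel
  add_mem' := by
    rintro _ _ ⟨z, b, hb, rfl⟩ ⟨w, c, hc, rfl⟩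
    exact ⟨z + w, b + c, add_mem hb hc, by rw [add_smul]; abel⟩
  algebraMap_mem' r := ⟨r, 0, zero_mem _, by rw [add_zero, Algebra.algebraMap_eq_smul_one]⟩
  star_mem' := by
    rintro _ ⟨z, b, hb, rfl⟩
    exact ⟨star z, star b, star_mem hb, by simp⟩

theorem mem_adjoinOne_of_mem {B : NonUnitalStarSubalgebra ℂ A} {x : A} (hx : x ∈ B) :
    x ∈ adjoinOne B := ⟨0, x, hx, by simp⟩

instance finiteDimensional_adjoinOne (B : NonUnitalStarSubalgebra ℂ A) [FiniteDimensional ℂ B] :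
    FiniteDimensional ℂ (adjoinOne B) := by
  let f : ℂ × B →ₗ[ℂ] A :=
    (LinearMap.toSpanSingleton ℂ A 1).coprod
      (B.toNonUnitalSubalgebra.toSubmodule.subtype)
  have hle : (adjoinOne B).toSubalgebra.toSubmodule ≤ LinearMap.range f := by
    rintro _ ⟨z, b, hb, rfl⟩
    exact ⟨(z, ⟨b, hb⟩), by simp only [f, LinearMap.coprod_apply,
      LinearMap.toSpanSingleton_apply]; rfl⟩
  exact Submodule.finiteDimensional_of_le hle

theorem isClosed_of_finiteDimensional (M : StarSubalgebra ℂ A) [FiniteDimensional ℂ M] :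
    IsClosed (M : Set A) := by
  have : FiniteDimensional ℂ M.toSubalgebra.toSubmodule := ‹FiniteDimensional ℂ M›
  exact Submodule.closed_of_finiteDimensional M.toSubalgebra.toSubmodule

theorem cfc_mem_of_finiteDimensional (M : StarSubalgebra ℂ A) [FiniteDimensional ℂ M] {h : A}
    (hh : h ∈ M) (f : ℝ → ℝ) : cfc f h ∈ M := by
  have := isClosed_of_finiteDimensional M
  exact cfc_mem (𝕜' := ℂ) f hh

/-- Such an element is a zero of a monic polynomial, and by spectral mapping its spectrum consists
of roots. On a finite spectrum every function is continuous, so the functional calculus applies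
freely to characteristic functions and inverses. -/
theorem finite_spectrum_of_mem (M : StarSubalgebra ℂ A) [FiniteDimensional ℂ M] {h : A}
    (hh : h ∈ M) : (spectrum ℝ h).Finite := by
  have hi : IsIntegral ℂ (⟨h, hh⟩ : M) := Algebra.IsIntegral.isIntegral _
  obtain ⟨p, hp, hp0⟩ := hi
  have hp1 : Polynomial.aeval h p = 0 := by
    have := congrArg (Subtype.val) hp0
    rw [← Polynomial.aeval_def] at this
    have h2 := Polynomial.aeval_algHom_apply M.subtype.toAlgHom (⟨h, hh⟩ : M) p
    erw [h2]
    exact this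
  have hfin : (spectrum ℂ h).Finite := by
    refine (p.roots.toFinset.finite_toSet).subset fun z hz => ?_
    rcases subsingleton_or_nontrivial A with hA | hA
    · simp [spectrum.of_subsingleton] at hz
    have := spectrum.subset_polynomial_aeval h p ⟨z, hz, rfl⟩
    rw [hp1, spectrum.zero_eq, Set.mem_singleton_iff] at this
    simp only [Finset.mem_coe, Multiset.mem_toFinset]
    exact (Polynomial.mem_roots hp.ne_zero).2 this
  refine Set.Finite.of_finite_image (f := algebraMap ℝ ℂ) (hfin.subset ?_)
    (algebraMap ℝ ℂ).injective.injOn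
  rintro _ ⟨x, hx, rfl⟩
  exact (spectrum.algebraMap_mem_iff ℂ).2 hx

end FiniteSpectrum

/-! ### Almost projections and inverse square roots by functional calculus. -/

section SpectralProjection

variable {A : Type*} [CStarAlgebra A]

/-- A jump outside the spectrum is harmless; this is how a spectral gap yields a projection. -/
theorem continuousOn_ite_lt {s : Set ℝ} {t : ℝ} (ht : t ∉ s) :
    ContinuousOn (fun x : ℝ => if t < x then (1 : ℝ) else 0) s := by
  intro x hx
  refine ContinuousAt.continuousWithinAt ?_
  have hxt : x ≠ t := fun h => ht (h ▸ hx)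
  rcases lt_or_gt_of_ne hxt with h | h
  · refine (continuousAt_const (y := (0 : ℝ))).congr ?_
    filter_upwards [Iio_mem_nhds h] with y hy
    rw [if_neg (not_lt.2 (le_of_lt hy))]
  · refine (continuousAt_const (y := (1 : ℝ))).congr ?_
    filter_upwards [Ioi_mem_nhds h] with y hy
    exact (if_pos hy).symm

theorem isStarProjection_cfc {f : ℝ → ℝ} {x : A} (hf : ContinuousOn f (spectrum ℝ x))
    (h01 : ∀ t ∈ spectrum ℝ x, f t = 0 ∨ f t = 1) : IsStarProjection (cfc f x) := by
  refine ⟨?_, cfc_predicate f x⟩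
  rw [IsIdempotentElem, ← cfc_mul f f x hf hf]
  refine cfc_congr fun t ht => ?_
  rcases h01 t ht with h | h <;> simp [h]

/-- Self-adjoint almost idempotents are close to projections. -/
theorem exists_isStarProjection_near {x : A} (hx : IsSelfAdjoint x) {δ : ℝ} (hδ : δ ≤ 1 / 8)
    (hxx : ‖x * x - x‖ ≤ δ) :
    let f : ℝ → ℝ := fun t => if 1 / 2 < t then 1 else 0
    ContinuousOn f (spectrum ℝ x) ∧ IsStarProjection (cfc f x) ∧ ‖cfc f x - x‖ ≤ 2 * δ := by
  intro f
  have h0 : 0 ≤ δ := (norm_nonneg _).trans hxx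
  have hsp : ∀ t ∈ spectrum ℝ x, |t * t - t| ≤ δ := by
    intro t ht
    have h1 : x * x - x = cfc (fun t : ℝ => t * t - t) x := by
      rw [cfc_sub (fun t : ℝ => t * t) (fun t => t) x, cfc_mul (fun t : ℝ => t) (fun t => t) x,
        cfc_id' ℝ x]
    rw [h1, norm_cfc_le_iff _ _ h0] at hxx
    exact hxx t ht
  have hne : (1 / 2 : ℝ) ∉ spectrum ℝ x := by
    intro h
    have := hsp _ h
    rw [abs_le] at this
    linarith [this.1]
  have hc : ContinuousOn f (spectrum ℝ x) := continuousOn_ite_lt hne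
  refine ⟨hc, isStarProjection_cfc hc fun t _ => ?_, ?_⟩
  · exact (ite_eq_or_eq _ _ _).symm
  · have h1 : cfc f x - x = cfc (fun t : ℝ => f t - t) x := by
      rw [cfc_sub f (fun t => t) x, cfc_id' ℝ x]
    rw [h1]
    -- On the spectrum `|t| |t - 1| ≤ δ`; whichever of `t` and `t - 1` is farther from `0` has
    -- modulus at least `1/2`, so the other has modulus at most `2δ`.
    refine norm_cfc_le (by linarith) fun t ht => ?_
    have := abs_le.1 (hsp t ht)
    rw [Real.norm_eq_abs, abs_le]
    by_cases h : 1 / 2 < t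
    · simp only [f, if_pos h]
      constructor <;> nlinarith
    · simp only [f, if_neg h]
      constructor <;> nlinarith

/-- The inverse square root of a self-adjoint element close to `1`. -/
noncomputable def invSqrt (h : A) : A := cfc (fun t : ℝ => (√t)⁻¹) h

theorem abs_sub_one_le_of_mem_spectrum {h : A} (hh : IsSelfAdjoint h) {δ : ℝ}
    (hδ : ‖h - 1‖ ≤ δ) {t : ℝ} (ht : t ∈ spectrum ℝ h) : |t - 1| ≤ δ := by
  have h1 : h - 1 = cfc (fun t : ℝ => t - 1) h := by
    rw [cfc_sub (fun t : ℝ => t) (fun _ => 1) h, cfc_id' ℝ h, cfc_const_one ℝ h]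
  rw [h1, norm_cfc_le_iff _ _ ((norm_nonneg _).trans hδ)] at hδ
  exact hδ t ht

theorem pos_of_mem_spectrum {h : A} (hh : IsSelfAdjoint h)
    (hδ : ‖h - 1‖ ≤ 1 / 2) {t : ℝ} (ht : t ∈ spectrum ℝ h) : 1 / 2 ≤ t := by
  have := abs_le.1 (abs_sub_one_le_of_mem_spectrum hh hδ ht)
  linarith [this.1]

theorem continuousOn_inv_sqrt {h : A} (hh : IsSelfAdjoint h) (hδ : ‖h - 1‖ ≤ 1 / 2) :
    ContinuousOn (fun t : ℝ => (√t)⁻¹) (spectrum ℝ h) := by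
  refine ContinuousOn.inv₀ (by fun_prop) fun t ht => ?_
  have := pos_of_mem_spectrum hh hδ ht
  exact (Real.sqrt_pos.2 (by linarith)).ne'

theorem isSelfAdjoint_invSqrt (h : A) : IsSelfAdjoint (invSqrt h) := cfc_predicate _ h

theorem invSqrt_mul_mul_invSqrt {h : A} (hh : IsSelfAdjoint h) (hδ : ‖h - 1‖ ≤ 1 / 2) :
    invSqrt h * h * invSqrt h = 1 := by
  have hc := continuousOn_inv_sqrt hh hδ
  have e : invSqrt h * h * invSqrt h
      = cfc (fun t : ℝ => (√t)⁻¹ * t * (√t)⁻¹) h := by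
    rw [cfc_mul (fun t : ℝ => (√t)⁻¹ * t) (fun t : ℝ => (√t)⁻¹) h,
      cfc_mul (fun t : ℝ => (√t)⁻¹) (fun t => t) h, cfc_id' ℝ h, invSqrt]
  rw [e, ← cfc_const_one ℝ h]
  refine cfc_congr fun t ht => ?_
  have ht := pos_of_mem_spectrum hh hδ ht
  have h0 : √t ≠ 0 := (Real.sqrt_pos.2 (by linarith)).ne'
  have h1 : √t * √t = t := Real.mul_self_sqrt (by linarith)
  field_simp
  nlinarith

theorem norm_invSqrt_sub_one_le {h : A} (hh : IsSelfAdjoint h) {δ : ℝ} (hδ2 : δ ≤ 1 / 2)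
    (hδ : ‖h - 1‖ ≤ δ) : ‖invSqrt h - 1‖ ≤ δ := by
  have hc := continuousOn_inv_sqrt hh (hδ.trans hδ2)
  have e : invSqrt h - 1 = cfc (fun t : ℝ => (√t)⁻¹ - 1) h := by
    rw [cfc_sub (fun t : ℝ => (√t)⁻¹) (fun _ => 1) h, cfc_const_one ℝ h, invSqrt]
  rw [e]
  refine norm_cfc_le ((norm_nonneg _).trans hδ) fun t ht => ?_
  have h2 := abs_sub_one_le_of_mem_spectrum hh hδ ht
  have ht := pos_of_mem_spectrum hh (hδ.trans hδ2) ht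
  set s := √t
  have h0 : 0 < s := Real.sqrt_pos.2 (by linarith)
  have h1 : s * s = t := Real.mul_self_sqrt (by linarith)
  have h3 : 1 / 2 < s := by nlinarith
  rw [Real.norm_eq_abs]
  have h4 : s⁻¹ - 1 = (1 - t) / (s * (1 + s)) := by
    rw [← h1]; field_simp; ring
  have h5 : 1 ≤ s * (1 + s) := by nlinarith
  rw [h4, abs_div, abs_of_pos (by positivity : 0 < s * (1 + s)), abs_sub_comm]
  exact (div_le_self (abs_nonneg _) h5).trans h2

theorem norm_invSqrt_le {h : A} (hh : IsSelfAdjoint h) (hδ : ‖h - 1‖ ≤ 1 / 2) :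
    ‖invSqrt h‖ ≤ 2 := by
  refine norm_cfc_le zero_le_two fun t ht => ?_
  have ht := pos_of_mem_spectrum hh hδ ht
  have h1 : √t * √t = t := Real.mul_self_sqrt (by linarith)
  have h0 : 0 < √t := Real.sqrt_pos.2 (by linarith)
  have h3 : 1 / 2 < √t := by nlinarith
  rw [Real.norm_eq_abs, abs_of_pos (inv_pos.2 h0), inv_le_comm₀ h0 two_pos]
  linarith

theorem commute_invSqrt {h b : A} (hb : Commute h b) : Commute (invSqrt h) b := hb.cfc_real _

theorem continuous_starAlgHom {Q : Type*} [CStarAlgebra Q] (π : A →⋆ₐ[ℂ] Q) : Continuous π :=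
  AddMonoidHomClass.continuous_of_bound π 1 fun x => by
    simpa using NonUnitalStarAlgHom.norm_apply_le π x

/-- This keeps polar decompositions of elements of `1 + ker π` inside `1 + ker π`. -/
theorem map_invSqrt_eq_one {Q : Type*} [CStarAlgebra Q] (π : A →⋆ₐ[ℂ] Q) {h : A}
    (hh : IsSelfAdjoint h) (hδ : ‖h - 1‖ ≤ 1 / 2) (h1 : π h = 1) : π (invSqrt h) = 1 := by
  have hc := continuousOn_inv_sqrt hh hδ
  have hcont : Continuous π := continuous_starAlgHom π
  rw [invSqrt, StarAlgHom.map_cfc π _ h hc hcont hh (hh.map π), h1]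
  have : (1 : Q) = algebraMap ℝ Q 1 := by simp
  rw [this, cfc_algebraMap]
  simp

end SpectralProjection

/-! ### Opening a spectral gap by perturbing within an LF kernel. -/

section Gap

variable {A Q : Type*} [CStarAlgebra A] [CStarAlgebra Q]

/-- The kernel of `π` is locally finite-dimensional. -/
def IsLFKer (π : A →⋆ₐ[ℂ] Q) : Prop :=
  ∀ F : Finset A, (∀ x ∈ F, π x = 0) → ∀ ε : ℝ, 0 < ε → ∃ B : NonUnitalStarSubalgebra ℂ A,
    FiniteDimensional ℂ B ∧ (∀ b ∈ B, π b = 0) ∧ ∀ x ∈ F, ∃ b ∈ B, ‖x - b‖ < ε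

theorem norm_le_one_of_star_mul_self {u : A} (hu : star u * u = 1) : ‖u‖ ≤ 1 := by
  rcases subsingleton_or_nontrivial A with h | h
  · simp [Subsingleton.elim u 0]
  · have h1 : ‖u‖ * ‖u‖ = 1 := by rw [← CStarRing.norm_star_mul_self, hu, norm_one]
    nlinarith [norm_nonneg u]

theorem norm_one_le : ‖(1 : A)‖ ≤ 1 := norm_le_one_of_star_mul_self (by simp)

theorem IsStarProjection.norm_le_one {p : A} (hp : IsStarProjection p) : ‖p‖ ≤ 1 := by
  have h1 : ‖p‖ * ‖p‖ = ‖p‖ := by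
    rw [← CStarRing.norm_star_mul_self, hp.isSelfAdjoint.star_eq, hp.isIdempotentElem.eq]
  by_contra h
  nlinarith [norm_nonneg p]

theorem norm_mul_le_of_le_one_left {a b : A} (ha : ‖a‖ ≤ 1) : ‖a * b‖ ≤ ‖b‖ :=
  (norm_mul_le _ _).trans (mul_le_of_le_one_left (norm_nonneg _) ha)

theorem norm_mul_le_of_le_one_right {a b : A} (hb : ‖b‖ ≤ 1) : ‖a * b‖ ≤ ‖a‖ :=
  (norm_mul_le _ _).trans (mul_le_of_le_one_right (norm_nonneg _) hb)

theorem isUnit_of_norm_sub_one_lt {x : A} (h : ‖x - 1‖ < 1) : IsUnit x := by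
  have := isUnit_one_sub_of_norm_lt_one (x := 1 - x) (by rwa [norm_sub_rev])
  simpa using this

/-- The unitary part of the polar decomposition of an element close to a unitary. -/
theorem polar_near_unitary {x u : A} (hu : star u * u = 1) (hu' : u * star u = 1) {δ : ℝ}
    (hδ : δ ≤ 1 / 14) (hxu : ‖x - u‖ ≤ δ) :
    ‖star x * x - 1‖ ≤ 1 / 2 ∧
    star (x * invSqrt (star x * x)) * (x * invSqrt (star x * x)) = 1 ∧
    (x * invSqrt (star x * x)) * star (x * invSqrt (star x * x)) = 1 ∧
    ‖x * invSqrt (star x * x) - u‖ ≤ 7 * δ := by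
  have h0 : 0 ≤ δ := (norm_nonneg _).trans hxu
  have hun := norm_le_one_of_star_mul_self hu
  have hxn : ‖x‖ ≤ 2 := by
    have : x = (x - u) + u := by abel
    rw [this]
    exact (norm_add_le _ _).trans (by linarith)
  have hx1 : ‖star x * x - 1‖ ≤ 3 * δ := by
    have e : star x * x - 1 = star x * (x - u) + star (x - u) * u := by
      rw [← hu, star_sub]; noncomm_ring
    rw [e]
    refine (norm_add_le _ _).trans ?_
    have h1 := norm_mul_le (star x) (x - u)
    have h2 := norm_mul_le (star (x - u)) u
    rw [norm_star] at h1 h2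
    nlinarith [norm_nonneg (x - u), norm_nonneg x, norm_nonneg u]
  have hsa : IsSelfAdjoint (star x * x) := IsSelfAdjoint.star_mul_self x
  have hhalf : ‖star x * x - 1‖ ≤ 1 / 2 := hx1.trans (by linarith)
  set g := invSqrt (star x * x) with hg
  have hgsa : star g = g := isSelfAdjoint_invSqrt _
  have hw : star (x * g) * (x * g) = 1 := by
    rw [star_mul, hgsa]
    have := invSqrt_mul_mul_invSqrt hsa hhalf
    rw [← hg] at this
    rw [← this]; noncomm_ring
  -- The constant is `2 · 3 + 1`: `‖x‖ ≤ 2`, and `g` is as close to `1` as `star x * x` is, namely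
  -- within `3δ`.
  have hwu : ‖x * g - u‖ ≤ 7 * δ := by
    have e : x * g - u = x * (g - 1) + (x - u) := by noncomm_ring
    rw [e]
    refine (norm_add_le _ _).trans ?_
    have h1 := norm_mul_le x (g - 1)
    have h2 := norm_invSqrt_sub_one_le hsa (by linarith) hx1
    nlinarith [norm_nonneg (g - 1), norm_nonneg x]
  refine ⟨hhalf, hw, ?_, hwu⟩
  -- An isometry is unitary as soon as it is invertible, and `x * g` is at distance less than `1`
  -- from the unitary `u`.
  have hunit : IsUnit (x * g) := by
    have h1 : IsUnit (star u * (x * g)) := by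
      refine isUnit_of_norm_sub_one_lt ?_
      have e : star u * (x * g) - 1 = star u * (x * g - u) := by rw [← hu]; noncomm_ring
      rw [e]
      refine (norm_mul_le_of_le_one_left (by rwa [norm_star])).trans_lt (hwu.trans_lt ?_)
      linarith
    have h2 : x * g = u * (star u * (x * g)) := by rw [← mul_assoc, hu', one_mul]
    rw [h2]
    exact (IsUnit.mul ⟨⟨u, star u, hu', hu⟩, rfl⟩ h1)
  obtain ⟨v, hv⟩ := hunit
  have h3 : star (x * g) = ↑v⁻¹ := by
    rw [← hv] at hw ⊢
    rw [← one_mul (↑v⁻¹ : A), ← hw, mul_assoc, Units.mul_inv, mul_one]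
  rw [h3, ← hv, Units.mul_inv]

/-- Approximate `u - 1` by an element `b` of a finite-dimensional subalgebra of the kernel; the
unitary part of `1 + b` stays in the algebra spanned by that subalgebra and `1`. The gain is that
`w` has finite spectrum while still being mapped to `1`. -/
theorem IsLFKer.exists_unitary_near {π : A →⋆ₐ[ℂ] Q} (hπ : IsLFKer π) {u : A}
    (hu : star u * u = 1) (hu' : u * star u = 1) (h1 : π u = 1) {ε : ℝ} (hε : 0 < ε) :
    ∃ (M : StarSubalgebra ℂ A) (w : A), FiniteDimensional ℂ M ∧ w ∈ M ∧ star w * w = 1 ∧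
      w * star w = 1 ∧ π w = 1 ∧ ‖w - u‖ < ε := by
  set δ := min (1 / 14) (ε / 8) with hδ
  have hδ0 : 0 < δ := by positivity
  obtain ⟨B, hB, hBk, hBa⟩ := hπ {u - 1} (by simp [h1]) δ hδ0
  obtain ⟨b, hb, hub⟩ := hBa (u - 1) (Finset.mem_singleton_self _)
  set x := 1 + b with hx
  have hxu : ‖x - u‖ ≤ δ := by
    rw [← norm_neg, show -(x - u) = u - 1 - b by rw [hx]; abel]; exact hub.le
  obtain ⟨p1, p2, p3, p4⟩ := polar_near_unitary hu hu' (min_le_left _ _) hxu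
  have hxM : x ∈ adjoinOne B := add_mem (one_mem _) (mem_adjoinOne_of_mem hb)
  have hπx : π x = 1 := by simp [hx, hBk b hb]
  refine ⟨adjoinOne B, x * invSqrt (star x * x), inferInstance, ?_, p2, p3, ?_, ?_⟩
  · exact mul_mem hxM (cfc_mem_of_finiteDimensional _ (mul_mem (star_mem hxM) hxM) _)
  · rw [map_mul, map_invSqrt_eq_one π (IsSelfAdjoint.star_mul_self x) p1
      (by rw [map_mul, map_star, hπx]; simp), hπx, one_mul]
  · have := min_le_right (1 / 14) (ε / 8)
    linarith

end Gap

section Gap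

variable {A Q : Type*} [CStarAlgebra A] [CStarAlgebra Q]

theorem spectrum_subset_Icc_of_norm_le_one {x : A} (hx : ‖x‖ ≤ 1) :
    spectrum ℝ x ⊆ Set.Icc (-1) 1 := by
  intro t ht
  have h1 := spectrum.norm_le_norm_mul_of_mem ht
  have h2 : ‖x‖ * ‖(1 : A)‖ ≤ 1 :=
    mul_le_one₀ hx (norm_nonneg _) norm_one_le
  exact abs_le.1 (h1.trans h2)

/-- All self-adjoint contractions have spectrum in one compact interval, where the functional
calculus is norm continuous in the element. -/
theorem exists_pos_norm_cfc_sub_lt {g : ℝ → ℝ} (hg : Continuous g) {C : A} (hC : IsSelfAdjoint C)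
    (hC1 : ‖C‖ ≤ 1) {ε : ℝ} (hε : 0 < ε) :
    ∃ δ > 0, ∀ C' : A, IsSelfAdjoint C' → ‖C'‖ ≤ 1 → ‖C' - C‖ < δ →
      ‖cfc g C - cfc g C'‖ < ε := by
  have h := continuousOn_cfc (p := IsSelfAdjoint) A (isCompact_Icc (a := (-1 : ℝ)) (b := 1)) g
    hg.continuousOn
  rw [Metric.continuousOn_iff] at h
  obtain ⟨δ, hδ, h2⟩ := h C ⟨hC, spectrum_subset_Icc_of_norm_le_one hC1⟩ ε hε
  refine ⟨δ, hδ, fun C' h3 h4 h5 => ?_⟩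
  have := h2 C' ⟨h3, spectrum_subset_Icc_of_norm_le_one h4⟩ (by rwa [dist_eq_norm])
  rwa [dist_comm, dist_eq_norm] at this

/-- A unitary `w` generating a finite-dimensional algebra splits it along the sign of its real
part; `r` is the projection where the real part is nonpositive. -/
theorem exists_projection_of_unitary (M : StarSubalgebra ℂ A) [FiniteDimensional ℂ M] {C S : A}
    (hM : C ∈ M) (hC : IsSelfAdjoint C) (hCS : Commute C S) (π : A →⋆ₐ[ℂ] Q) (hπ : π C = 1) :
    ∃ r K₁ K₂ : A, IsStarProjection r ∧ Commute r S ∧ (1 - C) * K₁ = r ∧ K₁ * r = K₁ ∧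
      r * K₁ = K₁ ∧ Commute S K₁ ∧ (∀ x, Commute C x → Commute x K₁) ∧ (1 + C) * K₂ = 1 - r ∧
      K₂ * (1 - r) = K₂ ∧ ‖K₁‖ ≤ 1 ∧ ‖K₂‖ ≤ 1 ∧ π r = 0 := by
  have hfin := finite_spectrum_of_mem M hM
  have hc : ∀ f : ℝ → ℝ, ContinuousOn f (spectrum ℝ C) := fun f => hfin.continuousOn f
  let χ : ℝ → ℝ := fun t => if 0 < t then 0 else 1
  let k₁ : ℝ → ℝ := fun t => if 0 < t then 0 else (1 - t)⁻¹
  let k₂ : ℝ → ℝ := fun t => if 0 < t then (1 + t)⁻¹ else 0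
  have e1 : (1 : A) = cfc (fun _ : ℝ => (1 : ℝ)) C := (cfc_const_one ℝ C).symm
  have e2 : 1 - C = cfc (fun t : ℝ => 1 - t) C := by
    rw [cfc_sub (fun _ => (1 : ℝ)) (fun t => t) C (hc _) (hc _), cfc_id' ℝ C, ← e1]
  have e3 : 1 + C = cfc (fun t : ℝ => 1 + t) C := by
    rw [cfc_add C (fun _ => (1 : ℝ)) (fun t => t) (hc _) (hc _), cfc_id' ℝ C, ← e1]
  refine ⟨cfc χ C, cfc k₁ C, cfc k₂ C, isStarProjection_cfc (hc _) fun t _ => ?_, hCS.cfc_real _,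
    ?_, ?_, ?_, (hCS.cfc_real _).symm, fun x hx => (hx.cfc_real _).symm, ?_, ?_, ?_, ?_, ?_⟩
  · exact ite_eq_or_eq _ _ _
  · rw [e2, ← cfc_mul _ _ C (hc _) (hc _)]
    refine cfc_congr fun t _ => ?_
    by_cases h : 0 < t
    · simp [χ, k₁, h]
    · simp only [χ, k₁, h, if_false]
      exact mul_inv_cancel₀ (by linarith)
  · rw [← cfc_mul _ _ C (hc _) (hc _)]
    refine cfc_congr fun t _ => ?_
    by_cases h : 0 < t <;> simp [χ, k₁, h]
  · rw [← cfc_mul _ _ C (hc _) (hc _)]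
    refine cfc_congr fun t _ => ?_
    by_cases h : 0 < t <;> simp [χ, k₁, h]
  · rw [e3, ← cfc_mul _ _ C (hc _) (hc _), e1, ← cfc_sub _ _ C (hc _) (hc _)]
    refine cfc_congr fun t _ => ?_
    by_cases h : 0 < t
    · simp only [χ, k₂, h, if_true, sub_zero]
      exact mul_inv_cancel₀ (by linarith)
    · simp [χ, k₂, h]
  · rw [e1, ← cfc_sub _ _ C (hc _) (hc _), ← cfc_mul _ _ C (hc _) (hc _)]
    refine cfc_congr fun t _ => ?_
    by_cases h : 0 < t <;> simp [χ, k₂, h]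
  · refine norm_cfc_le zero_le_one fun t _ => ?_
    by_cases h : 0 < t
    · simp [k₁, h]
    · simp only [k₁, h, if_false, norm_inv, Real.norm_eq_abs]
      rw [abs_of_pos (by linarith)]
      exact inv_le_one_of_one_le₀ (by linarith)
  · refine norm_cfc_le zero_le_one fun t _ => ?_
    by_cases h : 0 < t
    · simp only [k₂, h, if_true, norm_inv, Real.norm_eq_abs]
      rw [abs_of_pos (by linarith)]
      exact inv_le_one_of_one_le₀ (by linarith)
    · simp [k₂, h]
  · rw [StarAlgHom.map_cfc π _ C (hc _) (continuous_starAlgHom π) hC (hC.map π), hπ]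
    have : (1 : Q) = algebraMap ℝ Q 1 := by simp
    rw [this, cfc_algebraMap]
    simp [χ]

end Gap

section Gap

variable {A Q : Type*} [CStarAlgebra A] [CStarAlgebra Q]

/-- The elements of the functional calculus of `c` used to open a spectral gap at `0`. -/
theorem exists_gap_functions (π : A →⋆ₐ[ℂ] Q) {c : A} (hc : IsSelfAdjoint c)
    (hsp : ∀ t ∈ spectrum ℝ (π c), 1 ≤ |t|) :
    ∃ m C S : A, IsSelfAdjoint C ∧ IsSelfAdjoint S ∧ Commute C S ∧ C * C + S * S = 1 ∧
      ‖m‖ ≤ 1 ∧ ‖C‖ ≤ 1 ∧ ‖S‖ ≤ 1 ∧ (2 : ℂ) • (c * m) = 1 + C ∧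
      c * (1 - C) = S * cfc (fun t : ℝ => √((1 - t) / 2)) C ∧
      ‖cfc (fun t : ℝ => √((1 - t) / 2)) C‖ ≤ 1 ∧ π C = 1 ∧ π S = 0 := by
  -- Write the truncation as `cl = cos φ` with `φ ∈ [0, π]`. Then `fC = cos 2φ`, `fS = sin 2φ` and
  -- `fW = sin φ`, so `C + iS = e^{2iφ}` is unitary. On the spectrum of `π c` the truncation is
  -- `±1`, so this unitary is mapped to `1`; where `c` vanishes it takes the value `-1`.
  let cl : ℝ → ℝ := fun t => max (-1) (min 1 t)
  have hcl : Continuous cl := by fun_prop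
  have hcl1 : ∀ t, |cl t| ≤ 1 := fun t => abs_le.2 ⟨le_max_left _ _, max_le (by norm_num) (min_le_left _ _)⟩
  have hcl2 : ∀ t, 0 ≤ 1 - cl t ^ 2 := fun t => by
    have := abs_le.1 (hcl1 t); nlinarith [this.1, this.2]
  have hout : ∀ t, 1 ≤ |t| → cl t ^ 2 = 1 ∧ t * cl t = |t| := by
    intro t ht
    rcases le_abs.1 ht with h | h
    · have : cl t = 1 := by simp [cl, h]
      rw [this, abs_of_nonneg (by linarith)]; simp
    · have : cl t = -1 := by simp only [cl]; rw [max_eq_left]; exact (min_le_right _ _).trans (by linarith)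
      rw [this, abs_of_nonpos (by linarith)]; simp
  have hin : ∀ t, |t| ≤ 1 → cl t = t := by
    intro t ht
    have := abs_le.1 ht
    simp only [cl]; rw [min_eq_right this.2, max_eq_right this.1]
  -- A bounded substitute for an inverse: `t * fm t = cl t ^ 2`, which is `1` off `(-1, 1)`.
  let fm : ℝ → ℝ := fun t => cl t / max 1 |t|
  have hmax : ∀ t : ℝ, max 1 |t| ≠ 0 := fun t => (lt_of_lt_of_le one_pos (le_max_left _ _)).ne'
  have hfm : Continuous fm := hcl.div (by fun_prop) hmax
  let fC : ℝ → ℝ := fun t => 2 * cl t ^ 2 - 1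
  have hfC : Continuous fC := by fun_prop
  let fW : ℝ → ℝ := fun t => √(1 - cl t ^ 2)
  have hfW : Continuous fW := by fun_prop
  let fS : ℝ → ℝ := fun t => 2 * cl t * fW t
  have hfS : Continuous fS := by fun_prop
  have hW2 : ∀ t, fW t * fW t = 1 - cl t ^ 2 := fun t => Real.mul_self_sqrt (hcl2 t)
  have eW : cfc (fun t : ℝ => √((1 - t) / 2)) (cfc fC c) = cfc fW c := by
    rw [← cfc_comp' (fun t : ℝ => √((1 - t) / 2)) fC c
      (by fun_prop) hfC.continuousOn hc]
    refine cfc_congr fun t _ => ?_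
    simp only [fC, fW]; congr 1; ring
  have e1 : (1 : A) = cfc (fun _ : ℝ => (1 : ℝ)) c := (cfc_const_one ℝ c).symm
  have hπ : ∀ f : ℝ → ℝ, Continuous f → π (cfc f c) = cfc f (π c) := fun f hf =>
    StarAlgHom.map_cfc π f c hf.continuousOn (continuous_starAlgHom π) hc (hc.map π)
  have hCS : ∀ t, fC t * fC t + fS t * fS t = 1 := fun t => by
    have := hW2 t
    simp only [fC, fS]
    linear_combination 4 * cl t ^ 2 * this
  refine ⟨cfc fm c, cfc fC c, cfc fS c, cfc_predicate _ c, cfc_predicate _ c, cfc_commute_cfc _ _ c,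
    ?_, ?_, ?_, ?_, ?_, ?_, ?_, ?_, ?_⟩
  · rw [← cfc_mul _ _ c hfC.continuousOn hfC.continuousOn,
      ← cfc_mul _ _ c hfS.continuousOn hfS.continuousOn,
      ← cfc_add c (fun t => fC t * fC t) (fun t => fS t * fS t) (hfC.mul hfC).continuousOn
        (hfS.mul hfS).continuousOn, e1]
    exact cfc_congr fun t _ => hCS t
  · refine norm_cfc_le zero_le_one fun t _ => ?_
    simp only [fm, Real.norm_eq_abs, abs_div]
    refine div_le_one_of_le₀ ((hcl1 t).trans ((le_max_left _ _).trans (le_abs_self _))) (abs_nonneg _)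
  · refine norm_cfc_le zero_le_one fun t _ => ?_
    rw [Real.norm_eq_abs]
    exact abs_le_one_iff_mul_self_le_one.2 (by nlinarith [hCS t, mul_self_nonneg (fS t)])
  · refine norm_cfc_le zero_le_one fun t _ => ?_
    rw [Real.norm_eq_abs]
    exact abs_le_one_iff_mul_self_le_one.2 (by nlinarith [hCS t, mul_self_nonneg (fC t)])
  · have h1 : c * cfc fm c = cfc (fun t => t * fm t) c := by
      rw [cfc_mul (fun t => t) fm c continuousOn_id hfm.continuousOn, cfc_id' ℝ c]
    have hm' : ContinuousOn (fun t => t * fm t) (spectrum ℝ c) :=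
      (continuous_id.mul hfm).continuousOn
    rw [h1, two_smul, e1, ← cfc_add c _ _ hm' hm',
      ← cfc_add c (fun _ => (1 : ℝ)) fC continuousOn_const hfC.continuousOn]
    refine cfc_congr fun t _ => ?_
    have h2 : t * fm t = cl t ^ 2 := by
      simp only [fm]
      rw [mul_div_assoc', div_eq_iff (hmax t)]
      rcases le_total |t| 1 with h | h
      · rw [hin t h, max_eq_left h]; ring
      · rw [max_eq_right h, (hout t h).1, (hout t h).2, one_mul]
    simp only [h2, fC]; ring
  · rw [eW, ← cfc_mul _ _ c hfS.continuousOn hfW.continuousOn]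
    have h1 : c * (1 - cfc fC c) = cfc (fun t => t * (1 - fC t)) c := by
      rw [cfc_mul (fun t => t) (fun t => 1 - fC t) c continuousOn_id
        (continuous_const.sub hfC).continuousOn, cfc_id' ℝ c,
        cfc_sub (fun _ => (1 : ℝ)) fC c continuousOn_const hfC.continuousOn, ← e1]
    rw [h1]
    refine cfc_congr fun t _ => ?_
    simp only [fS]
    rw [mul_assoc, hW2]
    simp only [fC]
    rcases le_total |t| 1 with h | h
    · rw [hin t h]; ring
    · rw [(hout t h).1]; ring
  · rw [eW]
    refine norm_cfc_le zero_le_one fun t _ => ?_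
    rw [Real.norm_eq_abs]
    exact abs_le_one_iff_mul_self_le_one.2 (by nlinarith [hW2 t, sq_nonneg (cl t)])
  · rw [hπ _ hfC, ← cfc_const_one ℝ (π c) (hc.map π)]
    refine cfc_congr fun t ht => ?_
    simp only [fC, (hout t (hsp t ht)).1]; norm_num
  · rw [hπ _ hfS, ← cfc_const_zero ℝ (π c)]
    refine cfc_congr fun t ht => ?_
    simp only [fS, fW, (hout t (hsp t ht)).1]; simp

end Gap

section Gap

variable {A Q : Type*} [CStarAlgebra A] [CStarAlgebra Q]

/-- There is a right inverse, and by self-adjointness its adjoint is a left inverse. -/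
theorem isUnit_of_isSelfAdjoint_of_mul {c x : A} (hc : IsSelfAdjoint c) (h : ‖c * x - 1‖ < 1) :
    IsUnit c := by
  obtain ⟨v, hv⟩ := isUnit_of_norm_sub_one_lt h
  have h1 : c * (x * ↑v⁻¹) = 1 := by rw [← mul_assoc, ← hv, Units.mul_inv]
  have h2 : star (x * ↑v⁻¹) * c = 1 := by
    have := congrArg star h1
    rwa [star_mul, hc.star_eq, star_one] at this
  exact ⟨⟨c, x * ↑v⁻¹, h1, by rw [← left_inv_eq_right_inv h2 h1]; exact h2⟩, rfl⟩

/-- Replace the unitary `C + iS` of `exists_gap_functions` by a nearby one of finite spectrum, with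
real part `C'` and imaginary part `S'`. The spectral projection `r` of `C'` for `t ≤ 0` lies in the
kernel and almost reduces `c`, since `c (1 - C) = S W` is close to `S' W'`, where `W'` is a function
of `C'`. Replacing `c` by `1` on `r` leaves `(1 - r) c (1 - r) + r`, which is invertible because `2
c m = 1 + C` is close to `1 + C'`, invertible on `1 - r`. That the bound `7` does not depend on `c`
makes rescaling possible. -/
theorem IsLFKer.exists_isUnit_add_of_one_le {π : A →⋆ₐ[ℂ] Q} (hπ : IsLFKer π) {c : A}
    (hc : IsSelfAdjoint c) (hsp : ∀ t ∈ spectrum ℝ (π c), 1 ≤ |t|) :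
    ∃ y : A, IsSelfAdjoint y ∧ π y = 0 ∧ ‖y‖ ≤ 7 ∧ IsUnit (c + y) := by
  obtain ⟨m, C, S, hC, hS, hCS, hsq, hm1, hC1, hS1, hcm, hcC, hW1, hπC, hπS⟩ :=
    exists_gap_functions π hc hsp
  set g : ℝ → ℝ := fun t => √((1 - t) / 2) with hg
  set W := cfc g C with hW
  have hI : ∀ x : A, Complex.I • Complex.I • x = -x := fun x => by
    rw [smul_smul, Complex.I_mul_I, neg_one_smul]
  set u := C + Complex.I • S with hu
  have hsu : star u = C - Complex.I • S := by
    rw [hu, star_add, star_smul, hC.star_eq, hS.star_eq, Complex.star_def, Complex.conj_I, neg_smul,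
      sub_eq_add_neg]
  have hu1 : star u * u = 1 := by
    rw [hsu, hu, ← hsq]
    simp only [sub_mul, mul_add, smul_mul_assoc, mul_smul_comm, smul_sub, hI, hCS.eq]
    abel
  have hu2 : u * star u = 1 := by
    rw [hsu, hu, ← hsq]
    simp only [add_mul, mul_sub, smul_mul_assoc, mul_smul_comm, smul_add, hI, hCS.eq]
    abel
  obtain ⟨δ₀, hδ₀, hcont⟩ := exists_pos_norm_cfc_sub_lt (g := g) (by fun_prop) hC hC1
    (by norm_num : (0 : ℝ) < 1 / 16)
  -- The first bound brings `g(C')` close to `g(C)`, the second makes `c * (C' - C)` small.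
  set δ := min (δ₀ / 2) (1 / (16 * (1 + ‖c‖))) with hδ
  have hL : 0 < 1 + ‖c‖ := by positivity
  have hδ0 : 0 < δ := by positivity
  have hδL : δ * (1 + ‖c‖) ≤ 1 / 16 := by
    have : δ ≤ 1 / (16 * (1 + ‖c‖)) := min_le_right _ _
    rw [le_div_iff₀ (by positivity)] at this
    linarith
  obtain ⟨M, w, hM, hwM, hw1, hw2, hπw, hwu⟩ := hπ.exists_unitary_near hu1 hu2
    (by rw [hu, map_add, map_smul, hπC, hπS, smul_zero, add_zero]) hδ0
  have hwn : ‖w‖ ≤ 1 := norm_le_one_of_star_mul_self hw1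
  have hnorm2 : ∀ x y : A, ‖(2 : ℂ)⁻¹ • (x + y)‖ ≤ (‖x‖ + ‖y‖) / 2 := fun x y => by
    rw [norm_smul]
    have := norm_add_le x y
    simp only [norm_inv, Complex.norm_ofNat]
    linarith
  set C' := (2 : ℂ)⁻¹ • (w + star w) with hC'
  set S' := (2 : ℂ)⁻¹ • (-(Complex.I • w) + Complex.I • star w) with hS'
  have hC'sa : IsSelfAdjoint C' := by
    rw [IsSelfAdjoint, hC', star_smul, star_add, star_star, add_comm]; simp
  have hC'M : C' ∈ M := M.smul_mem (add_mem hwM (star_mem hwM)) _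
  have hC'1 : ‖C'‖ ≤ 1 := (hnorm2 _ _).trans (by rw [norm_star]; linarith)
  have hS'1 : ‖S'‖ ≤ 1 := (hnorm2 _ _).trans (by
    rw [norm_neg, norm_smul, norm_smul, norm_star, Complex.norm_I]; linarith)
  have hCeq : C = (2 : ℂ)⁻¹ • (u + star u) := by
    rw [hsu, hu, eq_inv_smul_iff₀ two_ne_zero, two_smul]; abel
  have hSeq : S = (2 : ℂ)⁻¹ • (-(Complex.I • u) + Complex.I • star u) := by
    rw [hsu, hu, eq_inv_smul_iff₀ two_ne_zero, two_smul]
    simp only [smul_add, smul_sub, hI]; abel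
  have hCC : ‖C' - C‖ ≤ δ := by
    have e : C' - C = (2 : ℂ)⁻¹ • ((w - u) + star (w - u)) := by
      rw [hC', hCeq, ← smul_sub, star_sub]; congr 1; abel
    rw [e]
    exact (hnorm2 _ _).trans (by rw [norm_star]; linarith)
  have hSS : ‖S - S'‖ ≤ δ := by
    have e : S - S' = (2 : ℂ)⁻¹ • ((Complex.I • (w - u)) + -(Complex.I • star (w - u))) := by
      rw [hS', hSeq, star_sub]; module
    rw [e]
    refine (hnorm2 _ _).trans ?_
    rw [norm_neg, norm_smul, norm_smul, norm_star, Complex.norm_I]; linarith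
  have hCS' : Commute C' S' := by
    have hww : Commute w (star w) := by rw [Commute, SemiconjBy, hw1, hw2]
    refine Commute.smul_left (Commute.smul_right ?_ _) _
    refine Commute.add_left (Commute.add_right ?_ ?_) (Commute.add_right ?_ ?_)
    · exact ((Commute.refl w).smul_right _).neg_right
    · exact hww.smul_right _
    · exact (hww.symm.smul_right _).neg_right
    · exact (Commute.refl _).smul_right _
  set W' := cfc g C' with hW'
  have hCW' : Commute C' W' := ((Commute.refl C').cfc_real g).symm
  have hWW : ‖W - W'‖ ≤ 1 / 16 :=
    (hcont C' hC'sa hC'1 (hCC.trans_lt ((min_le_left _ _).trans_lt (half_lt_self hδ₀)))).le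
  have hπC' : π C' = 1 := by
    rw [hC', map_smul, map_add, map_star, hπw, star_one, ← two_smul ℂ (1 : Q), smul_smul]; simp
  obtain ⟨r, K₁, K₂, hr, hrS, hK₁, hK₁r, hrK₁, hSK, hCK, hK₂, hK₂r, hK₁n, hK₂n, hπr⟩ :=
    exists_projection_of_unitary M hC'M hC'sa hCS' π hπC'
  have hrr : r * r = r := hr.isIdempotentElem.eq
  have hr1 : ‖r‖ ≤ 1 := hr.norm_le_one
  have hr1' : ‖1 - r‖ ≤ 1 := hr.one_sub.norm_le_one
  have hcdiff : ‖c * (C' - C)‖ ≤ 1 / 16 - δ := by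
    refine (norm_mul_le _ _).trans ?_
    nlinarith [norm_nonneg c]
  have hcr : c * r = S * W * K₁ - c * (C' - C) * K₁ := by
    rw [← hcC, ← hK₁]; noncomm_ring
  have hcr2 : ‖c * r‖ ≤ 2 := by
    rw [hcr]
    refine (norm_sub_le _ _).trans ?_
    have h1 : ‖S * W * K₁‖ ≤ 1 :=
      (norm_mul_le_of_le_one_right hK₁n).trans ((norm_mul_le_of_le_one_left hS1).trans hW1)
    have h2 : ‖c * (C' - C) * K₁‖ ≤ 1 / 16 - δ := (norm_mul_le_of_le_one_right hK₁n).trans hcdiff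
    linarith
  have hoff : ‖(1 - r) * c * r‖ ≤ 1 / 4 := by
    -- `S' W' K₁ = r S' W' K₁`, so cutting by `1 - r` removes the main part of `c r` and leaves only
    -- approximation errors.
    have hz : (1 - r) * (S' * W') * K₁ = 0 := by
      have h1 : S' * W' * K₁ = r * (S' * (W' * K₁)) := by
        rw [← mul_assoc r S', hrS.eq, mul_assoc S' r, (hCK W' hCW').eq, ← mul_assoc r, hrK₁,
          ← (hCK W' hCW').eq, mul_assoc]
      rw [mul_assoc, h1, ← mul_assoc, sub_mul, one_mul, hrr, sub_self, zero_mul]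
    have e : (1 - r) * c * r
        = (1 - r) * ((S - S') * W + S' * (W - W')) * K₁ - (1 - r) * (c * (C' - C)) * K₁ := by
      have : (1 - r) * c * r = (1 - r) * (c * r) - (1 - r) * (S' * W') * K₁ := by
        rw [hz, sub_zero, mul_assoc]
      rw [this, hcr]; noncomm_ring
    rw [e]
    refine (norm_sub_le _ _).trans ?_
    have h1 : ‖(1 - r) * ((S - S') * W + S' * (W - W')) * K₁‖ ≤ δ + 1 / 16 := by
      refine (norm_mul_le_of_le_one_right hK₁n).trans ((norm_mul_le_of_le_one_left hr1').trans ?_)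
      refine (norm_add_le _ _).trans (add_le_add ?_ ?_)
      · exact (norm_mul_le_of_le_one_right hW1).trans hSS
      · exact (norm_mul_le_of_le_one_left hS'1).trans hWW
    have h2 : ‖(1 - r) * (c * (C' - C)) * K₁‖ ≤ 1 / 16 - δ :=
      (norm_mul_le_of_le_one_right hK₁n).trans ((norm_mul_le_of_le_one_left hr1').trans hcdiff)
    linarith
  have hrc2 : ‖r * c‖ ≤ 2 := by
    rw [← norm_star, star_mul, hc.star_eq, hr.isSelfAdjoint.star_eq]; exact hcr2
  -- This is the difference between `(1 - r) c (1 - r) + r` and `c`; the bound on its norm is `1 + 2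
  -- + 2 + 2`.
  refine ⟨r - r * c - c * r + r * c * r, ?_, ?_, ?_, ?_⟩
  · rw [IsSelfAdjoint]
    simp only [star_add, star_sub, star_mul, hc.star_eq, hr.isSelfAdjoint.star_eq]
    noncomm_ring
  · simp [hπr]
  · have h1 : ‖r * c * r‖ ≤ 2 := (norm_mul_le_of_le_one_right hr1).trans hrc2
    have h2 := norm_add_le (r - r * c - c * r) (r * c * r)
    have h3 := norm_sub_le (r - r * c) (c * r)
    have h4 := norm_sub_le r (r * c)
    linarith
  · have e1 : c + (r - r * c - c * r + r * c * r) = (1 - r) * c * (1 - r) + r := by noncomm_ring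
    rw [e1]
    -- On `1 - r` the approximate right inverse is `2 m K₂`: the product `2 c m = 1 + C` is close to
    -- `1 + C'`, which `K₂` inverts there.
    refine isUnit_of_isSelfAdjoint_of_mul (x := (1 - r) * ((2 : ℂ) • m * K₂) + r) ?_ ?_
    · rw [IsSelfAdjoint]
      simp only [star_add, star_sub, star_mul, hc.star_eq, hr.isSelfAdjoint.star_eq, star_one]
      noncomm_ring
    · have hr1r : (1 - r) * r = 0 := by rw [sub_mul, one_mul, hrr, sub_self]
      have hrr1 : r * (1 - r) = 0 := by rw [mul_sub, mul_one, hrr, sub_self]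
      have hcm2 : c * ((2 : ℂ) • m) = 1 + C := by rw [mul_smul_comm, hcm]
      have e2 : ((1 - r) * c * (1 - r) + r) * ((1 - r) * ((2 : ℂ) • m * K₂) + r) - 1
          = -((1 - r) * ((C' - C) * K₂)) - (1 - r) * c * r * ((2 : ℂ) • m * K₂) := by
        have h1 : (1 - r) * (1 - r) = 1 - r := hr.one_sub.isIdempotentElem.eq
        have h2 : (1 - r) * c * ((2 : ℂ) • m * K₂) = (1 - r) * ((1 + C) * K₂) := by
          rw [mul_assoc, ← mul_assoc c, hcm2]
        have h3 : (1 - r) * ((1 + C') * K₂) = 1 - r := by rw [hK₂, h1]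
        generalize (2 : ℂ) • m * K₂ = X at h2 ⊢
        calc _ = (1 - r) * c * ((1 - r) * (1 - r)) * X
              + (1 - r) * c * ((1 - r) * r) + r * (1 - r) * X + r * r - 1 := by
                noncomm_ring
          _ = (1 - r) * c * X - (1 - r) * c * r * X - (1 - r) := by
                rw [h1, hr1r, hrr1, hrr]; noncomm_ring
          _ = (1 - r) * ((1 + C) * K₂) - (1 - r) * ((1 + C') * K₂)
              - (1 - r) * c * r * X := by rw [h2, h3]; abel
          _ = _ := by noncomm_ring
      rw [e2]
      refine (norm_sub_le _ _).trans_lt ?_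
      have h1 : ‖-((1 - r) * ((C' - C) * K₂))‖ ≤ δ := by
        rw [norm_neg]
        exact (norm_mul_le_of_le_one_left hr1').trans ((norm_mul_le_of_le_one_right hK₂n).trans hCC)
      have h2 : ‖(1 - r) * c * r * ((2 : ℂ) • m * K₂)‖ ≤ 1 / 4 * 2 := by
        refine (norm_mul_le _ _).trans (mul_le_mul hoff ?_ (norm_nonneg _) (by norm_num))
        refine (norm_mul_le_of_le_one_right hK₂n).trans ?_
        rw [norm_smul, Complex.norm_ofNat]; linarith
      have h3 : δ ≤ 1 / 16 := by nlinarith [norm_nonneg c]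
      linarith

end Gap

/-! ### Lifting orthogonal projections through an LF kernel. -/

section Lift

variable {A Q : Type*} [CStarAlgebra A] [CStarAlgebra Q]

/-- Rescale: with `κ` at most the gap of `π c`, the element `κ⁻¹ c` admits a correction of norm at
most `7`, and `7 κ < ε` because `κ ≤ ε / 8`. -/
theorem IsLFKer.exists_isUnit_add {π : A →⋆ₐ[ℂ] Q} (hπ : IsLFKer π) {c : A}
    (hc : IsSelfAdjoint c) (hu : IsUnit (π c)) {ε : ℝ} (hε : 0 < ε) :
    ∃ y : A, IsSelfAdjoint y ∧ π y = 0 ∧ ‖y‖ < ε ∧ IsUnit (c + y) := by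
  have h0 : (0 : ℝ) ∉ spectrum ℝ (π c) := spectrum.zero_notMem_iff ℝ |>.2 hu
  have hcl : IsClosed (spectrum ℝ (π c)) := spectrum.isClosed (𝕜 := ℝ) (π c)
  obtain ⟨η, hη, hball⟩ := Metric.isOpen_iff.1 hcl.isOpen_compl 0 h0
  set κ := min η (ε / 8) with hκ
  have hκ0 : 0 < κ := by positivity
  have hκ' : κ ≠ 0 := hκ0.ne'
  obtain ⟨y, hy, hπy, hy7, hyu⟩ := hπ.exists_isUnit_add_of_one_le (c := κ⁻¹ • c)
    (IsSelfAdjoint.smul (IsSelfAdjoint.all _) hc) (by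
      intro t ht
      have e : π (κ⁻¹ • c) = (Units.mk0 κ⁻¹ (inv_ne_zero hκ')) • π c := by
        rw [← Complex.coe_smul, map_smul, Complex.coe_smul]; rfl
      rw [e, spectrum.unit_smul_eq_smul, Set.mem_smul_set] at ht
      obtain ⟨s, hs, rfl⟩ := ht
      have h1 : s ∉ Metric.ball (0 : ℝ) η := fun h => hball h hs
      rw [Metric.mem_ball, dist_zero_right, Real.norm_eq_abs, not_lt] at h1
      change 1 ≤ |κ⁻¹ * s|
      rw [abs_mul, abs_of_pos (inv_pos.2 hκ0), inv_mul_eq_div, le_div_iff₀ hκ0, one_mul]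
      exact (min_le_left _ _).trans h1)
  refine ⟨κ • y, IsSelfAdjoint.smul (IsSelfAdjoint.all _) hy, ?_, ?_, ?_⟩
  · rw [← Complex.coe_smul, map_smul, hπy, smul_zero]
  · rw [norm_smul, Real.norm_eq_abs, abs_of_pos hκ0]
    have : κ ≤ ε / 8 := min_le_right _ _
    nlinarith
  · have e : c + κ • y = (Units.mk0 κ hκ') • (κ⁻¹ • c + y) := by
      rw [smul_add]; congr 1
      change c = κ • κ⁻¹ • c
      rw [smul_smul, mul_inv_cancel₀ hκ', one_smul]
    rw [e]
    exact hyu.smul _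

/-- Invertibility is an open condition, so the points can be treated one after another, each
correction being too small to close the gaps already opened. -/
theorem IsLFKer.exists_isUnit_add_sub {π : A →⋆ₐ[ℂ] Q} (hπ : IsLFKer π) {a : A}
    (ha : IsSelfAdjoint a) (T : Finset ℝ)
    (hT : ∀ t ∈ T, IsUnit (π a - algebraMap ℝ Q t)) :
    ∃ y : A, IsSelfAdjoint y ∧ π y = 0 ∧ ∀ t ∈ T, IsUnit (a + y - algebraMap ℝ A t) := by
  induction T using Finset.induction_on with
  | empty => exact ⟨0, .zero _, map_zero _, by simp⟩
  | insert t T _ ih =>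
    obtain ⟨y, hy, hπy, hyT⟩ := ih fun s hs => hT s (Finset.mem_insert_of_mem hs)
    have hev : ∀ᶠ z in 𝓝 (0 : A), ∀ s ∈ T, IsUnit (a + y + z - algebraMap ℝ A s) := by
      rw [Filter.eventually_all_finset]
      intro s hs
      have hcont : ContinuousAt (fun z : A => a + y + z - algebraMap ℝ A s) 0 := by fun_prop
      refine hcont.eventually (p := fun x => IsUnit x) ?_
      simp only [add_zero]
      exact Units.isOpen.mem_nhds (hyT s hs)
    obtain ⟨ε, hε, hball⟩ := Metric.eventually_nhds_iff.1 hev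
    have hal : ∀ t : ℝ, π (algebraMap ℝ A t) = algebraMap ℝ Q t := fun t => by
      rw [Algebra.algebraMap_eq_smul_one, Algebra.algebraMap_eq_smul_one, ← Complex.coe_smul,
        map_smul, map_one, Complex.coe_smul]
    obtain ⟨z, hz, hπz, hzε, hzu⟩ := hπ.exists_isUnit_add (c := a + y - algebraMap ℝ A t)
      ((ha.add hy).sub (IsSelfAdjoint.algebraMap A (IsSelfAdjoint.all t))) (by
        rw [map_sub, map_add, hπy, add_zero, hal]
        exact hT t (Finset.mem_insert_self _ _)) hε
    refine ⟨y + z, hy.add hz, by rw [map_add, hπy, hπz, add_zero], fun s hs => ?_⟩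
    rcases Finset.mem_insert.1 hs with rfl | hs
    · convert hzu using 1; abel
    · rw [← add_assoc]
      exact hball (by rwa [dist_zero_right]) s hs

/-- Lagrange interpolation on the spectrum. The extra nodes `T` serve an equation `h * p = t • p`
with `p = 0`, where `t` need not be in the spectrum. -/
theorem exists_polynomial_cfc {h : A} (hh : IsSelfAdjoint h) (hfin : (spectrum ℝ h).Finite)
    (f : ℝ → ℝ) (T : Finset ℝ) :
    ∃ q : Polynomial ℝ, (∀ t ∈ T, q.eval t = f t) ∧ cfc f h = Polynomial.aeval h q := by
  classical
  set s := T ∪ hfin.toFinset with hs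
  set q := Lagrange.interpolate s id f with hq
  have hev : ∀ t ∈ s, q.eval t = f t := fun t ht =>
    Lagrange.eval_interpolate_at_node f (Set.injOn_id _) ht
  refine ⟨q, fun t ht => hev t (Finset.mem_union_left _ ht), ?_⟩
  rw [← cfc_polynomial q h hh]
  refine cfc_congr fun t ht => (hev t (Finset.mem_union_right _ ?_)).symm
  simpa using ht

theorem aeval_mul_of_mul_eq_smul {h p : A} {t : ℝ} (hp : h * p = t • p) (q : Polynomial ℝ) :
    Polynomial.aeval h q * p = q.eval t • p := by
  induction q using Polynomial.induction_on' with
  | add a b ha hb => simp [add_mul, ha, hb, add_smul]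
  | monomial n c =>
    have : ∀ n : ℕ, h ^ n * p = t ^ n • p := by
      intro n
      induction n with
      | zero => simp
      | succ n ih => rw [pow_succ, mul_assoc, hp, mul_smul_comm, ih, smul_smul, pow_succ, mul_comm]
    rw [Polynomial.aeval_monomial, Polynomial.eval_monomial, mul_assoc, this, mul_smul_comm,
      ← Algebra.smul_def, smul_smul, mul_comm]

theorem cfc_mul_of_mul_eq_smul {h p : A} (hh : IsSelfAdjoint h) (hfin : (spectrum ℝ h).Finite)
    {t : ℝ} (hp : h * p = t • p) (f : ℝ → ℝ) : cfc f h * p = f t • p := by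
  obtain ⟨q, hq, hc⟩ := exists_polynomial_cfc hh hfin f {t}
  rw [hc, aeval_mul_of_mul_eq_smul hp, hq t (Finset.mem_singleton_self t)]

/-- Orthogonal families of projections summing to `1` lift along `π` if its kernel is LF. -/
theorem IsLFKer.exists_lift_projections {π : A →⋆ₐ[ℂ] Q} (hπ : IsLFKer π)
    (hsurj : Function.Surjective π) {n : ℕ} (p : Fin n → Q) (hp : ∀ j, IsStarProjection (p j))
    (hpp : ∀ j k, j ≠ k → p j * p k = 0) (hsum : ∑ j, p j = 1) :
    ∃ P : Fin n → A, (∀ j, IsStarProjection (P j)) ∧ (∀ j k, j ≠ k → P j * P k = 0) ∧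
      ∀ j, π (P j) = p j := by
  classical
  -- One self-adjoint element encodes the family: `p j` is its spectral projection at `j`.
  set h : Q := ∑ j : Fin n, ((j : ℕ) : ℝ) • p j with hh
  have hhsa : IsSelfAdjoint h := by
    rw [IsSelfAdjoint, hh, star_sum]
    refine Finset.sum_congr rfl fun j _ => ?_
    rw [star_smul, (hp j).isSelfAdjoint.star_eq, star_trivial]
  have hhp : ∀ j, h * p j = ((j : ℕ) : ℝ) • p j := fun j => by
    rw [hh, Finset.sum_mul, Finset.sum_eq_single j]
    · rw [smul_mul_assoc, (hp j).isIdempotentElem.eq]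
    · intro k _ hk
      rw [smul_mul_assoc, hpp k j hk, smul_zero]
    · simp
  have hunit : ∀ t : ℝ, (∀ j : Fin n, ((j : ℕ) : ℝ) ≠ t) → IsUnit (h - algebraMap ℝ Q t) := by
    intro t ht
    refine isUnit_of_isSelfAdjoint_of_mul (x := ∑ j : Fin n, (((j : ℕ) : ℝ) - t)⁻¹ • p j)
      (hhsa.sub (IsSelfAdjoint.algebraMap Q (IsSelfAdjoint.all t))) ?_
    have : (h - algebraMap ℝ Q t) * ∑ j : Fin n, (((j : ℕ) : ℝ) - t)⁻¹ • p j = 1 := by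
      rw [Finset.mul_sum, ← hsum]
      refine Finset.sum_congr rfl fun j _ => ?_
      rw [mul_smul_comm, sub_mul, hhp, ← Algebra.smul_def, ← sub_smul, smul_smul,
        inv_mul_cancel₀ (sub_ne_zero.2 (ht j)), one_smul]
    rw [this]; simp
  have hfin : (spectrum ℝ h).Finite := by
    refine (Set.finite_range fun j : Fin n => ((j : ℕ) : ℝ)).subset fun t ht => ?_
    by_contra hcon
    have := hunit t fun j hj => hcon ⟨j, hj⟩
    rw [spectrum.mem_iff, ← neg_sub, IsUnit.neg_iff] at ht
    exact ht this
  obtain ⟨a₀, ha₀⟩ := hsurj h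
  set a := (2 : ℝ)⁻¹ • (a₀ + star a₀) with ha
  have hasa : IsSelfAdjoint a := by
    rw [IsSelfAdjoint, ha, star_smul, star_add, star_star, add_comm, star_trivial]
  have hπa : π a = h := by
    rw [ha, ← Complex.coe_smul, map_smul, map_add, map_star, ha₀, hhsa.star_eq, Complex.coe_smul,
      ← two_smul ℝ h, smul_smul]
    norm_num
  -- The half-integers `-1/2, …, n - 1/2` separate the eigenvalues `0, …, n - 1`. Once a lift has
  -- gaps there, the characteristic functions of the intervals between them are continuous on its
  -- spectrum and give the lifted projections.
  set T : Finset ℝ := (Finset.range (n + 1)).image fun k : ℕ => (k : ℝ) - 1 / 2 with hT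
  have hTne : ∀ (k : ℕ) (j : Fin n), ((j : ℕ) : ℝ) ≠ (k : ℝ) - 1 / 2 := by
    intro k j hjk
    have : (2 * (j : ℕ) + 1 : ℤ) = 2 * k := by
      have : (2 * ((j : ℕ) : ℝ) + 1 : ℝ) = 2 * (k : ℝ) := by rw [hjk]; ring
      exact_mod_cast this
    omega
  obtain ⟨y, hy, hπy, hyT⟩ := hπ.exists_isUnit_add_sub hasa T (by
    intro t ht
    obtain ⟨k, -, rfl⟩ := Finset.mem_image.1 ht
    rw [hπa]
    exact hunit _ (hTne k))
  set b := a + y with hb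
  have hbsa : IsSelfAdjoint b := hasa.add hy
  have hπb : π b = h := by rw [hb, map_add, hπa, hπy, add_zero]
  have hnot : ∀ k : ℕ, k ≤ n → (k : ℝ) - 1 / 2 ∉ spectrum ℝ b := by
    intro k hk hmem
    rw [spectrum.mem_iff, ← neg_sub, IsUnit.neg_iff] at hmem
    exact hmem (hyT _ (Finset.mem_image.2 ⟨k, Finset.mem_range.2 (by omega), rfl⟩))
  let f : ℕ → ℝ → ℝ := fun k t =>
    (if (k : ℝ) - 1 / 2 < t then 1 else 0) - (if ((k + 1 : ℕ) : ℝ) - 1 / 2 < t then 1 else 0)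
  have hf : ∀ k : ℕ, k < n → ContinuousOn (f k) (spectrum ℝ b) := fun k hk =>
    (continuousOn_ite_lt (hnot k hk.le)).sub (continuousOn_ite_lt (hnot (k + 1) hk))
  have hf1 : ∀ (k : ℕ) (t : ℝ), f k t =
      if (k : ℝ) < t + 1 / 2 ∧ t + 1 / 2 ≤ k + 1 then 1 else 0 := by
    intro k t
    simp only [f]
    push_cast
    split_ifs with h1 h2 h3 h3 h2 h3 h3 <;> first | (norm_num; done) | (exfalso; grind)
  refine ⟨fun j => cfc (f j) b, fun j => isStarProjection_cfc (hf j j.2) fun t _ => ?_,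
    fun j k hjk => ?_, fun j => ?_⟩
  · rw [hf1]; exact (ite_eq_or_eq _ _ _).symm
  · rw [← cfc_mul _ _ b (hf j j.2) (hf k k.2), ← cfc_zero ℝ b]
    refine cfc_congr fun t _ => ?_
    simp only [hf1, Pi.zero_apply]
    split_ifs with h1 h2 <;> try norm_num
    refine hjk (Fin.ext ?_)
    have h3 : (j : ℕ) < (k : ℕ) + 1 := by exact_mod_cast h1.1.trans_le h2.2
    have h4 : (k : ℕ) < (j : ℕ) + 1 := by exact_mod_cast h2.1.trans_le h1.2
    omega
  · rw [StarAlgHom.map_cfc π _ b (hf j j.2) (continuous_starAlgHom π) hbsa (hbsa.map π), hπb]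
    have h1 : ∀ k : Fin n, cfc (f j) h * p k = f j ((k : ℕ) : ℝ) • p k := fun k =>
      cfc_mul_of_mul_eq_smul hhsa hfin (hhp k) _
    rw [← mul_one (cfc (f j) h), ← hsum, Finset.mul_sum, Finset.sum_eq_single j]
    · rw [h1, hf1, if_pos, one_smul]
      constructor <;> linarith
    · intro k _ hkj
      rw [h1, hf1, if_neg, zero_smul]
      rintro ⟨h2, h3⟩
      refine hkj (Fin.ext ?_)
      have h4 : (j : ℕ) < (k : ℕ) + 1 := by
        have : ((j : ℕ) : ℝ) < (k : ℕ) + 1 := by linarith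
        exact_mod_cast this
      have h5 : (k : ℕ) < (j : ℕ) + 1 := by
        have : ((k : ℕ) : ℝ) < (j : ℕ) + 1 := by linarith
        exact_mod_cast this
      omega
    · simp

end Lift

/-! ### Matrix units of finite-dimensional C*-algebras. -/

section MatrixUnits

variable {Q : Type*} [CStarAlgebra Q]

/-- `p` is a projection of `F` with `p F p ⊆ ℂ p`. -/
def IsMinimalIn (F : StarSubalgebra ℂ Q) (p : Q) : Prop :=
  p ∈ F ∧ IsStarProjection p ∧ p ≠ 0 ∧ ∀ x ∈ F, ∃ z : ℂ, p * x * p = z • p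

/-- The corner `p F p`. -/
def cornerSubmodule (F : StarSubalgebra ℂ Q) (p : Q) : Submodule ℂ Q where
  carrier := {x | x ∈ F ∧ p * x * p = x}
  add_mem' := by
    rintro a b ⟨ha, ha'⟩ ⟨hb, hb'⟩
    exact ⟨add_mem ha hb, by rw [mul_add, add_mul, ha', hb']⟩
  zero_mem' := ⟨zero_mem _, by simp⟩
  smul_mem' := by
    rintro c a ⟨ha, ha'⟩
    exact ⟨F.smul_mem ha c, by rw [mul_smul_comm, smul_mul_assoc, ha']⟩

theorem finiteDimensional_cornerSubmodule (F : StarSubalgebra ℂ Q) [FiniteDimensional ℂ F]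
    (p : Q) : FiniteDimensional ℂ (cornerSubmodule F p) := by
  have : FiniteDimensional ℂ F.toSubalgebra.toSubmodule := ‹FiniteDimensional ℂ F›
  exact Submodule.finiteDimensional_of_le (S₂ := F.toSubalgebra.toSubmodule) fun x hx => hx.1

/-- A projection of a finite-dimensional algebra that is not minimal has a proper nonzero
subprojection. -/
theorem exists_subprojection (F : StarSubalgebra ℂ Q) [FiniteDimensional ℂ F] {p : Q}
    (hpF : p ∈ F) (hp : IsStarProjection p) {x : Q} (hxF : x ∈ F)
    (hx : ∀ z : ℂ, p * x * p ≠ z • p) :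
    ∃ e ∈ F, IsStarProjection e ∧ p * e = e ∧ e * p = e ∧ e ≠ 0 ∧ e ≠ p := by
  classical
  have hps := hp.isSelfAdjoint.star_eq
  have hpp := hp.isIdempotentElem.eq
  -- If all self-adjoint elements of the corner were multiples of `p`, so would `p * x * p` be,
  -- through its real and imaginary parts.
  obtain ⟨y, hyF, hysa, hpy, hyp, hyne⟩ : ∃ y ∈ F, IsSelfAdjoint y ∧ p * y = y ∧ y * p = y ∧
      ∀ z : ℂ, y ≠ z • p := by
    by_contra! hcon
    set a := p * x * p with ha
    have haF : a ∈ F := mul_mem (mul_mem hpF hxF) hpF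
    have hpa : p * a = a := by rw [ha, ← mul_assoc, ← mul_assoc, hpp]
    have hap : a * p = a := by rw [ha, mul_assoc, hpp]
    have hpsa : p * star a = star a := by
      conv_rhs => rw [← hap, star_mul, hps]
    have hsap : star a * p = star a := by
      conv_rhs => rw [← hpa, star_mul, hps]
    obtain ⟨z₁, hz₁⟩ := hcon (a + star a) (add_mem haF (star_mem haF)) (IsSelfAdjoint.add_star_self a)
      (by rw [mul_add, hpa, hpsa]) (by rw [add_mul, hap, hsap])
    obtain ⟨z₂, hz₂⟩ := hcon (Complex.I • (a - star a))
      (F.smul_mem (sub_mem haF (star_mem haF)) _) (by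
        rw [IsSelfAdjoint, star_smul, star_sub, star_star, Complex.star_def, Complex.conj_I]
        module)
      (by rw [mul_smul_comm, mul_sub, hpa, hpsa]) (by rw [smul_mul_assoc, sub_mul, hap, hsap])
    refine hx ((2 : ℂ)⁻¹ * (z₁ - Complex.I * z₂)) ?_
    have : a = (2 : ℂ)⁻¹ • ((a + star a) - Complex.I • Complex.I • (a - star a)) := by
      rw [smul_smul Complex.I, Complex.I_mul_I]; module
    rw [this, hz₁, hz₂]; module
  have hfin := finite_spectrum_of_mem F hyF
  have hcomm : Commute y p := by rw [Commute, SemiconjBy, hpy, hyp]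
  let χ : ℝ → ℝ → ℝ := fun t s => if s = t then 1 else 0
  let e : ℝ → Q := fun t => cfc (χ t) y * p
  have hc : ∀ f : ℝ → ℝ, ContinuousOn f (spectrum ℝ y) := fun f => hfin.continuousOn f
  have hproj : ∀ t, IsStarProjection (cfc (χ t) y) := fun t =>
    isStarProjection_cfc (hc _) fun s _ => (ite_eq_or_eq _ _ _).symm
  have hcommχ : ∀ t, Commute (cfc (χ t) y) p := fun t => hcomm.cfc_real _
  have hsum2 : ∑ t ∈ hfin.toFinset, t • e t = y := by
    have : ∑ t ∈ hfin.toFinset, t • cfc (χ t) y = y := by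
      have h1 : ∀ t, t • cfc (χ t) y = cfc (fun s => t • χ t s) y := fun t =>
        (cfc_smul t (χ t) y (hc _)).symm
      simp only [h1]
      rw [← cfc_sum (fun t s => t • χ t s) y hfin.toFinset fun t _ => hc _]
      conv_rhs => rw [← cfc_id' ℝ y]
      refine cfc_congr fun s hs => ?_
      simp [χ, hs]
    simp only [e, ← smul_mul_assoc]
    rw [← Finset.sum_mul, this, hyp]
  -- Otherwise each spectral projection of `y`, cut by `p`, is `0` or `p`, and `y` would be a
  -- multiple of `p`.
  by_contra! hcon
  have hall : ∀ t, e t = 0 ∨ e t = p := by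
    intro t
    by_contra! h
    refine h.2 (hcon (e t) (mul_mem (cfc_mem_of_finiteDimensional F hyF _) hpF) ?_ ?_ ?_ h.1)
    · exact (hproj t).mul hp (hcommχ t)
    · simp only [e]
      rw [← mul_assoc, ← (hcommχ t).eq, mul_assoc, hpp]
    · simp only [e]
      rw [mul_assoc, hpp]
  have : ∀ t, ∃ z : ℂ, t • e t = z • p := fun t => by
    rcases hall t with h | h
    · exact ⟨0, by rw [h]; simp⟩
    · exact ⟨t, by rw [h, Complex.coe_smul]⟩
  choose z hz using this
  refine hyne (∑ t ∈ hfin.toFinset, z t) ?_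
  rw [Finset.sum_smul]
  refine hsum2.symm.trans ?_
  exact Finset.sum_congr rfl fun t _ => hz t

/-- Induction on the dimension of the corner: a projection that is not minimal splits into two
proper subprojections, whose corners are smaller because they do not contain `p`. -/
theorem exists_minimal_decomposition (F : StarSubalgebra ℂ Q) [FiniteDimensional ℂ F] (d : ℕ) :
    ∀ p ∈ F, IsStarProjection p → Module.finrank ℂ (cornerSubmodule F p) ≤ d →
      ∃ s : Finset Q, (∀ q ∈ s, IsMinimalIn F q) ∧ (∀ q ∈ s, ∀ q' ∈ s, q ≠ q' → q * q' = 0) ∧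
        ∑ q ∈ s, q = p := by
  classical
  induction d using Nat.strong_induction_on with
  | _ d ih =>
  intro p hpF hp hd
  by_cases hp0 : p = 0
  · exact ⟨∅, by simp, by simp, by simp [hp0]⟩
  by_cases hmin : ∀ x ∈ F, ∃ z : ℂ, p * x * p = z • p
  · exact ⟨{p}, by simpa using ⟨hpF, hp, hp0, hmin⟩, by simp, by simp⟩
  push Not at hmin
  obtain ⟨x, hxF, hx⟩ := hmin
  obtain ⟨e, heF, he, hpe, hep, he0, hene⟩ := exists_subprojection F hpF hp hxF hx
  have hpp := hp.isIdempotentElem.eq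
  have hee := he.isIdempotentElem.eq
  have hlt : ∀ q : Q, q ∈ F → p * q = q → q * p = q → q ≠ p → q * q = q →
      Module.finrank ℂ (cornerSubmodule F q) < d := by
    intro q _ hpq hqp hqne hqq
    have := finiteDimensional_cornerSubmodule F p
    refine (Submodule.finrank_lt_finrank_of_lt (t := cornerSubmodule F p) ?_).trans_le hd
    refine lt_of_le_of_ne (fun a ha => ⟨ha.1, ?_⟩) fun heq => ?_
    · rw [← ha.2]
      calc p * (q * a * q) * p = (p * q) * a * (q * p) := by noncomm_ring
        _ = q * a * q := by rw [hpq, hqp]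
    · have hmem : p ∈ cornerSubmodule F p := ⟨hpF, by rw [hpp, hpp]⟩
      rw [← heq] at hmem
      apply hqne
      have := hmem.2
      rw [hqp, hqq] at this
      exact this
  have hpe' : IsStarProjection (p - e) := by
    refine ⟨?_, hp.isSelfAdjoint.sub he.isSelfAdjoint⟩
    rw [IsIdempotentElem, mul_sub, sub_mul, sub_mul, hpp, hep, hpe, hee]; abel
  obtain ⟨s₁, hs₁, ho₁, hsum₁⟩ := ih _ (hlt e heF hpe hep hene hee) e heF he le_rfl
  obtain ⟨s₂, hs₂, ho₂, hsum₂⟩ := ih _ (hlt (p - e) (sub_mem hpF heF)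
    (by rw [mul_sub, hpp, hpe]) (by rw [sub_mul, hpp, hep])
    (fun h => he0 (by simpa using h)) hpe'.isIdempotentElem.eq) (p - e) (sub_mem hpF heF) hpe' le_rfl
  have habs : ∀ (s : Finset Q) (f : Q), (∀ q ∈ s, IsMinimalIn F q) →
      (∀ q ∈ s, ∀ q' ∈ s, q ≠ q' → q * q' = 0) → ∑ q ∈ s, q = f → ∀ q ∈ s, q * f = q ∧ f * q = q := by
    intro s f hs ho hf q hq
    have hqq := (hs q hq).2.1.isIdempotentElem.eq
    rw [← hf]
    constructor
    · rw [Finset.mul_sum, Finset.sum_eq_single q, hqq]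
      · exact fun q' hq' hne => ho q hq q' hq' (Ne.symm hne)
      · exact fun h => absurd hq h
    · rw [Finset.sum_mul, Finset.sum_eq_single q, hqq]
      · exact fun q' hq' hne => ho q' hq' q hq hne
      · exact fun h => absurd hq h
  have hcross : ∀ q ∈ s₁, ∀ q' ∈ s₂, q * q' = 0 ∧ q' * q = 0 := by
    intro q hq q' hq'
    have h1 := habs s₁ e hs₁ ho₁ hsum₁ q hq
    have h2 := habs s₂ (p - e) hs₂ ho₂ hsum₂ q' hq'
    constructor
    · rw [← h1.1, ← h2.2, mul_assoc, ← mul_assoc e, mul_sub, hep, hee, sub_self, zero_mul, mul_zero]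
    · rw [← h1.2, ← h2.1, mul_assoc, ← mul_assoc (p - e), sub_mul, hpe, hee, sub_self, zero_mul,
        mul_zero]
  refine ⟨s₁ ∪ s₂, ?_, ?_, ?_⟩
  · intro q hq
    rcases Finset.mem_union.1 hq with h | h
    exacts [hs₁ q h, hs₂ q h]
  · intro q hq q' hq' hne
    rcases Finset.mem_union.1 hq with h | h <;> rcases Finset.mem_union.1 hq' with h' | h'
    exacts [ho₁ q h q' h' hne, (hcross q h q' h').1, (hcross q' h' q h).2, ho₂ q h q' h' hne]
  · rw [Finset.sum_union, hsum₁, hsum₂]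
    · abel
    · rw [Finset.disjoint_left]
      intro q h h'
      have := (hcross q h q h').1
      rw [(hs₁ q h).2.1.isIdempotentElem.eq] at this
      exact (hs₁ q h).2.2.1 this

/-- By the C*-identity, the squared norm of the difference of the two sides is that of `p³ - 2p² + p
= 0`. -/
theorem mul_star_mul_self {v p : Q} (hv : star v * v = p) (hp : p * p = p) :
    v * star v * v = v := by
  have h0 : v * star v * v - v = 0 := by
    rw [← CStarRing.star_mul_self_eq_zero_iff]
    have e : star (v * star v * v - v) * (v * star v * v - v)
        = (star v * v) * (star v * v) * (star v * v) - (star v * v) * (star v * v)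
          - (star v * v) * (star v * v) + star v * v := by
      simp only [star_sub, star_mul, star_star]; noncomm_ring
    rw [e, hv, hp, hp]; abel
  exact sub_eq_zero.1 h0

/-- Two minimal projections connected by an element of `F` are equivalent in `F`. -/
theorem exists_partialIsometry {F : StarSubalgebra ℂ Q} {p q : Q} (hp : IsMinimalIn F p)
    (hq : IsMinimalIn F q) {x : Q} (hx : x ∈ F) (hne : p * x * q ≠ 0) :
    ∃ w ∈ F, star w * w = q ∧ w * star w = p := by
  set y := p * x * q with hy
  obtain ⟨hpF, hpp, -, hpmin⟩ := hp
  obtain ⟨hqF, hqq, hq0, hqmin⟩ := hq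
  have hps := hpp.isSelfAdjoint.star_eq
  have hqs := hqq.isSelfAdjoint.star_eq
  have hpi := hpp.isIdempotentElem.eq
  have hqi := hqq.isIdempotentElem.eq
  have hyF : y ∈ F := mul_mem (mul_mem hpF hx) hqF
  have hyq : y * q = y := by rw [hy, mul_assoc, hqi]
  have hpy : p * y = y := by rw [hy, ← mul_assoc, ← mul_assoc, hpi]
  clear_value y
  have hqy : q * star y = star y := by conv_rhs => rw [← hyq, star_mul, hqs]
  have hyp : star y * p = star y := by conv_rhs => rw [← hpy, star_mul, hps]
  obtain ⟨z, hz⟩ := hqmin _ (mul_mem (star_mem hyF) hyF)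
  obtain ⟨z', hz'⟩ := hpmin _ (mul_mem hyF (star_mem hyF))
  have hz : star y * y = z • q := by rw [← hz, ← mul_assoc, hqy, mul_assoc, hyq]
  have hz' : y * star y = z' • p := by rw [← hz', ← mul_assoc, hpy, mul_assoc, hyp]
  have hz0 : z ≠ 0 := by
    rintro rfl
    rw [zero_smul, CStarRing.star_mul_self_eq_zero_iff] at hz
    exact hne hz
  -- Compute `y y* y` in two ways.
  have hzz : z = z' := by
    have h1 : y * (star y * y) = z • y := by rw [hz, mul_smul_comm, hyq]
    have h2 : y * star y * y = z' • y := by rw [hz', smul_mul_assoc, hpy]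
    rw [← mul_assoc, h2] at h1
    have : (z' - z) • y = 0 := by rw [sub_smul, h1, sub_self]
    rcases smul_eq_zero.1 this with h | h
    · exact (sub_eq_zero.1 h).symm
    · exact absurd h hne
  subst hzz
  have hzreal : star z = z := by
    have h1 : star (z • q) = z • q := by rw [← hz, star_mul, star_star]
    rw [star_smul, hqs] at h1
    have : (star z - z) • q = 0 := by rw [sub_smul, h1, sub_self]
    rcases smul_eq_zero.1 this with h | h
    · exact sub_eq_zero.1 h
    · exact absurd h hq0
  obtain ⟨t, rfl⟩ : ∃ t : ℝ, (t : ℂ) = z := Complex.conj_eq_iff_real.1 hzreal |>.imp fun _ h => h.symm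
  have ht0 : t ≠ 0 := by exact_mod_cast hz0
  have htpos : 0 < t := by
    let _ := CStarAlgebra.spectralOrder Q
    have _ := CStarAlgebra.spectralOrderedRing Q
    by_contra hneg
    have hq_nonneg : 0 ≤ q := by rw [← hqi]; nth_rewrite 1 [← hqs]; exact star_mul_self_nonneg q
    have h1 : 0 ≤ star y * y := star_mul_self_nonneg y
    have h2 : 0 ≤ (-t) • q := smul_nonneg (by linarith [not_lt.1 hneg]) hq_nonneg
    have h3 : star y * y = 0 := by
      refine le_antisymm ?_ h1
      rw [hz, Complex.coe_smul, ← neg_nonneg, ← neg_smul]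
      exact h2
    exact hne ((CStarRing.star_mul_self_eq_zero_iff _).1 h3)
  have hsq : (√t)⁻¹ * ((√t)⁻¹ * t) = 1 := by
    have h1 : √t * √t = t := Real.mul_self_sqrt htpos.le
    have h2 : √t ≠ 0 := (Real.sqrt_pos.2 htpos).ne'
    field_simp
    nlinarith
  refine ⟨((√t)⁻¹ : ℝ) • y, ?_, ?_, ?_⟩
  · rw [← Complex.coe_smul]; exact F.smul_mem hyF _
  · rw [star_smul, star_trivial, smul_mul_smul_comm, hz, Complex.coe_smul, smul_smul, mul_assoc, hsq,
      one_smul]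
  · rw [star_smul, star_trivial, smul_mul_smul_comm, hz', Complex.coe_smul, smul_smul, mul_assoc, hsq,
      one_smul]

/-- A finite-dimensional unital algebra is spanned by a system of matrix units `w j * star (w k)`. -/
theorem exists_matrixUnits (F : StarSubalgebra ℂ Q) [FiniteDimensional ℂ F] :
    ∃ (n : ℕ) (p w : Fin n → Q) (r : Fin n → Fin n), (∀ j, IsStarProjection (p j)) ∧
      (∀ j k, j ≠ k → p j * p k = 0) ∧ ∑ j, p j = 1 ∧ (∀ j, star (w j) * w j = p (r j)) ∧
      (∀ j, w j * star (w j) = p j) ∧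
      ∀ x ∈ F, ∃ c : Fin n → Fin n → ℂ, x = ∑ j, ∑ k, c j k • (w j * star (w k)) := by
  classical
  obtain ⟨s, hs, ho, hsum⟩ := exists_minimal_decomposition F _ 1 (one_mem F) (.one Q) le_rfl
  let ι := s.equivFin.symm
  let p : Fin s.card → Q := fun j => ι j
  have hmin : ∀ j, IsMinimalIn F (p j) := fun j => hs _ (ι j).2
  have horth : ∀ j k, j ≠ k → p j * p k = 0 := fun j k hjk =>
    ho _ (ι j).2 _ (ι k).2 fun h => hjk (ι.injective (Subtype.ext h))
  have hp1 : ∑ j, p j = 1 := by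
    rw [← hsum, ← Finset.sum_coe_sort s]
    exact Equiv.sum_comp ι fun q => (q : Q)
  have hstar : ∀ j, star (p j) = p j := fun j => (hmin j).2.1.isSelfAdjoint.star_eq
  have hidem : ∀ j, p j * p j = p j := fun j => (hmin j).2.1.isIdempotentElem.eq
  -- The relation of lying in the same matrix block. It is transitive because partial isometries
  -- connecting minimal projections compose; `r` then picks one projection from each block, and `w
  -- j` carries it to `p j`.
  let R : Fin s.card → Fin s.card → Prop := fun j k => ∃ x ∈ F, p j * x * p k ≠ 0
  have hsymm : ∀ {j k}, R j k → R k j := by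
    rintro j k ⟨x, hx, hne⟩
    refine ⟨star x, star_mem hx, fun h => hne ?_⟩
    rw [← star_eq_zero, ← h, star_mul, star_mul, hstar, hstar, mul_assoc]
  let S : Setoid (Fin s.card) :=
    { r := R
      iseqv := ⟨fun j => ⟨1, one_mem _, by rw [mul_one, hidem]; exact (hmin j).2.2.1⟩, hsymm, by
        rintro j k l ⟨x, hx, hxne⟩ ⟨y, hy, hyne⟩
        obtain ⟨v, hv, hv1, hv2⟩ := exists_partialIsometry (hmin j) (hmin k) hx hxne
        obtain ⟨w, hw, hw1, hw2⟩ := exists_partialIsometry (hmin k) (hmin l) hy hyne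
        refine ⟨v * w, mul_mem hv hw, fun h => (hmin l).2.2.1 ?_⟩
        have h1 : star (v * w) * (v * w) = p l := by
          calc star (v * w) * (v * w) = star w * (star v * v) * w := by rw [star_mul]; noncomm_ring
            _ = star w * w * (star w * w) := by rw [hv1, ← hw2]; noncomm_ring
            _ = p l := by rw [hw1, hidem]
        have h2 : p j * (v * w) * p l = v * w := by
          rw [← hv2, ← hw1]
          calc v * star v * (v * w) * (star w * w) = v * (star v * v) * ((w * star w) * w) := by
                noncomm_ring
            _ = v * (star v * v * (star v * v)) * w := by rw [hw2, hv1]; noncomm_ring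
            _ = v * star v * v * w := by rw [hv1, hidem, ← hv1]; noncomm_ring
            _ = v * w := by rw [mul_star_mul_self hv1 (hidem k)]
        rw [h2] at h
        rw [← h1, h, mul_zero]⟩ }
  let r : Fin s.card → Fin s.card := fun j => (Quotient.mk S j).out
  have hr : ∀ j, R j (r j) := fun j => hsymm (Quotient.mk_out (s := S) j)
  have hr' : ∀ j k, R j k → r j = r k := fun j k h => by
    simp only [r]; rw [Quotient.sound (s := S) h]
  have hex : ∀ j, ∃ w ∈ F, star w * w = p (r j) ∧ w * star w = p j := fun j => by
    obtain ⟨x, hx, hne⟩ := hr j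
    exact exists_partialIsometry (hmin j) (hmin _) hx hne
  choose w hwF hw1 hw2 using hex
  refine ⟨s.card, p, w, r, fun j => (hmin j).2.1, horth, hp1, hw1, hw2, fun x hx => ?_⟩
  -- For `j` and `k` in one block, transport by `w j` and `w k` moves `x` into the one-dimensional
  -- corner at their common representative.
  have hcoef : ∀ j k, ∃ c : ℂ, p j * x * p k = c • (w j * star (w k)) := by
    intro j k
    by_cases h0 : p j * x * p k = 0
    · exact ⟨0, by rw [h0, zero_smul]⟩
    · have hrr := hr' j k ⟨x, hx, h0⟩
      obtain ⟨z, hz⟩ := (hmin (r j)).2.2.2 (star (w j) * x * w k)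
        (mul_mem (mul_mem (star_mem (hwF j)) hx) (hwF k))
      refine ⟨z, ?_⟩
      calc p j * x * p k = (p j * p j) * x * (p k * p k) := by rw [hidem, hidem]
        _ = w j * ((star (w j) * w j) * (star (w j) * x * w k) * (star (w k) * w k)) * star (w k) := by
            rw [← hw2, ← hw2]; noncomm_ring
        _ = z • (w j * p (r j) * star (w k)) := by
            rw [hw1, hw1, ← hrr, hz, mul_smul_comm, smul_mul_assoc]
        _ = z • ((w j * star (w j)) * (w j * star (w k))) := by rw [← hw1]; noncomm_ring
        _ = z • (w j * star (w k)) := by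
            congr 1
            rw [hw2, ← hw2]
            rw [← mul_assoc, mul_star_mul_self (hw1 j) (hidem _)]
  choose c hc using hcoef
  refine ⟨c, ?_⟩
  calc x = (∑ j, p j) * x * (∑ k, p k) := by rw [hp1, one_mul, mul_one]
    _ = ∑ j, ∑ k, p j * x * p k := by simp only [Finset.sum_mul, Finset.mul_sum]; rw [Finset.sum_comm]
    _ = _ := by simp only [hc]

end MatrixUnits

/-! ### Projections in LF ideals. -/

section Approximation

variable {A Q : Type*} [CStarAlgebra A] [CStarAlgebra Q]

/-- Together with `cfc_ite_eq_mul`, this places spectral projections away from `0` in `B` itself and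
not only in `adjoinOne B`. -/
theorem mem_of_mem_adjoinOne_mul {B : NonUnitalStarSubalgebra ℂ A} {b x : A} (hb : b ∈ B)
    (hx : x ∈ adjoinOne B) : b * x ∈ B := by
  obtain ⟨z, c, hc, rfl⟩ := hx
  rw [mul_add, mul_smul_comm, mul_one]
  exact add_mem (SMulMemClass.smul_mem z hb) (mul_mem hb hc)

/-- A characteristic function vanishing near `0` is divisible by `t`. The spectral projection thus
inherits from `x` membership in ideals and relations such as `P * x = x`. -/
theorem cfc_ite_eq_mul {x : A} (hx : IsSelfAdjoint x) {s : ℝ → Prop} [DecidablePred s]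
    (hc : ContinuousOn (fun t : ℝ => if s t then (1 : ℝ) else 0) (spectrum ℝ x))
    (h0 : ∀ᶠ t in 𝓝 0, ¬ s t) :
    cfc (fun t : ℝ => if s t then (1 : ℝ) else 0) x
      = x * cfc (fun t : ℝ => t⁻¹ * if s t then (1 : ℝ) else 0) x := by
  have hcont : ContinuousOn (fun t : ℝ => t⁻¹ * if s t then (1 : ℝ) else 0) (spectrum ℝ x) := by
    intro t ht
    by_cases h : t = 0
    · refine ContinuousAt.continuousWithinAt ?_
      refine (continuousAt_const (y := (0 : ℝ))).congr ?_
      rw [h]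
      filter_upwards [h0] with u hu
      rw [if_neg hu, mul_zero]
    · exact (continuousAt_inv₀ h).continuousWithinAt.mul (hc t ht)
  have e : x * cfc (fun t : ℝ => t⁻¹ * if s t then (1 : ℝ) else 0) x
      = cfc (fun t : ℝ => t * (t⁻¹ * if s t then (1 : ℝ) else 0)) x := by
    rw [cfc_mul (fun t => t) _ x continuousOn_id hcont, cfc_id' ℝ x]
  rw [e]
  refine cfc_congr fun t _ => ?_
  by_cases h : t = 0
  · subst h; simp [h0.self_of_nhds]
  · rw [mul_inv_cancel_left₀ h]

/-- A contraction of `A` lifting `π z` up to the norm of `π z`. -/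
theorem exists_ker_norm_sub_le (π : A →⋆ₐ[ℂ] Q) {z : A} {ε : ℝ} (hε : 0 < ε) (hz : ‖π z‖ ≤ ε) :
    ∃ y, π y = 0 ∧ ‖z - y‖ ≤ ε := by
  -- `k` is `1` on `[0, ε²]` and `t k(t)² ≤ ε²` for `t ≥ 0`. So `z k(z* z)` has the same image as
  -- `z` and norm at most `ε`.
  let k : ℝ → ℝ := fun t => ε / max ε (√t)
  have hmax : ∀ t, 0 < max ε (√t) := fun t => lt_max_of_lt_left hε
  have hk : Continuous k := continuous_const.div (by fun_prop) fun t => (hmax t).ne'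
  set h := star z * z with hh
  have hsa : IsSelfAdjoint h := .star_mul_self z
  have hK : IsSelfAdjoint (cfc k h) := cfc_predicate _ _
  refine ⟨z - z * cfc k h, ?_, ?_⟩
  · rw [map_sub, map_mul,
      StarAlgHom.map_cfc π k h hk.continuousOn (continuous_starAlgHom π) hsa (hsa.map π)]
    have : cfc k (π h) = 1 := by
      rw [← cfc_const_one ℝ (π h) (hsa.map π)]
      refine cfc_congr fun t ht => ?_
      have h1 := spectrum.norm_le_norm_mul_of_mem ht
      rw [hh, map_mul, map_star, CStarRing.norm_star_mul_self] at h1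
      have h2 : t ≤ ε ^ 2 := by
        have := norm_one_le (A := Q)
        have h3 : ‖π z‖ * ‖π z‖ ≤ ε ^ 2 := by nlinarith [norm_nonneg (π z)]
        have h4 : t ≤ ‖t‖ := le_abs_self t
        nlinarith [norm_nonneg (π z), norm_nonneg (1 : Q),
          mul_nonneg (norm_nonneg (π z)) (norm_nonneg (π z))]
      have h3 : √t ≤ ε := Real.sqrt_le_iff.2 ⟨hε.le, h2⟩
      simp only [k]
      rw [max_eq_left h3, div_self hε.ne']
    rw [this, mul_one, sub_self]
  · rw [sub_sub_cancel]
    have h1 : ‖z * cfc k h‖ * ‖z * cfc k h‖ ≤ ε ^ 2 := by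
      rw [← CStarRing.norm_star_mul_self, star_mul, hK.star_eq]
      have e : cfc k h * star z * (z * cfc k h) = cfc (fun t => k t * (t * k t)) h := by
        rw [cfc_mul k (fun t => t * k t) h hk.continuousOn (continuous_id.mul hk).continuousOn,
          cfc_mul (fun t => t) k h continuousOn_id hk.continuousOn, cfc_id' ℝ h, hh]
        noncomm_ring
      rw [e]
      refine norm_cfc_le (by positivity) fun t ht => ?_
      have ht0 : 0 ≤ t := by
        let _ := CStarAlgebra.spectralOrder A
        have _ := CStarAlgebra.spectralOrderedRing A
        exact spectrum_nonneg_of_nonneg (star_mul_self_nonneg z) ht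
      have h2 : k t * √t ≤ ε := by
        simp only [k]
        rw [div_mul_eq_mul_div, div_le_iff₀ (hmax t)]
        exact mul_le_mul_of_nonneg_left (le_max_right _ _) hε.le
      have h3 : 0 ≤ k t := div_nonneg hε.le (hmax t).le
      have h4 : k t * (t * k t) = (k t * √t) ^ 2 := by
        rw [mul_pow, Real.sq_sqrt ht0]; ring
      rw [h4, Real.norm_eq_abs, abs_of_nonneg (sq_nonneg _)]
      exact pow_le_pow_left₀ (by positivity) h2 2
    nlinarith [norm_nonneg (z * cfc k h)]

theorem exists_selfAdjoint_near {B : NonUnitalStarSubalgebra ℂ A} {h b : A}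
    (hh : IsSelfAdjoint h) (hb : b ∈ B) :
    ∃ s ∈ B, IsSelfAdjoint s ∧ ‖h - s‖ ≤ ‖h - b‖ := by
  refine ⟨(2 : ℂ)⁻¹ • (b + star b), SMulMemClass.smul_mem _ (add_mem hb (star_mem hb)), ?_, ?_⟩
  · rw [IsSelfAdjoint, star_smul, star_add, star_star, add_comm]; simp
  · have e : h - (2 : ℂ)⁻¹ • (b + star b) = (2 : ℂ)⁻¹ • ((h - b) + star (h - b)) := by
      rw [star_sub, hh.star_eq]; module
    rw [e, norm_smul]
    have := norm_add_le (h - b) (star (h - b))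
    rw [norm_star] at this
    simp only [norm_inv, Complex.norm_ofNat]
    linarith

theorem norm_mul_self_sub_self_le {x e : A} (he : IsStarProjection e) {δ : ℝ} (hδ1 : δ ≤ 1)
    (hx : ‖x - e‖ ≤ δ) : ‖x * x - x‖ ≤ 4 * δ := by
  have e1 : x * x - x = (x - e) * (x - e) + e * (x - e) + (x - e) * e - (x - e) := by
    have := he.isIdempotentElem.eq
    calc x * x - x = x * x - x + (e * e - e * e) + (e * e - e) := by rw [this]; abel
      _ = _ := by rw [this]; noncomm_ring; simp only [this]; try abel
  have h0 := norm_nonneg (x - e)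
  rw [e1]
  have h1 := norm_sub_le ((x - e) * (x - e) + e * (x - e) + (x - e) * e) (x - e)
  have h2 := norm_add_le ((x - e) * (x - e) + e * (x - e)) ((x - e) * e)
  have h3 := norm_add_le ((x - e) * (x - e)) (e * (x - e))
  have h4 := norm_mul_le (x - e) (x - e)
  have h5 := norm_mul_le_of_le_one_left (b := x - e) he.norm_le_one
  have h6 := norm_mul_le_of_le_one_right (a := x - e) he.norm_le_one
  nlinarith

theorem map_cfc_eq_zero (π : A →⋆ₐ[ℂ] Q) {x : A} (hx : IsSelfAdjoint x) (hπ : π x = 0) {f : ℝ → ℝ}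
    (hf : ContinuousOn f (spectrum ℝ x)) (h0 : f 0 = 0) : π (cfc f x) = 0 := by
  rw [StarAlgHom.map_cfc π f x hf (continuous_starAlgHom π) hx (hx.map π), hπ]
  have : (0 : Q) = algebraMap ℝ Q 0 := by simp
  rw [this, cfc_algebraMap, h0]

/-- An LF ideal contains projections below `P` that are almost units on the right ideal `P I`. -/
theorem IsLFKer.exists_projection_le {π : A →⋆ₐ[ℂ] Q} (hπ : IsLFKer π) {P : A}
    (hP : IsStarProjection P) (s : Finset A) (hs : ∀ y ∈ s, π y = 0 ∧ P * y = y) {ε : ℝ}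
    (hε : 0 < ε) :
    ∃ e : A, IsStarProjection e ∧ π e = 0 ∧ P * e = e ∧ e * P = e ∧
      ∀ y ∈ s, ‖(P - e) * y‖ < ε := by
  have hPs := hP.isSelfAdjoint.star_eq
  have hPP := hP.isIdempotentElem.eq
  set h := ∑ y ∈ s, y * star y with hh
  have hhsa : IsSelfAdjoint h := by
    rw [IsSelfAdjoint, hh, star_sum]
    exact Finset.sum_congr rfl fun y _ => by rw [star_mul, star_star]
  have hπh : π h = 0 := by
    rw [hh, map_sum]
    exact Finset.sum_eq_zero fun y hy => by rw [map_mul, (hs y hy).1, zero_mul]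
  have hPh : P * h = h := by
    rw [hh, Finset.mul_sum]
    exact Finset.sum_congr rfl fun y hy => by rw [← mul_assoc, (hs y hy).2]
  have hhP : h * P = h := by
    have := congrArg star hPh
    rwa [star_mul, hhsa.star_eq, hPs] at this
  -- The goal is `‖(P - e) y‖² ≤ ‖h (P - e)‖ ≤ η + ηκ + 18 κ ‖h‖ < ε²`.
  set η := ε ^ 2 / 4 with hη
  have hη0 : 0 < η := by positivity
  have hhn : 0 < 1 + ‖h‖ := by positivity
  set κ := min (1 / 64) (ε ^ 2 / (4 * (18 * (1 + ‖h‖)))) with hκ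
  have hκ0 : 0 < κ := by positivity
  have hκ1 : κ ≤ 1 / 64 := min_le_left _ _
  have hκ2 : 18 * κ * ‖h‖ ≤ ε ^ 2 / 4 := by
    have h1 : κ ≤ ε ^ 2 / (4 * (18 * (1 + ‖h‖))) := min_le_right _ _
    rw [le_div_iff₀ (by positivity)] at h1
    nlinarith [norm_nonneg h]
  obtain ⟨B, hB, hBk, hBa⟩ := hπ {h} (by simpa using hπh) (η * κ) (by positivity)
  obtain ⟨b₀, hb₀, hhb₀⟩ := hBa h (Finset.mem_singleton_self _)
  obtain ⟨b, hb, hbsa, hhb⟩ := exists_selfAdjoint_near hhsa hb₀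
  replace hhb := hhb.trans hhb₀.le
  have hfin := finite_spectrum_of_mem _ (mem_adjoinOne_of_mem hb)
  have hc : ∀ f : ℝ → ℝ, ContinuousOn f (spectrum ℝ b) := fun f => hfin.continuousOn f
  let f : ℝ → ℝ := fun t => if η < |t| then 1 else 0
  let g : ℝ → ℝ := fun t => t⁻¹ * if η < |t| then 1 else 0
  set e₀ := cfc f b with he₀
  have he₀p : IsStarProjection e₀ := isStarProjection_cfc (hc _) fun t _ => (ite_eq_or_eq _ _ _).symm
  have hπe₀ : π e₀ = 0 := map_cfc_eq_zero π hbsa (hBk b hb) (hc _) (by simp [f, hη0.le])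
  have he₀g : e₀ = b * cfc g b := by
    refine cfc_ite_eq_mul hbsa (hc _) ?_
    filter_upwards [Metric.ball_mem_nhds (0 : ℝ) hη0] with t ht
    rw [Metric.mem_ball, dist_zero_right, Real.norm_eq_abs] at ht
    exact not_lt.2 ht.le
  have hgn : ‖cfc g b‖ ≤ η⁻¹ := by
    refine norm_cfc_le (by positivity) fun t _ => ?_
    by_cases ht : η < |t|
    · simp only [g, if_pos ht, mul_one, norm_inv, Real.norm_eq_abs]
      exact inv_anti₀ hη0 ht.le
    · simp only [g, if_neg ht, mul_zero, norm_zero]; positivity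
  have hbe : ‖b * (1 - e₀)‖ ≤ η := by
    have e1 : b * (1 - e₀) = cfc (fun t => t * (1 - f t)) b := by
      rw [cfc_mul (fun t => t) (fun t => 1 - f t) b (hc _) (hc _), cfc_id' ℝ b,
        cfc_sub (fun _ => (1 : ℝ)) f b (hc _) (hc _), cfc_const_one ℝ b]
    rw [e1]
    refine norm_cfc_le hη0.le fun t _ => ?_
    by_cases ht : η < |t|
    · simp [f, ht, hη0.le]
    · simp only [f, if_neg ht, sub_zero, mul_one]; exact not_lt.1 ht
  -- Since `P h = h`, only the error `h - b` survives under `1 - P`. Dividing by spectral values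
  -- above `η` costs a factor `η⁻¹`, which explains the precision `η * κ` for `b`.
  have hPe₀ : ‖(1 - P) * e₀‖ ≤ κ := by
    have e1 : (1 - P) * e₀ = -((1 - P) * ((h - b) * cfc g b)) := by
      rw [he₀g, sub_mul h b, mul_sub (1 - P), ← mul_assoc (1 - P) h, sub_mul 1 P h, one_mul, hPh,
        sub_self, zero_mul, zero_sub, neg_neg]
    rw [e1, norm_neg]
    refine (norm_mul_le_of_le_one_left hP.one_sub.norm_le_one).trans ((norm_mul_le _ _).trans ?_)
    calc ‖h - b‖ * ‖cfc g b‖ ≤ (η * κ) * η⁻¹ :=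
          mul_le_mul hhb hgn (norm_nonneg _) (by positivity)
      _ = κ := by field_simp
  have he₀P : ‖e₀ * (1 - P)‖ ≤ κ := by
    rw [← norm_star, star_mul, he₀p.isSelfAdjoint.star_eq, hP.one_sub.isSelfAdjoint.star_eq]
    exact hPe₀
  -- `e₀` is only almost below `P`. Its compression is almost idempotent and lies in the corner, so
  -- a spectral projection of it lies exactly below `P`.
  set x := P * e₀ * P with hx
  have hxsa : IsSelfAdjoint x := by
    rw [IsSelfAdjoint, hx, star_mul, star_mul, hPs, he₀p.isSelfAdjoint.star_eq, mul_assoc]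
  have hxe₀ : ‖x - e₀‖ ≤ 2 * κ := by
    have e1 : x - e₀ = -((1 - P) * e₀) - P * (e₀ * (1 - P)) := by rw [hx]; noncomm_ring
    rw [e1]
    refine (norm_sub_le _ _).trans ?_
    rw [norm_neg]
    have := norm_mul_le_of_le_one_left (b := e₀ * (1 - P)) hP.norm_le_one
    linarith
  have hxx := norm_mul_self_sub_self_le he₀p (by linarith) hxe₀
  obtain ⟨hcx, hep, hex⟩ := exists_isStarProjection_near hxsa (by linarith) hxx
  set e := cfc (fun t : ℝ => if 1 / 2 < t then (1 : ℝ) else 0) x with he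
  have hex' : e = x * cfc (fun t : ℝ => t⁻¹ * if 1 / 2 < t then (1 : ℝ) else 0) x := by
    refine cfc_ite_eq_mul hxsa hcx ?_
    filter_upwards [Iio_mem_nhds (show (0 : ℝ) < 1 / 2 by norm_num)] with t ht
    exact not_lt.2 (le_of_lt ht)
  have hPe : P * e = e := by
    rw [hex', ← mul_assoc, hx, ← mul_assoc, ← mul_assoc, hPP]
  have heP : e * P = e := by
    have := congrArg star hPe
    rwa [star_mul, hPs, hep.isSelfAdjoint.star_eq] at this
  have hee₀ : ‖e - e₀‖ ≤ 18 * κ := by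
    have e1 : e - e₀ = (e - x) + (x - e₀) := by abel
    rw [e1]
    exact (norm_add_le _ _).trans (by linarith)
  have hmain : ‖h * (P - e)‖ < ε ^ 2 := by
    have e1 : h * (P - e) = b * (1 - e₀) + (h - b) * (1 - e₀) - h * (e - e₀) := by
      rw [mul_sub, hhP]; noncomm_ring
    rw [e1]
    have h1 := norm_sub_le (b * (1 - e₀) + (h - b) * (1 - e₀)) (h * (e - e₀))
    have h2 := norm_add_le (b * (1 - e₀)) ((h - b) * (1 - e₀))
    have h3 := norm_mul_le_of_le_one_right (a := h - b) he₀p.one_sub.norm_le_one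
    have h4 := (norm_mul_le h (e - e₀)).trans (mul_le_mul_of_nonneg_left hee₀ (norm_nonneg h))
    have h5 : η * κ ≤ η / 64 := by nlinarith
    have h6 : 0 < ε ^ 2 := by positivity
    linarith
  have hPep : IsStarProjection (P - e) := by
    refine ⟨?_, hP.isSelfAdjoint.sub hep.isSelfAdjoint⟩
    rw [IsIdempotentElem, mul_sub, sub_mul, sub_mul, hPP, heP, hPe, hep.isIdempotentElem.eq]; abel
  refine ⟨e, hep, map_cfc_eq_zero π hxsa (by rw [hx, map_mul, map_mul, hπe₀, mul_zero, zero_mul])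
    hcx (by norm_num), hPe, heP, fun y hy => ?_⟩
  have h1 : ‖(P - e) * y‖ * ‖(P - e) * y‖ ≤ ‖h * (P - e)‖ := by
    rw [← CStarRing.norm_self_mul_star, star_mul, hPep.isSelfAdjoint.star_eq]
    let _ := CStarAlgebra.spectralOrder A
    have _ := CStarAlgebra.spectralOrderedRing A
    have h2 : y * star y ≤ h := by
      rw [hh]
      exact Finset.single_le_sum (f := fun y => y * star y) (fun y _ => mul_star_self_nonneg y) hy
    have h3 := star_left_conjugate_le_conjugate h2 (P - e)
    rw [hPep.isSelfAdjoint.star_eq] at h3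
    have h4 : (P - e) * y * (star y * (P - e)) = (P - e) * (y * star y) * (P - e) := by noncomm_ring
    rw [h4]
    refine (CStarAlgebra.norm_le_norm_of_nonneg_of_le ?_ h3).trans ?_
    · have := star_left_conjugate_nonneg (mul_star_self_nonneg y) (P - e)
      rwa [hPep.isSelfAdjoint.star_eq] at this
    · rw [mul_assoc]
      exact norm_mul_le_of_le_one_left hPep.norm_le_one
  by_contra hcon
  nlinarith [norm_nonneg ((P - e) * y)]

end Approximation

/-! ### Conjugates, orthogonal sums and spans of matrix units. -/

section Subalgebras

variable {A Q : Type*} [CStarAlgebra A] [CStarAlgebra Q]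

/-- The algebra `v B v*` for `v* v ∈ B`. -/
def conjSubalgebra (B : NonUnitalStarSubalgebra ℂ A) (v : A) (hv : star v * v ∈ B) :
    NonUnitalStarSubalgebra ℂ A where
  carrier := {x | ∃ b ∈ B, x = v * b * star v}
  add_mem' := by
    rintro _ _ ⟨b, hb, rfl⟩ ⟨c, hc, rfl⟩
    exact ⟨b + c, add_mem hb hc, by noncomm_ring⟩
  zero_mem' := ⟨0, zero_mem _, by simp⟩
  mul_mem' := by
    rintro _ _ ⟨b, hb, rfl⟩ ⟨c, hc, rfl⟩
    exact ⟨b * (star v * v) * c, mul_mem (mul_mem hb hv) hc, by noncomm_ring⟩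
  smul_mem' := by
    rintro z _ ⟨b, hb, rfl⟩
    exact ⟨z • b, SMulMemClass.smul_mem z hb, by rw [mul_smul_comm, smul_mul_assoc]⟩
  star_mem' := by
    rintro _ ⟨b, hb, rfl⟩
    exact ⟨star b, star_mem hb, by rw [star_mul, star_mul, star_star, mul_assoc]⟩

theorem finiteDimensional_of_subset_range {V : Type*} [AddCommGroup V] [Module ℂ V]
    [FiniteDimensional ℂ V] (B : NonUnitalStarSubalgebra ℂ A) (f : V →ₗ[ℂ] A)
    (h : ∀ x ∈ B, ∃ v, f v = x) : FiniteDimensional ℂ B := by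
  have hle : B.toNonUnitalSubalgebra.toSubmodule ≤ LinearMap.range f := fun x hx => h x hx
  exact Submodule.finiteDimensional_of_le hle

theorem finiteDimensional_conjSubalgebra (B : NonUnitalStarSubalgebra ℂ A) [FiniteDimensional ℂ B]
    (v : A) (hv : star v * v ∈ B) : FiniteDimensional ℂ (conjSubalgebra B v hv) := by
  refine finiteDimensional_of_subset_range (V := B) _
    ((LinearMap.mulRight ℂ (star v) ∘ₗ LinearMap.mulLeft ℂ v) ∘ₗ
      B.toNonUnitalSubalgebra.toSubmodule.subtype) ?_
  rintro _ ⟨b, hb, rfl⟩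
  exact ⟨⟨b, hb⟩, rfl⟩

/-- The sum of two orthogonal subalgebras. -/
def orthogonalSup (B C : NonUnitalStarSubalgebra ℂ A)
    (h : ∀ b ∈ B, ∀ c ∈ C, b * c = 0) : NonUnitalStarSubalgebra ℂ A where
  carrier := {x | ∃ b ∈ B, ∃ c ∈ C, x = b + c}
  add_mem' := by
    rintro _ _ ⟨b, hb, c, hc, rfl⟩ ⟨b', hb', c', hc', rfl⟩
    exact ⟨b + b', add_mem hb hb', c + c', add_mem hc hc', by abel⟩
  zero_mem' := ⟨0, zero_mem _, 0, zero_mem _, by simp⟩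
  mul_mem' := by
    rintro _ _ ⟨b, hb, c, hc, rfl⟩ ⟨b', hb', c', hc', rfl⟩
    refine ⟨b * b', mul_mem hb hb', c * c', mul_mem hc hc', ?_⟩
    have h2 : c * b' = 0 := by
      rw [← star_eq_zero, star_mul]
      exact h _ (star_mem hb') _ (star_mem hc)
    rw [mul_add, add_mul, add_mul, h b hb c' hc', h2]; abel
  smul_mem' := by
    rintro z _ ⟨b, hb, c, hc, rfl⟩
    exact ⟨z • b, SMulMemClass.smul_mem z hb, z • c, SMulMemClass.smul_mem z hc, smul_add _ _ _⟩
  star_mem' := by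
    rintro _ ⟨b, hb, c, hc, rfl⟩
    exact ⟨star b, star_mem hb, star c, star_mem hc, star_add _ _⟩

theorem finiteDimensional_orthogonalSup (B C : NonUnitalStarSubalgebra ℂ A)
    [FiniteDimensional ℂ B] [FiniteDimensional ℂ C] (h : ∀ b ∈ B, ∀ c ∈ C, b * c = 0) :
    FiniteDimensional ℂ (orthogonalSup B C h) := by
  refine finiteDimensional_of_subset_range (V := B × C) _
    (B.toNonUnitalSubalgebra.toSubmodule.subtype.coprod
      C.toNonUnitalSubalgebra.toSubmodule.subtype) ?_
  rintro _ ⟨b, hb, c, hc, rfl⟩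
  exact ⟨(⟨b, hb⟩, ⟨c, hc⟩), LinearMap.coprod_apply _ _ _⟩

/-- The algebra spanned by the matrix units `v j * star (v k)`. -/
noncomputable def matrixUnitSpan {n : ℕ} (v : Fin n → A)
    (hv : ∀ i j k l, ∃ z : ℂ, v i * star (v j) * (v k * star (v l)) = z • (v i * star (v l))) :
    NonUnitalStarSubalgebra ℂ A where
  __ := Submodule.span ℂ (Set.range fun i : Fin n × Fin n => v i.1 * star (v i.2))
  mul_mem' := by
    intro x y hx hy
    refine Submodule.span_induction₂ (p := fun x y _ _ => x * y ∈ Submodule.span ℂ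
      (Set.range fun i : Fin n × Fin n => v i.1 * star (v i.2))) ?_ ?_ ?_ ?_ ?_ ?_ ?_ hx hy
    · rintro _ _ ⟨i, rfl⟩ ⟨j, rfl⟩
      obtain ⟨z, hz⟩ := hv i.1 i.2 j.1 j.2
      rw [hz]
      exact Submodule.smul_mem _ _ (Submodule.subset_span ⟨(i.1, j.2), rfl⟩)
    · intro y _; rw [zero_mul]; exact zero_mem _
    · intro x _; rw [mul_zero]; exact zero_mem _
    · intro x y z _ _ _ h1 h2; rw [add_mul]; exact add_mem h1 h2
    · intro x y z _ _ _ h1 h2; rw [mul_add]; exact add_mem h1 h2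
    · intro r x y _ _ h; rw [smul_mul_assoc]; exact Submodule.smul_mem _ _ h
    · intro r x y _ _ h; rw [mul_smul_comm]; exact Submodule.smul_mem _ _ h
  star_mem' := by
    intro x hx
    refine Submodule.span_induction (p := fun x _ => star x ∈ Submodule.span ℂ
      (Set.range fun i : Fin n × Fin n => v i.1 * star (v i.2))) ?_ ?_ ?_ ?_ hx
    · rintro _ ⟨i, rfl⟩
      exact Submodule.subset_span ⟨(i.2, i.1), by simp⟩
    · rw [star_zero]; exact zero_mem _
    · intro x y _ _ h1 h2; rw [star_add]; exact add_mem h1 h2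
    · intro r x _ h; rw [star_smul]; exact Submodule.smul_mem _ _ h

theorem mem_matrixUnitSpan {n : ℕ} {v : Fin n → A}
    {hv : ∀ i j k l, ∃ z : ℂ, v i * star (v j) * (v k * star (v l)) = z • (v i * star (v l))}
    {x : A} : x ∈ matrixUnitSpan v hv ↔
      x ∈ Submodule.span ℂ (Set.range fun i : Fin n × Fin n => v i.1 * star (v i.2)) := Iff.rfl

theorem sum_mem_matrixUnitSpan {n : ℕ} {v : Fin n → A}
    {hv : ∀ i j k l, ∃ z : ℂ, v i * star (v j) * (v k * star (v l)) = z • (v i * star (v l))}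
    (c : Fin n → Fin n → ℂ) : ∑ j, ∑ k, c j k • (v j * star (v k)) ∈ matrixUnitSpan v hv :=
  sum_mem fun j _ => sum_mem fun k _ => mem_matrixUnitSpan.2
    (Submodule.smul_mem _ _ (Submodule.subset_span ⟨(j, k), rfl⟩))

theorem finiteDimensional_matrixUnitSpan {n : ℕ} (v : Fin n → A)
    (hv : ∀ i j k l, ∃ z : ℂ, v i * star (v j) * (v k * star (v l)) = z • (v i * star (v l))) :
    FiniteDimensional ℂ (matrixUnitSpan v hv) :=
  FiniteDimensional.span_of_finite ℂ (Set.finite_range _)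

end Subalgebras

/-! ### Corners of LF ideals. -/

section Corner

variable {A Q : Type*} [CStarAlgebra A] [CStarAlgebra Q]

/-- Corners of LF ideals are LF. -/
theorem IsLFKer.exists_corner {π : A →⋆ₐ[ℂ] Q} (hπ : IsLFKer π) {E : A}
    (hE : IsStarProjection E) (hπE : π E = 0) (s : Finset A)
    (hs : ∀ a ∈ s, π a = 0 ∧ E * a * E = a) {ε : ℝ} (hε : 0 < ε) :
    ∃ B : NonUnitalStarSubalgebra ℂ A, FiniteDimensional ℂ B ∧
      (∀ b ∈ B, E * b = b) ∧ ∀ a ∈ s, ∃ b ∈ B, ‖a - b‖ < ε := by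
  classical
  have hEs := hE.isSelfAdjoint.star_eq
  have hEE := hE.isIdempotentElem.eq
  have hE1 := hE.norm_le_one
  set M := ∑ a ∈ s, ‖a‖ with hM
  have hM0 : 0 ≤ M := Finset.sum_nonneg fun a _ => norm_nonneg a
  -- The estimates below are `‖e - E‖ ≤ 9δ`, `‖y - 1‖ ≤ 18δ`, `‖U - 1‖ ≤ 126δ` and a total error of
  -- at most `δ + 252 δ (M + δ)`.
  set δ := min (1 / 1000) (ε / (1000 * (1 + M))) with hδ
  have hδ0 : 0 < δ := by positivity
  have hδ1 : δ ≤ 1 / 1000 := min_le_left _ _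
  have hδ2 : 1000 * δ * (1 + M) ≤ ε := by
    have : δ ≤ ε / (1000 * (1 + M)) := min_le_right _ _
    rw [le_div_iff₀ (by positivity)] at this
    linarith
  obtain ⟨B, hB, hBk, hBa⟩ := hπ (insert E s) (by
    intro x hx
    rcases Finset.mem_insert.1 hx with rfl | hx
    exacts [hπE, (hs x hx).1]) δ hδ0
  obtain ⟨e₀, he₀, hEe₀⟩ := hBa E (Finset.mem_insert_self _ _)
  obtain ⟨x, hxB, hxsa, hEx⟩ := exists_selfAdjoint_near hE.isSelfAdjoint he₀
  replace hEx : ‖x - E‖ ≤ δ := by rw [norm_sub_rev]; exact hEx.trans hEe₀.le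
  have hxx := norm_mul_self_sub_self_le hE (by linarith) hEx
  obtain ⟨hcx, hep, hex⟩ := exists_isStarProjection_near hxsa (by linarith) hxx
  set e := cfc (fun t : ℝ => if 1 / 2 < t then (1 : ℝ) else 0) x with he
  have heB : e ∈ B := by
    have hex' : e = x * cfc (fun t : ℝ => t⁻¹ * if 1 / 2 < t then (1 : ℝ) else 0) x := by
      refine cfc_ite_eq_mul hxsa hcx ?_
      filter_upwards [Iio_mem_nhds (show (0 : ℝ) < 1 / 2 by norm_num)] with t ht
      exact not_lt.2 (le_of_lt ht)
    rw [hex']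
    exact mem_of_mem_adjoinOne_mul hxB
      (cfc_mem_of_finiteDimensional _ (mem_adjoinOne_of_mem hxB) _)
  have hee := hep.isIdempotentElem.eq
  have hes := hep.isSelfAdjoint.star_eq
  have heE : ‖e - E‖ ≤ 9 * δ := by
    have e1 : e - E = (e - x) + (x - E) := by abel
    rw [e1]
    exact (norm_add_le _ _).trans (by linarith)
  -- `y` is close to `1` and intertwines `e` with `E`; its unitary part `U` does the same and moves
  -- the corner of `B` at `e` into the corner at `E`.
  set y := E * e + (1 - E) * (1 - e) with hy
  have hy1 : ‖y - 1‖ ≤ 18 * δ := by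
    have e1 : y - 1 = E * (e - E) - (1 - E) * (e - E) := by
      have h1 : (1 - E) * E = 0 := by rw [sub_mul, one_mul, hEE, sub_self]
      rw [mul_sub E, mul_sub (1 - E), h1, hEE, hy]; noncomm_ring
    rw [e1]
    have h1 := norm_mul_le_of_le_one_left (b := e - E) hE1
    have h2 := norm_mul_le_of_le_one_left (b := e - E) hE.one_sub.norm_le_one
    exact (norm_sub_le _ _).trans (by linarith)
  obtain ⟨-, hU1, hU2, hU3⟩ := polar_near_unitary (x := y) (u := 1) (by simp) (by simp)
    (by linarith) hy1
  set U := y * invSqrt (star y * y) with hU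
  have hye : y * e = E * y := by
    have h1 : (1 - e) * e = 0 := by rw [sub_mul, one_mul, hee, sub_self]
    have h2 : E * (1 - E) = 0 := by rw [mul_sub, mul_one, hEE, sub_self]
    rw [hy, add_mul, mul_add, mul_assoc, hee, mul_assoc, h1, mul_zero, ← mul_assoc, hEE, ← mul_assoc,
      h2, zero_mul]
  have hye' : e * star y = star y * E := by
    have := congrArg star hye
    rwa [star_mul, star_mul, hes, hEs] at this
  have hcomm : Commute (star y * y) e := by
    rw [Commute, SemiconjBy, mul_assoc, hye, ← mul_assoc, ← hye', mul_assoc]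
  have hUe : U * e = E * U := by
    rw [hU, mul_assoc, (commute_invSqrt hcomm).eq, ← mul_assoc, hye, mul_assoc]
  clear_value U
  have hUe' : e * star U = star U * E := by
    have := congrArg star hUe
    rwa [star_mul, star_mul, hes, hEs] at this
  have hUn : ‖U‖ ≤ 1 := norm_le_one_of_star_mul_self hU1
  have hv : star (U * e) * (U * e) = e := by
    rw [star_mul, hes, mul_assoc, ← mul_assoc (star U), hU1, one_mul, hee]
  refine ⟨conjSubalgebra B (U * e) (by rw [hv]; exact heB), finiteDimensional_conjSubalgebra _ _ _,
    ?_, ?_⟩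
  · rintro _ ⟨b, hb, rfl⟩
    rw [hUe, ← mul_assoc, ← mul_assoc, ← mul_assoc, hEE]
  · intro a ha
    obtain ⟨b, hb, hab⟩ := hBa a (Finset.mem_insert_of_mem ha)
    refine ⟨_, ⟨b, hb, rfl⟩, ?_⟩
    have haM : ‖a‖ ≤ M := Finset.single_le_sum (f := fun a => ‖a‖) (fun a _ => norm_nonneg a) ha
    have e1 : a - U * e * b * star (U * e)
        = E * ((a - b) - ((U - 1) * b * star U + b * star (U - 1))) * E := by
      have h1 : U * e * b * star (U * e) = E * (U * b * star U) * E := by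
        rw [star_mul, hes, hUe', hUe]; noncomm_ring
      rw [h1]
      nth_rewrite 1 [← (hs a ha).2]
      rw [star_sub, star_one]; noncomm_ring
    have hb1 : ‖b‖ ≤ M + δ := by
      have : b = a - (a - b) := by abel
      rw [this]
      exact (norm_sub_le _ _).trans (by linarith)
    rw [e1]
    have h1 : ‖(a - b) - ((U - 1) * b * star U + b * star (U - 1))‖
        ≤ δ + (7 * (18 * δ) * (M + δ) + (M + δ) * (7 * (18 * δ))) := by
      refine (norm_sub_le _ _).trans (add_le_add hab.le ((norm_add_le _ _).trans (add_le_add ?_ ?_)))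
      · refine (norm_mul_le_of_le_one_right (by rwa [norm_star])).trans ((norm_mul_le _ _).trans ?_)
        exact mul_le_mul hU3 hb1 (norm_nonneg _) (by positivity)
      · refine (norm_mul_le _ _).trans (mul_le_mul hb1 ?_ (norm_nonneg _) (by positivity))
        rwa [norm_star]
    refine ((norm_mul_le_of_le_one_right hE1).trans ((norm_mul_le_of_le_one_left hE1).trans h1)).trans_lt ?_
    nlinarith

end Corner

/-! ### Lifting matrix units and approximating in the extension. -/

section Extension

variable {A Q : Type*} [CStarAlgebra A] [CStarAlgebra Q]

/-- Lifting matrix units after cutting down by projections of an LF ideal: `v j` lifts `w j`, and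
`star (v j)` almost annihilates the finite subset `Y` of the ideal. -/
theorem IsLFKer.exists_lift_matrixUnits {π : A →⋆ₐ[ℂ] Q} (hπ : IsLFKer π) {n : ℕ} {P x : Fin n → A}
    {w : Fin n → Q} {r : Fin n → Fin n} (hP : ∀ j, IsStarProjection (P j))
    (hPP : ∀ j k, j ≠ k → P j * P k = 0) (hPx : ∀ j, P j * x j = x j)
    (hxP : ∀ j, x j * P (r j) = x j) (hπx : ∀ j, π (x j) = w j)
    (hw : ∀ j, star (w j) * w j = π (P (r j))) (Y : Finset A) (hY : ∀ y ∈ Y, π y = 0) {δ : ℝ}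
    (hδ : 0 < δ) (hδ1 : δ ≤ 1) :
    ∃ f v : Fin n → A, (∀ ρ, IsStarProjection (f ρ)) ∧
      (∀ j k, star (v j) * v k = if j = k then f (r j) else 0) ∧
      (∀ j ρ, v j * f ρ = if r j = ρ then v j else 0) ∧ (∀ j, π (v j) = w j) ∧
      (∀ j k, j ≠ k → star (v j) * x k = 0) ∧
      (∀ j, ‖star (v j) - f (r j) * star (x j)‖ ≤ δ * ‖x j‖) ∧
      (∀ ρ j, ‖f ρ * star (x j) - f ρ * star (v j)‖ ≤ δ * ‖x j‖) ∧
      (∀ j, ‖f (r j) * (star (x j) * x j) - f (r j)‖ ≤ δ) ∧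
      ∀ j, ∀ y ∈ Y, ‖star (v j) * y‖ ≤ δ := by
  classical
  have hPs : ∀ j, star (P j) = P j := fun j => (hP j).isSelfAdjoint.star_eq
  have hPi : ∀ j, P j * P j = P j := fun j => (hP j).isIdempotentElem.eq
  have hPx' : ∀ j, P (r j) * star (x j) = star (x j) := fun j => by
    conv_rhs => rw [← hxP j, star_mul, hPs]
  -- These elements of the ideal are to be almost killed by `f ρ = P ρ - e ρ`. The first kind makes
  -- `x j * f (r j)` almost a partial isometry, the second makes its adjoint almost annihilate `Y`.
  let S : Fin n → Finset A := fun ρ =>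
    (Finset.univ.filter fun j => r j = ρ).biUnion fun j =>
      insert (star (x j) * x j - P ρ) (Y.image fun y => star (x j) * y)
  have hS : ∀ ρ, ∀ y ∈ S ρ, π y = 0 ∧ P ρ * y = y := by
    intro ρ y hy
    obtain ⟨j, hj, hy⟩ := Finset.mem_biUnion.1 hy
    obtain rfl := (Finset.mem_filter.1 hj).2
    rcases Finset.mem_insert.1 hy with rfl | hy
    · rw [map_sub, map_mul, map_star, hπx, hw, sub_self, mul_sub, ← mul_assoc, hPx', hPi]
      exact ⟨rfl, rfl⟩
    · obtain ⟨y, hy', rfl⟩ := Finset.mem_image.1 hy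
      rw [map_mul, hY y hy', mul_zero, ← mul_assoc, hPx']
      exact ⟨rfl, rfl⟩
  choose e he hπe hPe heP hey using fun ρ =>
    hπ.exists_projection_le (hP ρ) (S ρ) (hS ρ) (show 0 < δ / 4 by positivity)
  set f : Fin n → A := fun ρ => P ρ - e ρ with hf
  have hfP : ∀ ρ, f ρ * P ρ = f ρ := fun ρ => by simp only [hf]; rw [sub_mul, hPi, heP]
  have hPf : ∀ ρ, P ρ * f ρ = f ρ := fun ρ => by simp only [hf]; rw [mul_sub, hPi, hPe]
  have hfp : ∀ ρ, IsStarProjection (f ρ) := fun ρ =>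
    ⟨by
      rw [IsIdempotentElem]
      nth_rewrite 1 [hf]
      simp only
      rw [sub_mul, hPf]
      simp only [hf]
      rw [mul_sub, heP, (he ρ).isIdempotentElem.eq]; abel,
      (hP ρ).isSelfAdjoint.sub (he ρ).isSelfAdjoint⟩
  have hff : ∀ ρ, f ρ * f ρ = f ρ := fun ρ => (hfp ρ).isIdempotentElem.eq
  have hfs : ∀ ρ, star (f ρ) = f ρ := fun ρ => (hfp ρ).isSelfAdjoint.star_eq
  have hf1 : ∀ ρ, ‖f ρ‖ ≤ 1 := fun ρ => (hfp ρ).norm_le_one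
  have hfo : ∀ ρ σ, ρ ≠ σ → f ρ * f σ = 0 := fun ρ σ h => by
    rw [← hfP ρ, ← hPf σ, mul_assoc, ← mul_assoc (P ρ), hPP ρ σ h, zero_mul, mul_zero]
  have hfPo : ∀ ρ σ, ρ ≠ σ → f ρ * P σ = 0 := fun ρ σ h => by
    rw [← hfP ρ, mul_assoc, hPP ρ σ h, mul_zero]
  have hπf : ∀ ρ, π (f ρ) = π (P ρ) := fun ρ => by simp only [hf]; rw [map_sub, hπe, sub_zero]
  clear_value f
  have hfx : ∀ j, ‖f (r j) * (star (x j) * x j - P (r j))‖ ≤ δ / 4 := fun j => by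
    have := hey (r j) (star (x j) * x j - P (r j)) (Finset.mem_biUnion.2
      ⟨j, Finset.mem_filter.2 ⟨Finset.mem_univ _, rfl⟩, Finset.mem_insert_self _ _⟩)
    simpa [hf] using this.le
  have hfy : ∀ j, ∀ y ∈ Y, ‖f (r j) * (star (x j) * y)‖ ≤ δ / 4 := fun j y hy => by
    have := hey (r j) (star (x j) * y) (Finset.mem_biUnion.2
      ⟨j, Finset.mem_filter.2 ⟨Finset.mem_univ _, rfl⟩,
        Finset.mem_insert_of_mem (Finset.mem_image.2 ⟨y, hy, rfl⟩)⟩)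
    simpa [hf] using this.le
  -- The summand `1 - f` makes `h j` close to `1` in the whole algebra. Correcting by its inverse
  -- square root, which commutes with `f (r j)`, gives `star (v j) * v j = f (r j)` exactly.
  set h : Fin n → A := fun j => f (r j) * (star (x j) * x j) * f (r j) + (1 - f (r j)) with hh
  have hhsa : ∀ j, IsSelfAdjoint (h j) := fun j => by
    rw [IsSelfAdjoint]
    simp only [hh, star_add, star_mul, star_star, star_sub, star_one, hfs, mul_assoc]
  have hh1 : ∀ j, ‖h j - 1‖ ≤ δ / 4 := fun j => by
    have e1 : h j - 1 = f (r j) * (star (x j) * x j - P (r j)) * f (r j) := by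
      simp only [hh]
      rw [mul_sub, hfP, sub_mul, hff]; abel
    rw [e1]
    exact (norm_mul_le_of_le_one_right (hf1 _)).trans (hfx j)
  have hh2 : ∀ j, ‖h j - 1‖ ≤ 1 / 2 := fun j => (hh1 j).trans (by linarith)
  have hfh : ∀ j, h j * f (r j) = f (r j) * (star (x j) * x j) * f (r j) := fun j => by
    simp only [hh]
    rw [add_mul, sub_mul, one_mul, hff, sub_self, add_zero, mul_assoc, hff]
  have hhf : ∀ j, Commute (h j) (f (r j)) := fun j => by
    rw [Commute, SemiconjBy, hfh]
    simp only [hh]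
    generalize star (x j) * x j = X
    rw [mul_add, mul_sub, mul_one, hff, sub_self, add_zero, ← mul_assoc, ← mul_assoc (f (r j)) (f (r j)),
      hff]
  set g : Fin n → A := fun j => invSqrt (h j) with hg
  have hgf : ∀ j, g j * f (r j) = f (r j) * g j := fun j => (commute_invSqrt (hhf j)).eq
  have hgs : ∀ j, star (g j) = g j := fun j => isSelfAdjoint_invSqrt _
  have hghg : ∀ j, g j * h j * g j = 1 := fun j => invSqrt_mul_mul_invSqrt (hhsa j) (hh2 j)
  have hg1 : ∀ j, ‖g j - 1‖ ≤ δ / 4 := fun j =>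
    norm_invSqrt_sub_one_le (hhsa j) (by linarith) (hh1 j)
  have hg2 : ∀ j, ‖g j‖ ≤ 2 := fun j => norm_invSqrt_le (hhsa j) (hh2 j)
  have hπg : ∀ j, π (g j) = 1 := fun j => by
    refine map_invSqrt_eq_one π (hhsa j) (hh2 j) ?_
    simp only [hh, map_add, map_mul, map_sub, map_one, map_star, hπx, hw, hπf]
    rw [← map_mul, hPi, ← map_mul, hPi]; abel
  clear_value g h
  set v : Fin n → A := fun j => x j * f (r j) * g j with hv
  have hvs : ∀ j, star (v j) = g j * f (r j) * star (x j) := fun j => by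
    simp only [hv]; rw [star_mul, star_mul, hgs, hfs, mul_assoc]
  have hvf : ∀ j ρ, v j * f ρ = if r j = ρ then v j else 0 := fun j ρ => by
    simp only [hv]
    split_ifs with hj
    · subst hj; rw [mul_assoc, hgf, ← mul_assoc, mul_assoc (x j), hff]
    · rw [mul_assoc (x j), ← hgf, mul_assoc, mul_assoc, hfo _ _ hj, mul_zero, mul_zero]
  have hdiff : ∀ j, ‖star (v j) - f (r j) * star (x j)‖ ≤ δ * ‖x j‖ := fun j => by
    have e1 : star (v j) - f (r j) * star (x j) = (g j - 1) * (f (r j) * star (x j)) := by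
      rw [hvs]; noncomm_ring
    rw [e1]
    refine (norm_mul_le _ _).trans (mul_le_mul ((hg1 j).trans (by linarith)) ?_ (norm_nonneg _) hδ.le)
    rw [← norm_star (x j)]
    exact norm_mul_le_of_le_one_left (hf1 _)
  have hfv : ∀ j, f (r j) * star (v j) = star (v j) := fun j => by
    have := congrArg star (hvf j (r j))
    rwa [if_pos rfl, star_mul, hfs] at this
  have hxx : ∀ j k, j ≠ k → star (x j) * x k = 0 := fun j k hjk => by
    rw [← hPx j, ← hPx k, star_mul, hPs, mul_assoc, ← mul_assoc (P j), hPP j k hjk, zero_mul,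
      mul_zero]
  refine ⟨f, v, hfp, fun j k => ?_, hvf, fun j => ?_,
    fun j k hjk => by rw [hvs, mul_assoc, hxx j k hjk, mul_zero], hdiff, fun ρ j => ?_, fun j => ?_,
    fun j y hy => ?_⟩
  · split_ifs with hjk
    · subst hjk
      calc star (v j) * v j = g j * (f (r j) * (star (x j) * x j) * f (r j)) * g j := by
            rw [hvs]; simp only [hv]; noncomm_ring
        _ = g j * h j * (f (r j) * g j) := by rw [← hfh]; noncomm_ring
        _ = f (r j) := by rw [← hgf, ← mul_assoc, hghg, one_mul]
    · rw [hvs]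
      simp only [hv]
      calc g j * f (r j) * star (x j) * (x k * f (r k) * g k)
          = g j * f (r j) * (star (x j) * x k) * (f (r k) * g k) := by noncomm_ring
        _ = 0 := by rw [hxx j k hjk]; simp
  · simp only [hv]
    rw [map_mul, map_mul, hπg, mul_one, hπf, ← map_mul, hxP, hπx]
  · by_cases hj : r j = ρ
    · subst hj
      rw [hfv, norm_sub_rev]
      exact hdiff j
    · have h1 : f ρ * star (v j) = 0 := by
        have := congrArg star (hvf j ρ)
        rwa [if_neg hj, star_mul, hfs, star_zero] at this
      have h2 : f ρ * star (x j) = 0 := by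
        rw [← hPx' j, ← mul_assoc, hfPo _ _ (Ne.symm hj), zero_mul]
      rw [h1, h2, sub_self, norm_zero]; positivity
  · have := hfx j
    rw [mul_sub, hfP] at this
    linarith
  · rw [hvs, mul_assoc, mul_assoc]
    refine (norm_mul_le _ _).trans ?_
    have h1 := hfy j y hy
    have h2 := hg2 j
    nlinarith [norm_nonneg (f (r j) * (star (x j) * y)), norm_nonneg (g j)]

end Extension

section Extension

variable {A Q : Type*} [CStarAlgebra A] [CStarAlgebra Q]

/-- Each `a` is within `ε` of `T c + y`, with `T c` a combination of the rough lifts `x j * star (x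
k)` and `y` in the kernel. The exact matrix units built from `v` have unit `S` with `1 - S` in the
kernel, and they approximate `T c + y` outside the corner of `1 - S`; the corner itself is LF. -/
theorem IsLFKer.exists_approx {π : A →⋆ₐ[ℂ] Q} (hπ : IsLFKer π) (hsurj : Function.Surjective π)
    (F : StarSubalgebra ℂ Q) [FiniteDimensional ℂ F] (s : Finset A) {ε : ℝ} (hε : 0 < ε)
    (hs : ∀ a ∈ s, ∃ q ∈ F, ‖π a - q‖ < ε) :
    ∃ M : StarSubalgebra ℂ A, FiniteDimensional ℂ M ∧ ∀ a ∈ s, ∃ b ∈ M, ‖a - b‖ < 4 * ε := by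
  classical
  obtain ⟨n, p, w, r, hp, hpp, hpsum, hw1, hw2, hspan⟩ := exists_matrixUnits F
  obtain ⟨P, hP, hPP, hπP⟩ := hπ.exists_lift_projections hsurj p hp hpp hpsum
  have hpi : ∀ j, p j * p j = p j := fun j => (hp j).isIdempotentElem.eq
  have hPi : ∀ j, P j * P j = P j := fun j => (hP j).isIdempotentElem.eq
  choose W hW using fun j => hsurj (w j)
  have hwp : ∀ j, w j * p (r j) = w j := fun j => by
    rw [← hw1, ← mul_assoc, mul_star_mul_self (hw1 j) (hpi _)]
  have hpw : ∀ j, p j * w j = w j := fun j => by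
    rw [← hw2, mul_star_mul_self (hw1 j) (hpi _)]
  let x : Fin n → A := fun j => P j * W j * P (r j)
  have hPx : ∀ j, P j * x j = x j := fun j => by
    simp only [x]; rw [← mul_assoc, ← mul_assoc, hPi]
  have hxP : ∀ j, x j * P (r j) = x j := fun j => by
    simp only [x]; rw [mul_assoc, hPi]
  have hπx : ∀ j, π (x j) = w j := fun j => by
    simp only [x]; rw [map_mul, map_mul, hπP, hπP, hW, hpw, hwp]
  clear_value x
  let T : (Fin n → Fin n → ℂ) → A := fun c => ∑ j, ∑ k, c j k • (x j * star (x k))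
  have hπT : ∀ c, π (T c) = ∑ j, ∑ k, c j k • (w j * star (w k)) := fun c => by
    simp only [T, map_sum, map_smul, map_mul, map_star, hπx]
  have hdata : ∀ a : A, ∃ (c : Fin n → Fin n → ℂ) (y : A), a ∈ s → π y = 0 ∧ ‖a - (T c + y)‖ ≤ ε := by
    intro a
    by_cases ha : a ∈ s
    · obtain ⟨q, hq, hqa⟩ := hs a ha
      obtain ⟨c, rfl⟩ := hspan q hq
      obtain ⟨y, hy, hya⟩ := exists_ker_norm_sub_le π (z := a - T c) hε (by
        rw [map_sub, hπT]; exact hqa.le)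
      exact ⟨c, y, fun _ => ⟨hy, by rwa [← sub_sub]⟩⟩
    · exact ⟨0, 0, fun h => absurd h ha⟩
  choose c y hcy using hdata
  set X := 1 + ∑ j, ‖x j‖ with hX
  have hxX : ∀ j, ‖x j‖ ≤ X := fun j => by
    have := Finset.single_le_sum (f := fun j => ‖x j‖) (fun j _ => norm_nonneg _) (Finset.mem_univ j)
    linarith
  have hX1 : 1 ≤ X := by
    have : 0 ≤ ∑ j, ‖x j‖ := Finset.sum_nonneg fun j _ => norm_nonneg _
    linarith
  set Kc := ∑ a ∈ s, ∑ j, ∑ k, ‖c a j k‖ with hKc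
  have hKc0 : 0 ≤ Kc := Finset.sum_nonneg fun a _ => Finset.sum_nonneg fun j _ =>
    Finset.sum_nonneg fun k _ => norm_nonneg _
  -- `δ * K` bounds the error under `S`: each of the `n` rows contributes `δ` from the kernel part
  -- and `3 X³ δ` per unit of coefficient.
  set K := n + 3 * X ^ 3 * Kc with hK
  have hK0 : 0 ≤ K := by positivity
  set δ := min 1 (ε / (1 + K)) with hδ
  have hδ0 : 0 < δ := by positivity
  have hδ1 : δ ≤ 1 := min_le_left _ _
  have hδK : δ * K ≤ ε := by
    have : δ ≤ ε / (1 + K) := min_le_right _ _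
    rw [le_div_iff₀ (by positivity)] at this
    linarith
  -- The adjoints are included so that right multiplication by `S` reduces to the left-hand
  -- estimate.
  set Y := s.image y ∪ s.image fun a => star (y a) with hY
  have hY0 : ∀ y' ∈ Y, π y' = 0 := by
    intro y' hy'
    rcases Finset.mem_union.1 hy' with h | h <;> obtain ⟨a, ha, rfl⟩ := Finset.mem_image.1 h
    · exact (hcy a ha).1
    · rw [map_star, (hcy a ha).1, star_zero]
  obtain ⟨f, v, hf, hvv, hvf, hπv, hvx, hv1, hv2, hv3, hv4⟩ := hπ.exists_lift_matrixUnits hP hPP hPx hxP hπx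
    (fun j => by rw [hw1, hπP]) Y hY0 hδ0 hδ1
  have hvn : ∀ j, ‖v j‖ ≤ 1 := fun j => by
    have h1 : ‖v j‖ * ‖v j‖ ≤ 1 := by
      rw [← CStarRing.norm_star_mul_self, hvv, if_pos rfl]; exact (hf _).norm_le_one
    nlinarith [norm_nonneg (v j)]
  have hvf' : ∀ j, v j * f (r j) = v j := fun j => by rw [hvf, if_pos rfl]
  let Φ : (Fin n → Fin n → ℂ) → A := fun c => ∑ j, ∑ k, c j k • (v j * star (v k))
  set S := ∑ j, v j * star (v j) with hS
  have hSs : star S = S := by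
    rw [hS, star_sum]
    exact Finset.sum_congr rfl fun j _ => by rw [star_mul, star_star]
  have hSv : ∀ j, S * v j = v j := fun j => by
    rw [hS, Finset.sum_mul, Finset.sum_eq_single j]
    · rw [mul_assoc, hvv, if_pos rfl, hvf']
    · intro k _ hk
      rw [mul_assoc, hvv, if_neg hk, mul_zero]
    · simp
  have hSS : S * S = S := by
    conv_lhs => rw [hS, Finset.mul_sum]
    rw [hS]
    exact Finset.sum_congr rfl fun j _ => by rw [← hS, ← mul_assoc, hSv]
  have hSp : IsStarProjection S := ⟨hSS, hSs⟩
  have hπS : π S = 1 := by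
    rw [hS, map_sum, ← hpsum]
    exact Finset.sum_congr rfl fun j _ => by rw [map_mul, map_star, hπv, hw2]
  set E := 1 - S with hE
  have hEp : IsStarProjection E := hSp.one_sub
  have hEE : E * E = E := hEp.isIdempotentElem.eq
  have hEs : star E = E := hEp.isSelfAdjoint.star_eq
  have hπE : π E = 0 := by rw [hE, map_sub, map_one, hπS, sub_self]
  have hEv : ∀ j, E * v j = 0 := fun j => by rw [hE, sub_mul, one_mul, hSv, sub_self]
  have hbound : ∀ (c : Fin n → Fin n → ℂ) (y : A), y ∈ Y →
      ‖S * (T c + y - Φ c)‖ ≤ δ * (n + 3 * X ^ 3 * ∑ j, ∑ k, ‖c j k‖) := by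
    intro c y hy
    have hterm : ∀ j l, ‖star (v j) * (x j * star (x l)) - f (r j) * star (v l)‖ ≤ 3 * X ^ 3 * δ := by
      intro j l
      have e1 : star (v j) * (x j * star (x l)) - f (r j) * star (v l)
          = (star (v j) - f (r j) * star (x j)) * (x j * star (x l))
            + (f (r j) * (star (x j) * x j) - f (r j)) * star (x l)
            + (f (r j) * star (x l) - f (r j) * star (v l)) := by noncomm_ring
      rw [e1]
      have hl := hxX l
      have hj := hxX j
      have hX2 : X ≤ X ^ 3 := le_self_pow₀ hX1 (by norm_num)
      have n1 : ‖(star (v j) - f (r j) * star (x j)) * (x j * star (x l))‖ ≤ δ * X ^ 3 := by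
        calc _ ≤ (δ * ‖x j‖) * (‖x j‖ * ‖x l‖) := by
              refine (norm_mul_le _ _).trans (mul_le_mul (hv1 j) ?_ (norm_nonneg _) (by positivity))
              exact (norm_mul_le _ _).trans_eq (by rw [norm_star])
          _ ≤ (δ * X) * (X * X) := by gcongr
          _ = _ := by ring
      have n2 : ‖(f (r j) * (star (x j) * x j) - f (r j)) * star (x l)‖ ≤ δ * X ^ 3 := by
        refine (norm_mul_le _ _).trans (mul_le_mul (hv3 j) ?_ (norm_nonneg _) hδ0.le)
        rw [norm_star]
        exact hl.trans hX2
      have n3 : ‖f (r j) * star (x l) - f (r j) * star (v l)‖ ≤ δ * X ^ 3 :=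
        (hv2 _ _).trans (mul_le_mul_of_nonneg_left (hl.trans hX2) hδ0.le)
      refine (norm_add_le _ _).trans ?_
      have n4 := norm_add_le ((star (v j) - f (r j) * star (x j)) * (x j * star (x l)))
        ((f (r j) * (star (x j) * x j) - f (r j)) * star (x l))
      linarith
    have hvT : ∀ j, star (v j) * (T c - Φ c)
        = ∑ l, c j l • (star (v j) * (x j * star (x l)) - f (r j) * star (v l)) := by
      intro j
      have hsum : ∀ u : Fin n → A, (∀ k, j ≠ k → star (v j) * u k = 0) →
          star (v j) * ∑ i, ∑ k, c i k • (u i * star (u k))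
            = ∑ l, c j l • (star (v j) * (u j * star (u l))) := fun u hu => by
        rw [Finset.mul_sum, Finset.sum_eq_single j]
        · rw [Finset.mul_sum]
          exact Finset.sum_congr rfl fun l _ => by rw [mul_smul_comm]
        · intro k _ hk
          rw [Finset.mul_sum]
          refine Finset.sum_eq_zero fun l _ => ?_
          rw [mul_smul_comm, ← mul_assoc, hu k (Ne.symm hk), zero_mul, smul_zero]
        · simp
      rw [mul_sub, hsum x (hvx j), hsum v (fun k hk => by rw [hvv, if_neg hk]),
        ← Finset.sum_sub_distrib]
      refine Finset.sum_congr rfl fun l _ => ?_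
      rw [smul_sub, ← mul_assoc (star (v j)) (v j), hvv, if_pos rfl]
    have hvz : ∀ j, ‖star (v j) * (T c + y - Φ c)‖ ≤ δ + ∑ l, ‖c j l‖ * (3 * X ^ 3 * δ) := by
      intro j
      have e1 : star (v j) * (T c + y - Φ c) = star (v j) * y + star (v j) * (T c - Φ c) := by
        noncomm_ring
      rw [e1, hvT]
      refine (norm_add_le _ _).trans (add_le_add (hv4 j y hy) ((norm_sum_le _ _).trans ?_))
      refine Finset.sum_le_sum fun l _ => ?_
      rw [norm_smul]
      exact mul_le_mul_of_nonneg_left (hterm j l) (norm_nonneg _)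
    rw [hS, Finset.sum_mul]
    refine (norm_sum_le _ _).trans ((Finset.sum_le_sum fun j _ => ?_).trans_eq
      (b := ∑ j, (δ + ∑ l, ‖c j l‖ * (3 * X ^ 3 * δ))) ?_)
    · rw [mul_assoc]
      exact (norm_mul_le_of_le_one_left (hvn j)).trans (hvz j)
    · rw [Finset.sum_add_distrib]
      simp only [← Finset.sum_mul]
      simp
      ring
  have hunits : ∀ i j k l, ∃ z : ℂ,
      v i * star (v j) * (v k * star (v l)) = z • (v i * star (v l)) := by
    intro i j k l
    have e1 : v i * star (v j) * (v k * star (v l)) = v i * (star (v j) * v k) * star (v l) := by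
      noncomm_ring
    rw [e1, hvv]
    split_ifs with h1
    · rw [hvf]
      split_ifs with h2
      · exact ⟨1, by rw [one_smul]⟩
      · exact ⟨0, by rw [zero_mul, zero_smul]⟩
    · exact ⟨0, by rw [mul_zero, zero_mul, zero_smul]⟩
  obtain ⟨B, hB, hBE, hBa⟩ := hπ.exists_corner hEp hπE (s.image fun a => E * (T (c a) + y a) * E) (by
    intro b hb
    obtain ⟨a, -, rfl⟩ := Finset.mem_image.1 hb
    refine ⟨by rw [map_mul, hπE, mul_zero], ?_⟩
    rw [← mul_assoc, ← mul_assoc, hEE, mul_assoc, hEE]) hε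
  have horth : ∀ b ∈ matrixUnitSpan v hunits, ∀ b' ∈ B, b * b' = 0 := by
    intro b hb b' hb'
    have hbE : b * E = 0 := by
      rw [mem_matrixUnitSpan] at hb
      refine Submodule.span_induction (p := fun b _ => b * E = 0) ?_ (zero_mul _) ?_ ?_ hb
      · rintro _ ⟨i, rfl⟩
        have : star (v i.2) * E = 0 := by rw [← star_eq_zero, star_mul, star_star, hEs, hEv]
        simp only
        rw [mul_assoc, this, mul_zero]
      · intro a b _ _ h1 h2; rw [add_mul, h1, h2, add_zero]
      · intro z a _ h1; rw [smul_mul_assoc, h1, smul_zero]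
    rw [← hBE b' hb', ← mul_assoc, hbE, zero_mul]
  have := finiteDimensional_matrixUnitSpan v hunits
  have := finiteDimensional_orthogonalSup _ B horth
  refine ⟨adjoinOne (orthogonalSup _ B horth), inferInstance, fun a ha => ?_⟩
  obtain ⟨b, hb, hab⟩ := hBa _ (Finset.mem_image_of_mem _ ha)
  refine ⟨Φ (c a) + b, mem_adjoinOne_of_mem ⟨_, sum_mem_matrixUnitSpan _, b, hb, rfl⟩, ?_⟩
  have hsingle : ∑ j, ∑ k, ‖c a j k‖ ≤ Kc :=
    Finset.single_le_sum (f := fun a => ∑ j, ∑ k, ‖c a j k‖) (fun a _ => Finset.sum_nonneg fun j _ =>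
      Finset.sum_nonneg fun k _ => norm_nonneg _) ha
  have hle : ∀ t : ℝ, t ≤ Kc → δ * (n + 3 * X ^ 3 * t) ≤ ε := fun t ht => by
    refine le_trans (mul_le_mul_of_nonneg_left ?_ hδ0.le) hδK
    rw [hK]
    have := mul_le_mul_of_nonneg_left ht (show 0 ≤ 3 * X ^ 3 by positivity)
    linarith
  set z := T (c a) + y a - Φ (c a) with hz
  have hz1 : ‖S * z‖ ≤ ε := (hbound (c a) (y a)
    (Finset.mem_union_left _ (Finset.mem_image_of_mem _ ha))).trans (hle _ hsingle)
  have hz2 : ‖z * S‖ ≤ ε := by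
    have e1 : star (z * S) = S * (T (fun j k => star (c a k j)) + star (y a)
        - Φ fun j k => star (c a k j)) := by
      have hstarT : ∀ (u : Fin n → A), star (∑ j, ∑ k, c a j k • (u j * star (u k)))
          = ∑ j, ∑ k, star (c a k j) • (u j * star (u k)) := fun u => by
        simp only [star_sum, star_smul, star_mul, star_star]
        rw [Finset.sum_comm]
      rw [star_mul, hSs, hz, star_sub, star_add]
      simp only [T, Φ, hstarT]
    rw [← norm_star, e1]
    refine (hbound _ (star (y a)) (Finset.mem_union_right _ (Finset.mem_image_of_mem _ ha))).trans
      (hle _ ?_)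
    simp only [norm_star]
    rw [Finset.sum_comm]
    exact hsingle
  have hΦE : Φ (c a) * E = 0 := by
    simp only [Φ, Finset.sum_mul]
    refine Finset.sum_eq_zero fun j _ => Finset.sum_eq_zero fun k _ => ?_
    have : star (v k) * E = 0 := by rw [← star_eq_zero, star_mul, star_star, hEs, hEv]
    rw [smul_mul_assoc, mul_assoc, this, mul_zero, smul_zero]
  -- Four errors: the distance in the quotient, two off-corner terms each at most `ε`, and the
  -- approximation inside the corner of `E`, where `Φ (c a)` vanishes.
  have e1 : a - (Φ (c a) + b) = (a - (T (c a) + y a)) + S * z + E * (z * S)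
      + (E * (T (c a) + y a) * E - b) := by
    have h1 : S * z + E * (z * S) = z - E * z * E := by rw [hE]; noncomm_ring
    have h2 : E * z * E = E * (T (c a) + y a) * E := by
      have e2 : E * z * E = E * (T (c a) + y a) * E - E * (Φ (c a) * E) := by
        rw [hz]; generalize E = E'; noncomm_ring
      rw [e2, hΦE, mul_zero, sub_zero]
    rw [add_assoc (a - _), h1, h2, hz]; abel
  rw [e1]
  have h1 := norm_add_le ((a - (T (c a) + y a)) + S * z + E * (z * S))
    (E * (T (c a) + y a) * E - b)
  have h2 := norm_add_le ((a - (T (c a) + y a)) + S * z) (E * (z * S))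
  have h3 := norm_add_le (a - (T (c a) + y a)) (S * z)
  have h4 := norm_mul_le_of_le_one_left (b := z * S) hEp.norm_le_one
  have h5 := (hcy a ha).2
  linarith

end Extension

/-! ### Reduction of the extension theorem to the unital case. -/

section Unitization

theorem Unitization.norm_fst_le {E : Type*} [NonUnitalCStarAlgebra E] (x : Unitization ℂ E) :
    ‖x.fst‖ ≤ ‖x‖ := by
  rw [Unitization.norm_eq_sup]
  exact le_sup_left

theorem finiteDimensional_nonUnitalStarSubalgebra_map {A B : Type*} [NonUnitalCStarAlgebra A]
    [NonUnitalCStarAlgebra B] (f : A →⋆ₙₐ[ℂ] B) (S : NonUnitalStarSubalgebra ℂ A)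
    [FiniteDimensional ℂ S] : FiniteDimensional ℂ (S.map f) := by
  let g : S →ₗ[ℂ] S.map f :=
    { toFun := fun x => ⟨f x, x, x.2, rfl⟩
      map_add' := fun x y => Subtype.ext (map_add f _ _)
      map_smul' := fun z x => Subtype.ext (map_smul f _ _) }
  refine Module.Finite.of_surjective g ?_
  rintro ⟨_, a, ha, rfl⟩
  exact ⟨⟨a, ha⟩, rfl⟩

variable {I E Q : Type*} [NonUnitalCStarAlgebra I] [NonUnitalCStarAlgebra E]
  [NonUnitalCStarAlgebra Q]

/-- Unitizing does not enlarge the kernel: an element mapped to `0` has scalar part `0` and the rest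
in the image of `i`. -/
theorem isLFKer_starMap {i : I →⋆ₙₐ[ℂ] E} {π : E →⋆ₙₐ[ℂ] Q}
    (hπi : ∀ a, π a = 0 ↔ a ∈ Set.range i) (hI : IsLF I) :
    IsLFKer (Unitization.starMap (R := ℂ) π) := by
  classical
  have hker : ∀ x, Unitization.starMap (R := ℂ) π x = 0 →
      ∃ b : I, x = ((i b : E) : Unitization ℂ E) := by
    intro x
    induction x using Unitization.ind with
    | inl_add_inr r a =>
      intro h
      rw [map_add, Unitization.starMap_inr, Unitization.starMap_inl] at h
      have h1 := congrArg (fun x => x.fst) h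
      have h2 := congrArg (fun x => x.snd) h
      simp [Unitization.algebraMap_eq_inl] at h1 h2
      obtain ⟨b, rfl⟩ := (hπi a).1 h2
      exact ⟨b, by simp [h1]⟩
  intro F hF ε hε
  choose! g hg using hker
  obtain ⟨B, hB, hBF⟩ := hI (F.image g) ε hε
  let j : I →⋆ₙₐ[ℂ] Unitization ℂ E := (Unitization.inrNonUnitalStarAlgHom ℂ E).comp i
  refine ⟨B.map j, finiteDimensional_nonUnitalStarSubalgebra_map j B, ?_, fun x hx => ?_⟩
  · rintro _ ⟨b, -, rfl⟩
    change Unitization.starMap (R := ℂ) π ((i b : E) : Unitization ℂ E) = 0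
    rw [Unitization.starMap_inr, (hπi _).2 ⟨b, rfl⟩, Unitization.inr_zero]
  · obtain ⟨b, hb, hxb⟩ := hBF _ (Finset.mem_image_of_mem _ hx)
    refine ⟨j b, ⟨b, hb, rfl⟩, lt_of_le_of_lt ?_ hxb⟩
    have e : x - j b = j (g x - b) := by
      rw [map_sub]
      exact congrArg (· - j b) (hg x (hF x hx))
    rw [e]
    exact NonUnitalStarAlgHom.norm_apply_le j _

/-- An extension of an LF algebra by an LF algebra is LF. -/
theorem IsExtension.isLF (h : IsExtension I E Q) (hI : IsLF I) (hQ : IsLF Q) : IsLF E := by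
  classical
  obtain ⟨i, π, -, hsurj, hπi⟩ := h
  intro s ε hε
  -- The unital approximation is accurate to `4 · ε/8 = ε/2`. Dropping its scalar part, bounded by
  -- the same distance, at most doubles the error.
  obtain ⟨B, hB, hBs⟩ := hQ (s.image π) (ε / 8) (by positivity)
  let j := Unitization.inrNonUnitalStarAlgHom ℂ Q
  have := finiteDimensional_nonUnitalStarSubalgebra_map j B
  obtain ⟨M, hM, hMs⟩ := (isLFKer_starMap hπi hI).exists_approx
    (Unitization.starMap_surjective hsurj) (adjoinOne (B.map j))
    (s.image (Unitization.inr : E → Unitization ℂ E)) (ε := ε / 8) (by positivity) (by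
      intro a ha
      obtain ⟨a, ha', rfl⟩ := Finset.mem_image.1 ha
      obtain ⟨b, hb, hab⟩ := hBs _ (Finset.mem_image_of_mem _ ha')
      refine ⟨j b, mem_adjoinOne_of_mem ⟨b, hb, rfl⟩, ?_⟩
      have e : Unitization.starMap (R := ℂ) π (a : Unitization ℂ E) - j b = j (π a - b) := by
        rw [Unitization.starMap_inr, map_sub]; rfl
      rw [e]
      exact (NonUnitalStarAlgHom.norm_apply_le j _).trans_lt hab)
  let N : NonUnitalStarSubalgebra ℂ E :=
    M.toNonUnitalStarSubalgebra.comap (Unitization.inrNonUnitalStarAlgHom ℂ E)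
  have hN : FiniteDimensional ℂ N := by
    let g : N →ₗ[ℂ] M :=
      { toFun := fun x => ⟨((x : E) : Unitization ℂ E), x.2⟩
        map_add' := fun x y => Subtype.ext (Unitization.inr_add ℂ _ _)
        map_smul' := fun z x => Subtype.ext (Unitization.inr_smul ℂ _ _) }
    refine Module.Finite.of_injective g fun x y hxy => Subtype.ext ?_
    exact Unitization.inr_injective (congrArg Subtype.val hxy)
  refine ⟨N, hN, fun a ha => ?_⟩
  obtain ⟨b, hb, hab⟩ := hMs _ (Finset.mem_image_of_mem _ ha)
  have hinr : b - algebraMap ℂ _ b.fst = (b.snd : Unitization ℂ E) := by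
    rw [Unitization.algebraMap_eq_inl]
    nth_rewrite 1 [← Unitization.inl_fst_add_inr_snd_eq b]
    exact add_sub_cancel_left _ _
  have hfst : ‖b.fst‖ ≤ ‖(a : Unitization ℂ E) - b‖ := by
    have e : ((a : Unitization ℂ E) - b).fst = -b.fst := by
      change (a : Unitization ℂ E).fst - b.fst = _
      rw [Unitization.fst_inr, zero_sub]
    rw [← norm_neg, ← e]
    exact Unitization.norm_fst_le _
  refine ⟨b.snd, ?_, ?_⟩
  · change (b.snd : Unitization ℂ E) ∈ M
    rw [← hinr]
    exact sub_mem hb (M.algebraMap_mem _)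
  · have e : ((a - b.snd : E) : Unitization ℂ E)
        = ((a : Unitization ℂ E) - b) + algebraMap ℂ _ b.fst := by
      rw [Unitization.inr_sub, ← hinr]; abel
    rw [← Unitization.norm_inr (𝕜 := ℂ), e]
    refine (norm_add_le _ _).trans_lt ?_
    rw [norm_algebraMap']
    linarith

end Unitization

/-! ### Bounded families and `c₀`-sums. -/

section BoundedFamilies

variable {X : Type*} {D : Type*} [NonUnitalCStarAlgebra D]

open Classical in
/-- The bounded family supported at one point, as a `*`-homomorphism. -/
noncomputable def lpSingle (x : X) : D →⋆ₙₐ[ℂ] lp (fun _ : X => D) ∞ where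
  toFun d := ⟨fun t => if t = x then d else 0, by
    refine memℓp_infty ⟨‖d‖, ?_⟩
    rintro _ ⟨t, rfl⟩
    dsimp only
    split_ifs <;> simp⟩
  map_smul' z d := lp.ext (funext fun t => by
    change (if t = x then z • d else 0) = z • if t = x then d else 0
    split_ifs <;> simp)
  map_zero' := lp.ext (funext fun t => ite_self 0)
  map_add' d e := lp.ext (funext fun t => by
    change (if t = x then d + e else 0) = (if t = x then d else 0) + if t = x then e else 0
    split_ifs <;> simp)
  map_mul' d e := lp.ext (funext fun t => by
    change (if t = x then d * e else 0) = (if t = x then d else 0) * if t = x then e else 0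
    split_ifs <;> simp)
  map_star' d := lp.ext (funext fun t => by
    change (if t = x then star d else 0) = star (if t = x then d else 0)
    split_ifs <;> simp)

/-- Evaluation of bounded families at a point. -/
def lpEval (x : X) : lp (fun _ : X => D) ∞ →⋆ₙₐ[ℂ] D where
  toFun a := a x
  map_smul' _ _ := rfl
  map_zero' := rfl
  map_add' _ _ := rfl
  map_mul' _ _ := rfl
  map_star' _ := rfl

@[simp] theorem lpEval_apply (x : X) (a : lp (fun _ : X => D) ∞) : lpEval x a = a x := rfl

@[simp] theorem lpSingle_apply_self (x : X) (d : D) : lpSingle x d x = d := by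
  exact if_pos rfl

theorem lpSingle_apply_of_ne {x t : X} (h : t ≠ x) (d : D) : lpSingle x d t = 0 := by
  exact if_neg h

theorem sum_lpSingle_apply (G : Finset X) (f : X → D) (t : X) [Decidable (t ∈ G)] :
    (∑ x ∈ G, lpSingle x (f x)) t = if t ∈ G then f t else 0 := by
  rw [← lpEval_apply, map_sum]
  simp only [lpEval_apply]
  split_ifs with h
  · rw [Finset.sum_eq_single_of_mem t h fun x _ hx => lpSingle_apply_of_ne (Ne.symm hx) _,
      lpSingle_apply_self]
  · exact Finset.sum_eq_zero fun x hx =>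
      lpSingle_apply_of_ne (fun e : t = x => h (by rwa [e])) _

theorem lpSingle_mul_mul_lpSingle (x : X) (d e : D) (a : lp (fun _ : X => D) ∞) :
    lpSingle x d * a * lpSingle x e = lpSingle x (d * a x * e) := by
  refine lp.ext (funext fun t => ?_)
  change lpSingle x d t * a t * lpSingle x e t = _
  by_cases h : t = x
  · subst h; simp
  · simp [lpSingle_apply_of_ne h]

variable (X D) in
/-- The `c₀`-direct sum of copies of a C*-algebra. -/
def c0Sum : NonUnitalStarSubalgebra ℂ (lp (fun _ : X => D) ∞) where
  carrier := {a | Tendsto (fun x => a x) cofinite (𝓝 0)}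
  add_mem' ha hb := by
    have := Tendsto.add ha hb
    rwa [add_zero] at this
  zero_mem' := tendsto_const_nhds
  mul_mem' ha hb := by
    have := Tendsto.mul ha hb
    rwa [mul_zero] at this
  smul_mem' c a ha := by
    have := Tendsto.const_smul ha c
    rwa [smul_zero] at this
  star_mem' ha := by
    have := Tendsto.star ha
    rwa [star_zero] at this

set_option synthInstance.maxHeartbeats 400000 in
noncomputable instance instNonUnitalRingC0Sum : NonUnitalRing (c0Sum X D) := inferInstance

noncomputable instance instAddCommGroupC0Sum : AddCommGroup (c0Sum X D) :=
  instNonUnitalRingC0Sum.toAddCommGroup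

noncomputable instance instAddGroupC0Sum : AddGroup (c0Sum X D) :=
  instAddCommGroupC0Sum.toAddGroup

noncomputable instance instAddC0Sum : Add (c0Sum X D) :=
  instNonUnitalRingC0Sum.toAdd

noncomputable instance instMulC0Sum : Mul (c0Sum X D) := instNonUnitalRingC0Sum.toMul

set_option synthInstance.maxHeartbeats 400000 in
noncomputable instance instModuleC0Sum : Module ℂ (c0Sum X D) := inferInstance

noncomputable instance instSMulC0Sum : SMul ℂ (c0Sum X D) := instModuleC0Sum.toSMul

noncomputable instance instDistribMulActionC0Sum : DistribMulAction ℂ (c0Sum X D) :=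
  instModuleC0Sum.toDistribMulAction

theorem mem_c0Sum {a : lp (fun _ : X => D) ∞} :
    a ∈ c0Sum X D ↔ Tendsto (fun x => a x) cofinite (𝓝 0) := Iff.rfl

theorem mem_c0Sum_iff_finite {a : lp (fun _ : X => D) ∞} :
    a ∈ c0Sum X D ↔ ∀ ε > 0, {x | ε ≤ ‖a x‖}.Finite := by
  rw [mem_c0Sum, Metric.tendsto_nhds]
  simp only [dist_zero_right, Filter.eventually_cofinite, not_lt]

theorem mem_c0Sum_of_forall_near {a : lp (fun _ : X => D) ∞}
    (h : ∀ ε > 0, ∃ b ∈ c0Sum X D, ‖a - b‖ < ε) : a ∈ c0Sum X D := by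
  rw [mem_c0Sum_iff_finite]
  intro ε hε
  obtain ⟨b, hb, hab⟩ := h (ε / 2) (half_pos hε)
  refine (mem_c0Sum_iff_finite.1 hb (ε / 2) (half_pos hε)).subset fun x hx => ?_
  have h1 : ‖a x - b x‖ ≤ ‖a - b‖ := lp.norm_apply_le_norm ENNReal.top_ne_zero (a - b) x
  have h2 := norm_le_norm_add_norm_sub' (a x) (b x)
  simp only [Set.mem_ofPred_eq] at hx ⊢
  linarith

instance instIsClosedC0Sum : IsClosed (c0Sum X D : Set (lp (fun _ : X => D) ∞)) := by
  refine isClosed_of_closure_subset fun a ha => mem_c0Sum_of_forall_near fun ε hε => ?_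
  obtain ⟨b, hb, hab⟩ := Metric.mem_closure_iff.1 ha ε hε
  exact ⟨b, hb, by rwa [← dist_eq_norm]⟩

noncomputable instance instNonUnitalCStarAlgebraC0Sum : NonUnitalCStarAlgebra (c0Sum X D) :=
  inferInstance

noncomputable instance instNormedAddCommGroupC0Sum : NormedAddCommGroup (c0Sum X D) :=
  inferInstance

theorem lpSingle_mem_c0Sum (x : X) (d : D) : lpSingle x d ∈ c0Sum X D := by
  rw [mem_c0Sum_iff_finite]
  refine fun ε hε => (Set.finite_singleton x).subset fun t ht => ?_
  by_contra h
  rw [Set.mem_ofPred_eq, lpSingle_apply_of_ne h, norm_zero] at ht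
  linarith

theorem mul_mem_c0Sum_left (a : lp (fun _ : X => D) ∞) {b : lp (fun _ : X => D) ∞}
    (hb : b ∈ c0Sum X D) : a * b ∈ c0Sum X D := by
  rw [mem_c0Sum, tendsto_zero_iff_norm_tendsto_zero] at *
  refine squeeze_zero (fun _ => norm_nonneg _) (fun x => ?_) (by simpa using hb.const_mul ‖a‖)
  exact (norm_mul_le _ _).trans (mul_le_mul_of_nonneg_right
    (lp.norm_apply_le_norm ENNReal.top_ne_zero a x) (norm_nonneg _))

theorem mul_mem_c0Sum_right {a : lp (fun _ : X => D) ∞} (b : lp (fun _ : X => D) ∞)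
    (ha : a ∈ c0Sum X D) : a * b ∈ c0Sum X D := by
  have := star_mem (mul_mem_c0Sum_left (star b) (star_mem ha))
  rwa [star_mul, star_star, star_star] at this

/-- A family in the `c₀`-direct sum is approximated by finitely supported families, whose values may
be prescribed approximately. -/
theorem norm_sub_sum_lpSingle_le {a : lp (fun _ : X => D) ∞} {G : Finset X} {f : X → D} {ε : ℝ}
    (hε : 0 ≤ ε) (hG : ∀ x, ε < ‖a x‖ → x ∈ G) (hf : ∀ x ∈ G, ‖a x - f x‖ ≤ ε) :
    ‖a - ∑ x ∈ G, lpSingle x (f x)‖ ≤ ε := by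
  classical
  refine lp.norm_le_of_forall_le hε fun t => ?_
  change ‖a t - (∑ x ∈ G, lpSingle x (f x)) t‖ ≤ ε
  rw [sum_lpSingle_apply]
  split_ifs with h
  · exact hf t h
  · rw [sub_zero]
    exact not_lt.1 fun h' => h (hG t h')

theorem mem_of_mem_c0Sum {K : Submodule ℂ (lp (fun _ : X => D) ∞)}
    (hK : IsClosed (K : Set (lp (fun _ : X => D) ∞))) (h : ∀ x d, lpSingle x d ∈ K)
    {a : lp (fun _ : X => D) ∞} (ha : a ∈ c0Sum X D) : a ∈ K := by
  rw [← SetLike.mem_coe, ← hK.closure_eq, Metric.mem_closure_iff]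
  intro ε hε
  have hfin := mem_c0Sum_iff_finite.1 ha (ε / 2) (half_pos hε)
  refine ⟨∑ x ∈ hfin.toFinset, lpSingle x (a x), K.sum_mem fun x _ => h x _, ?_⟩
  rw [dist_eq_norm]
  exact (norm_sub_sum_lpSingle_le (half_pos hε).le (fun x hx => by simpa using hx.le)
    (fun x _ => by simpa using (half_pos hε).le)).trans_lt (half_lt_self hε)

/-- The families in the `c₀`-direct sum supported in `G` with values in `B`. -/
def c0SumSubalgebra (G : Set X) (B : NonUnitalStarSubalgebra ℂ D) :
    NonUnitalStarSubalgebra ℂ (c0Sum X D) where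
  carrier := {a | ∀ x, (a : lp (fun _ : X => D) ∞) x ∈ B ∧ (x ∉ G → (a : lp (fun _ : X => D) ∞) x = 0)}
  add_mem' {a b} ha hb x := ⟨add_mem (ha x).1 (hb x).1, fun hx => by
    change (a : lp (fun _ : X => D) ∞) x + (b : lp (fun _ : X => D) ∞) x = 0
    rw [(ha x).2 hx, (hb x).2 hx, add_zero]⟩
  zero_mem' x := ⟨zero_mem B, fun _ => rfl⟩
  mul_mem' {a b} ha hb x := ⟨mul_mem (ha x).1 (hb x).1, fun hx => by
    change (a : lp (fun _ : X => D) ∞) x * (b : lp (fun _ : X => D) ∞) x = 0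
    rw [(ha x).2 hx, zero_mul]⟩
  smul_mem' c a ha x := ⟨SMulMemClass.smul_mem c (ha x).1, fun hx => by
    change c • (a : lp (fun _ : X => D) ∞) x = 0
    rw [(ha x).2 hx, smul_zero]⟩
  star_mem' {a} ha x := ⟨star_mem (ha x).1, fun hx => by
    change star ((a : lp (fun _ : X => D) ∞) x) = 0
    rw [(ha x).2 hx, star_zero]⟩

theorem finiteDimensional_c0SumSubalgebra (G : Finset X) (B : NonUnitalStarSubalgebra ℂ D)
    [FiniteDimensional ℂ B] : FiniteDimensional ℂ (c0SumSubalgebra (G : Set X) B) := by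
  let g : c0SumSubalgebra (G : Set X) B →ₗ[ℂ] (G → B) :=
    { toFun := fun a x => ⟨((a : c0Sum X D) : lp (fun _ : X => D) ∞) x, (a.2 x).1⟩
      map_add' := fun _ _ => rfl
      map_smul' := fun _ _ => rfl }
  refine Module.Finite.of_injective g fun a b hab => ?_
  refine Subtype.ext (Subtype.ext (lp.ext (funext fun x => ?_)))
  by_cases hx : x ∈ G
  · exact congrArg Subtype.val (congrFun hab ⟨x, hx⟩)
  · exact ((a.2 x).2 hx).trans ((b.2 x).2 hx).symm

/-- The subalgebras are indexed by a finite support and a single member of the family of `D`;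
directedness in `D` lets one member serve all points of the support. -/
theorem IsAF.c0Sum (hD : IsAF D) : IsAF (c0Sum X D) := by
  classical
  obtain ⟨S, ⟨B₀, hB₀⟩, hdir, hfin, hdense⟩ := hD
  refine ⟨{T | ∃ (G : Finset X) (B : _), B ∈ S ∧ T = c0SumSubalgebra (G : Set X) B},
    ⟨_, ∅, B₀, hB₀, rfl⟩, ?_, ?_, ?_⟩
  · rintro _ ⟨G, B, hB, rfl⟩ _ ⟨G', B', hB', rfl⟩
    obtain ⟨B'', hB'', h1, h2⟩ := hdir B hB B' hB'
    refine ⟨_, ⟨G ∪ G', B'', hB'', rfl⟩, fun a ha x => ⟨h1 (ha x).1, fun hx => (ha x).2 ?_⟩,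
      fun a ha x => ⟨h2 (ha x).1, fun hx => (ha x).2 ?_⟩⟩ <;>
    simp_all
  · rintro _ ⟨G, B, hB, rfl⟩
    have := hfin B hB
    exact finiteDimensional_c0SumSubalgebra G B
  · refine Metric.dense_iff.2 fun a ε hε => ?_
    have hfinite := mem_c0Sum_iff_finite.1 a.2 (ε / 2) (half_pos hε)
    have key : ∀ G : Finset X, ∃ B ∈ S, ∀ x ∈ G, ∃ d ∈ B,
        ‖(a : lp (fun _ : X => D) ∞) x - d‖ < ε / 2 := by
      intro G
      induction G using Finset.induction_on with
      | empty => exact ⟨B₀, hB₀, by simp⟩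
      | insert x G _ ih =>
        obtain ⟨B, hB, hBG⟩ := ih
        obtain ⟨d, hd1, hd2⟩ := Metric.dense_iff.1 hdense ((a : lp (fun _ : X => D) ∞) x) (ε / 2)
          (half_pos hε)
        simp only [Set.mem_iUnion] at hd2
        obtain ⟨B', hB', hd⟩ := hd2
        obtain ⟨B'', hB'', h1, h2⟩ := hdir B hB B' hB'
        refine ⟨B'', hB'', fun t ht => ?_⟩
        rcases Finset.mem_insert.1 ht with rfl | ht
        · exact ⟨d, h2 hd, by rwa [← dist_eq_norm, dist_comm]⟩
        · obtain ⟨e, he, h⟩ := hBG t ht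
          exact ⟨e, h1 he, h⟩
    obtain ⟨B, hB, hBG⟩ := key hfinite.toFinset
    choose! f hf hfa using hBG
    refine ⟨∑ x ∈ hfinite.toFinset, ⟨lpSingle x (f x), lpSingle_mem_c0Sum x _⟩, ?_, ?_⟩
    · rw [Metric.mem_ball, dist_comm, dist_eq_norm]
      change ‖(a : lp (fun _ : X => D) ∞)
        - ((∑ x ∈ hfinite.toFinset, ⟨lpSingle x (f x), lpSingle_mem_c0Sum x _⟩ : _root_.c0Sum X D) :
          lp (fun _ : X => D) ∞)‖ < ε
      rw [AddSubmonoidClass.coe_finsetSum]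
      refine (norm_sub_sum_lpSingle_le (half_pos hε).le (fun x hx => by simpa using hx.le)
        (fun x hx => (hfa x hx).le)).trans_lt (half_lt_self hε)
    · simp only [Set.mem_iUnion]
      refine ⟨_, ⟨hfinite.toFinset, B, hB, rfl⟩, sum_mem fun x hx t => ?_⟩
      change lpSingle x (f x) t ∈ B ∧ (t ∉ _ → lpSingle x (f x) t = 0)
      by_cases h : t = x
      · subst h
        exact ⟨by rw [lpSingle_apply_self]; exact hf t hx, fun h => absurd hx h⟩
      · exact ⟨by rw [lpSingle_apply_of_ne h]; exact zero_mem B, fun _ => lpSingle_apply_of_ne h _⟩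

theorem isAF_of_finiteDimensional [FiniteDimensional ℂ D] : IsAF D := by
  refine ⟨{⊤}, Set.singleton_nonempty _, ?_, ?_, ?_⟩
  · rintro _ rfl _ rfl
    exact ⟨⊤, rfl, le_rfl, le_rfl⟩
  · rintro _ rfl
    exact Module.Finite.of_injective
      (NonUnitalStarSubalgebra.toNonUnitalSubalgebra ⊤ : NonUnitalSubalgebra ℂ D).toSubmodule.subtype
      Subtype.val_injective
  · convert dense_univ
    simp

end BoundedFamilies

/-! ### The algebra `D`: entries, truncations, and why it is AF. -/

section DimensionDrop

set_option synthInstance.maxHeartbeats 400000 in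
noncomputable local instance instModuleDimDrop : Module ℂ DimDrop := inferInstance

noncomputable local instance instSMulDimDrop : SMul ℂ DimDrop := instModuleDimDrop.toSMul

set_option synthInstance.maxHeartbeats 400000 in
noncomputable local instance instNonUnitalRingDimDrop : NonUnitalRing DimDrop := inferInstance

noncomputable local instance instAddCommGroupDimDrop : AddCommGroup DimDrop :=
  instNonUnitalRingDimDrop.toAddCommGroup

noncomputable local instance instAddGroupDimDrop : AddGroup DimDrop :=
  instAddCommGroupDimDrop.toAddGroup

noncomputable local instance instAddCommMonoidDimDrop : AddCommMonoid DimDrop :=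
  instAddCommGroupDimDrop.toAddCommMonoid

noncomputable local instance instAddZeroClassDimDrop : AddZeroClass DimDrop :=
  instAddCommMonoidDimDrop.toAddMonoid.toAddZeroClass

noncomputable local instance instAddDimDrop : Add DimDrop := instAddZeroClassDimDrop.toAdd

noncomputable local instance instMulDimDrop : Mul DimDrop := instNonUnitalRingDimDrop.toMul

noncomputable local instance instDistribMulActionDimDrop : DistribMulAction ℂ DimDrop :=
  instModuleDimDrop.toDistribMulAction

noncomputable local instance instDistribSMulDimDrop : DistribSMul ℂ DimDrop :=
  instModuleDimDrop.toDistribMulAction.toDistribSMul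

set_option synthInstance.maxHeartbeats 400000 in
noncomputable local instance instNonUnitalCStarAlgebraDimDrop : NonUnitalCStarAlgebra DimDrop :=
  inferInstance

set_option synthInstance.maxHeartbeats 400000 in
noncomputable local instance instNormedAddCommGroupDimDrop : NormedAddCommGroup DimDrop :=
  inferInstance

noncomputable local instance instSeminormedAddGroupDimDrop : SeminormedAddGroup DimDrop :=
  instNormedAddCommGroupDimDrop.toSeminormedAddCommGroup.toSeminormedAddGroup

theorem isStarProjection_lineProj (θ : ℝ) : IsStarProjection (lineProj θ) := by
  refine ⟨?_, lineProj_star θ⟩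
  have h : (Complex.sin θ) ^ 2 = 1 - Complex.cos θ ^ 2 := by
    rw [← Complex.sin_sq_add_cos_sq (θ : ℂ)]; ring
  ext i j
  fin_cases i <;> fin_cases j <;> simp [lineProj, Matrix.mul_apply] <;> ring_nf
  · linear_combination (Complex.sin θ ^ 2) * h
  · linear_combination (Complex.sin θ * Complex.cos θ) * h
  · linear_combination (Complex.sin θ * Complex.cos θ) * h
  · linear_combination (Complex.cos θ ^ 2) * h

theorem lineProj_zero : lineProj 0 = !![0, 0; 0, 1] := by
  simp [lineProj]

theorem lineProj_zero_ne_zero : lineProj 0 ≠ 0 := fun h => by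
  have := congrFun (congrFun h 1) 1
  simp [lineProj_zero] at this

theorem lineProj_zero_mul_mul (m : M2) : lineProj 0 * m * lineProj 0 = m 1 1 • lineProj 0 := by
  rw [lineProj_zero]
  ext i j
  fin_cases i <;> fin_cases j <;> simp [Matrix.mul_apply, Matrix.vecMul, dotProduct]

theorem lineProj_zero_mul_lineProj_mul (θ : ℝ) :
    lineProj 0 * lineProj θ * lineProj 0 = (Real.cos θ ^ 2 : ℝ) • lineProj 0 := by
  rw [lineProj_zero_mul_mul]
  ext i j
  simp [lineProj]

/-- Every matrix is obtained from `P_0` and `P_θ` when `sin θ` and `cos θ` do not vanish. -/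
theorem mem_of_lineProj_mem {S : NonUnitalStarSubalgebra ℂ M2} {θ : ℝ} (hs : Real.sin θ ≠ 0)
    (hc : Real.cos θ ≠ 0) (h0 : lineProj 0 ∈ S) (hθ : lineProj 0 * lineProj θ ∈ S) (m : M2) :
    m ∈ S := by
  have hs' : (Real.sin θ : ℂ) ≠ 0 := Complex.ofReal_ne_zero.2 hs
  have hc' : (Real.cos θ : ℂ) ≠ 0 := Complex.ofReal_ne_zero.2 hc
  have h22 : (!![0, 0; 0, 1] : M2) ∈ S := lineProj_zero ▸ h0
  have h21 : (!![0, 0; 1, 0] : M2) ∈ S := by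
    have e : (!![0, 0; 1, 0] : M2) = ((Real.sin θ : ℂ) * Real.cos θ)⁻¹ •
        (lineProj 0 * lineProj θ - ((Real.cos θ : ℂ) ^ 2) • lineProj 0) := by
      rw [lineProj_zero]
      ext i j
      fin_cases i <;> fin_cases j <;> simp [lineProj]
      rw [← Complex.ofReal_sin, ← Complex.ofReal_cos]
      field_simp
    rw [e]
    exact SMulMemClass.smul_mem _ (sub_mem hθ (SMulMemClass.smul_mem _ h0))
  have h12 : (!![0, 1; 0, 0] : M2) ∈ S := by
    have e : (!![0, 1; 0, 0] : M2) = star (!![0, 0; 1, 0] : M2) := by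
      ext i j
      fin_cases i <;> fin_cases j <;> simp [Matrix.star_apply]
    rw [e]
    exact star_mem h21
  have h11 : (!![1, 0; 0, 0] : M2) ∈ S := by
    have e : (!![1, 0; 0, 0] : M2) = !![0, 1; 0, 0] * !![0, 0; 1, 0] := by
      ext i j
      fin_cases i <;> fin_cases j <;> simp [Matrix.mul_apply]
    rw [e]
    exact mul_mem h12 h21
  have e : m = m 0 0 • !![1, 0; 0, 0] + m 0 1 • !![0, 1; 0, 0] + m 1 0 • !![0, 0; 1, 0]
      + m 1 1 • !![0, 0; 0, 1] := by
    ext i j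
    fin_cases i <;> fin_cases j <;> simp
  rw [e]
  exact add_mem (add_mem (add_mem (SMulMemClass.smul_mem _ h11) (SMulMemClass.smul_mem _ h12))
    (SMulMemClass.smul_mem _ h21)) (SMulMemClass.smul_mem _ h22)

/-- The element of `D` supported at one index. -/
noncomputable def dimSingle (n : ℕ) : M2 →⋆ₙₐ[ℂ] DimDrop :=
  NonUnitalStarAlgHom.codRestrict (lpSingle n) dimDrop fun m => ⟨0, by
    rw [zero_smul, ← Nat.cofinite_eq_atTop]
    exact lpSingle_mem_c0Sum n m⟩

/-- The entry of an element of `D` at an index. -/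
noncomputable def dimEval (n : ℕ) : DimDrop →⋆ₙₐ[ℂ] M2 :=
  (lpEval n).comp (NonUnitalStarSubalgebraClass.subtype dimDrop)

theorem dimDrop_ext {d e : DimDrop} (h : ∀ n, dimEval n d = dimEval n e) : d = e :=
  Subtype.ext (lp.ext (funext h))

theorem dimDrop_norm_le {d : DimDrop} {r : ℝ} (hr : 0 ≤ r) (h : ∀ n, ‖dimEval n d‖ ≤ r) :
    ‖d‖ ≤ r :=
  lp.norm_le_of_forall_le (f := (d : SeqM2)) hr h

@[simp] theorem dimEval_dimSingle_self (n : ℕ) (m : M2) : dimEval n (dimSingle n m) = m :=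
  lpSingle_apply_self n m

theorem dimEval_dimSingle_of_ne {n k : ℕ} (h : k ≠ n) (m : M2) : dimEval k (dimSingle n m) = 0 :=
  lpSingle_apply_of_ne h m

@[simp] theorem dimEval_projP (n : ℕ) : dimEval n projP = lineProj 0 := rfl

@[simp] theorem dimEval_projQ (n : ℕ) : dimEval n projQ = lineProj (1 / ((n : ℝ) + 1)) := rfl

theorem dimSingle_mul (d : DimDrop) (n : ℕ) (m : M2) :
    dimSingle n m * d = dimSingle n (m * dimEval n d) := by
  refine dimDrop_ext fun k => ?_
  rw [map_mul]
  by_cases h : k = n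
  · subst h; simp
  · simp [dimEval_dimSingle_of_ne h]

theorem isStarProjection_projP : IsStarProjection projP :=
  ⟨dimDrop_ext fun n => by rw [map_mul, dimEval_projP, lineProj_zero_mul],
    dimDrop_ext fun n => by rw [map_star, dimEval_projP, lineProj_star]⟩

theorem isStarProjection_projQ : IsStarProjection projQ :=
  ⟨dimDrop_ext fun n => by
      rw [map_mul, dimEval_projQ]; exact (isStarProjection_lineProj _).isIdempotentElem.eq,
    dimDrop_ext fun n => by rw [map_star, dimEval_projQ, lineProj_star]⟩

theorem projP_ne_zero : projP ≠ 0 := fun h => lineProj_zero_ne_zero (by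
  have := congrArg (dimEval 0) h
  rwa [map_zero] at this)

theorem exists_dimDrop_limit (d : DimDrop) :
    ∃ z : ℂ, ∀ ε > 0, ∃ N, ∀ n ≥ N, ‖dimEval n d - z • lineProj 0‖ < ε := by
  obtain ⟨z, hz⟩ := d.2
  refine ⟨z, fun ε hε => ?_⟩
  obtain ⟨N, hN⟩ := Metric.tendsto_atTop.1 hz ε hε
  exact ⟨N, fun n hn => by rw [← dist_eq_norm]; exact hN n hn⟩

/-- An element of `D` is approximated by the elements which agree with a multiple of `p` from some
index on. -/
theorem norm_sub_truncation_le {d : DimDrop} {z : ℂ} {N : ℕ} {ε : ℝ} (hε : 0 ≤ ε)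
    (h : ∀ n ≥ N, ‖dimEval n d - z • lineProj 0‖ ≤ ε) :
    ‖d - (z • projP + ∑ n ∈ Finset.range N, dimSingle n (dimEval n d - z • lineProj 0))‖ ≤ ε := by
  refine dimDrop_norm_le hε fun k => ?_
  rw [map_sub, map_add, map_smul, dimEval_projP, map_sum]
  by_cases hk : k < N
  · rw [Finset.sum_eq_single_of_mem k (Finset.mem_range.2 hk)
      fun n _ hn => dimEval_dimSingle_of_ne (Ne.symm hn) _, dimEval_dimSingle_self]
    simpa using hε
  · rw [Finset.sum_eq_zero fun n hn => dimEval_dimSingle_of_ne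
      (fun e : k = n => hk (e ▸ Finset.mem_range.1 hn)) _, add_zero]
    exact h k (not_lt.1 hk)

theorem mem_of_dimSingle_mem {K : Submodule ℂ DimDrop} (hK : IsClosed (K : Set DimDrop))
    (hp : projP ∈ K) (hs : ∀ n m, dimSingle n m ∈ K) (d : DimDrop) : d ∈ K := by
  rw [← SetLike.mem_coe, ← hK.closure_eq, Metric.mem_closure_iff]
  intro ε hε
  obtain ⟨z, hz⟩ := exists_dimDrop_limit d
  obtain ⟨N, hN⟩ := hz (ε / 2) (half_pos hε)
  refine ⟨z • projP + ∑ n ∈ Finset.range N, dimSingle n (dimEval n d - z • lineProj 0),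
    K.add_mem (K.smul_mem z hp) (K.sum_mem fun n _ => hs n _), ?_⟩
  refine lt_of_eq_of_lt (dist_eq_norm (E := DimDrop) d _) ?_
  exact (norm_sub_truncation_le (half_pos hε).le fun n hn => (hN n hn).le).trans_lt
    (half_lt_self hε)

/-- The elements of `D` which agree with a multiple of `p` from the index `N` on. -/
noncomputable def dimDropTrunc (N : ℕ) : NonUnitalStarSubalgebra ℂ DimDrop where
  carrier := {d | ∃ z : ℂ, ∀ n ≥ N, dimEval n d = z • lineProj 0}
  add_mem' := by
    rintro a b ⟨z, hz⟩ ⟨w, hw⟩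
    exact ⟨z + w, fun n hn => by rw [map_add, hz n hn, hw n hn, add_smul]⟩
  zero_mem' := ⟨0, fun n _ => by rw [map_zero, zero_smul]⟩
  mul_mem' := by
    rintro a b ⟨z, hz⟩ ⟨w, hw⟩
    exact ⟨z * w, fun n hn => by
      rw [map_mul, hz n hn, hw n hn, smul_mul_smul_comm, lineProj_zero_mul]⟩
  smul_mem' := by
    rintro c a ⟨z, hz⟩
    exact ⟨c * z, fun n hn => by rw [map_smul, hz n hn, mul_smul]⟩
  star_mem' := by
    rintro a ⟨z, hz⟩
    exact ⟨star z, fun n hn => by rw [map_star, hz n hn, star_smul, lineProj_star]⟩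

theorem finiteDimensional_dimDropTrunc (N : ℕ) : FiniteDimensional ℂ (dimDropTrunc N) := by
  -- The entry at `N` is kept as well, because it determines the scalar of the tail.
  let g : dimDropTrunc N →ₗ[ℂ] (Fin (N + 1) → M2) :=
    { toFun := fun d i => dimEval i d
      map_add' := fun _ _ => rfl
      map_smul' := fun _ _ => rfl }
  refine Module.Finite.of_injective g fun d e hde => Subtype.ext (dimDrop_ext fun n => ?_)
  have h : ∀ k, k < N + 1 → dimEval k (d : DimDrop) = dimEval k (e : DimDrop) := fun k hk =>
    congrFun hde ⟨k, hk⟩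
  by_cases hn : n < N + 1
  · exact h n hn
  · obtain ⟨z, hz⟩ := d.2
    obtain ⟨w, hw⟩ := e.2
    have h1 := h N (Nat.lt_succ_self N)
    rw [hz N le_rfl, hw N le_rfl] at h1
    rw [hz n (by omega), hw n (by omega), h1]

theorem isAF_dimDrop : IsAF DimDrop := by
  refine ⟨Set.range dimDropTrunc, Set.range_nonempty _, ?_, ?_, ?_⟩
  · rintro _ ⟨N, rfl⟩ _ ⟨M, rfl⟩
    refine ⟨_, ⟨max N M, rfl⟩, ?_, ?_⟩
    · rintro d ⟨z, hz⟩
      exact ⟨z, fun n hn => hz n ((le_max_left _ _).trans hn)⟩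
    · rintro d ⟨z, hz⟩
      exact ⟨z, fun n hn => hz n ((le_max_right _ _).trans hn)⟩
  · rintro _ ⟨N, rfl⟩
    exact finiteDimensional_dimDropTrunc N
  · refine Metric.dense_iff.2 fun d ε hε => ?_
    obtain ⟨z, hz⟩ := exists_dimDrop_limit d
    obtain ⟨N, hN⟩ := hz (ε / 2) (half_pos hε)
    refine ⟨z • projP + ∑ n ∈ Finset.range N, dimSingle n (dimEval n d - z • lineProj 0), ?_,
      Set.mem_iUnion₂.2 ⟨_, ⟨N, rfl⟩, ?_⟩⟩
    · rw [Metric.mem_ball, dist_comm]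
      refine lt_of_eq_of_lt (dist_eq_norm (E := DimDrop) d _) ?_
      exact (norm_sub_truncation_le (half_pos hε).le fun n hn => (hN n hn).le).trans_lt
        (half_lt_self hε)
    · refine ⟨z, fun n hn => ?_⟩
      rw [map_add, map_smul, dimEval_projP, map_sum, Finset.sum_eq_zero, add_zero]
      intro k hk
      exact dimEval_dimSingle_of_ne (fun e => by have := Finset.mem_range.1 hk; omega) _

theorem not_finiteDimensional_dimDrop : ¬ FiniteDimensional ℂ DimDrop := by
  intro h
  have hli : LinearIndependent ℂ fun n : ℕ => dimSingle n (lineProj 0) := by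
    rw [linearIndependent_iff']
    intro s g hg i hi
    have h1 := congrArg (dimEval i) hg
    rw [map_sum, map_zero, Finset.sum_eq_single_of_mem i hi fun n _ hn => by
      rw [map_smul, dimEval_dimSingle_of_ne (Ne.symm hn), smul_zero], map_smul,
      dimEval_dimSingle_self] at h1
    exact (smul_eq_zero.1 h1).resolve_right lineProj_zero_ne_zero
  have := hli.finite
  exact not_finite ℕ

end DimensionDrop

/-! ### `D` is generated by `p` and `q`. -/

section Generation

attribute [local instance] instModuleDimDrop instSMulDimDrop instNonUnitalRingDimDrop
  instAddCommGroupDimDrop instAddGroupDimDrop instAddCommMonoidDimDrop instAddZeroClassDimDrop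
  instAddDimDrop instMulDimDrop instDistribMulActionDimDrop instDistribSMulDimDrop
  instNonUnitalCStarAlgebraDimDrop instNormedAddCommGroupDimDrop instSeminormedAddGroupDimDrop

/-- The squared cosines of the angles between the lines of `p` and `q` are separated. -/
theorem exists_cos_sq_separated (n : ℕ) : ∃ γ : ℝ, 0 < γ ∧ ∀ m : ℕ, m ≠ n →
    γ ≤ (Real.cos (1 / ((m : ℝ) + 1)) ^ 2 - Real.cos (1 / ((n : ℝ) + 1)) ^ 2) ^ 2 := by
  set c : ℕ → ℝ := fun m => Real.cos (1 / ((m : ℝ) + 1)) ^ 2 with hc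
  have hmem : ∀ m : ℕ, 0 < 1 / ((m : ℝ) + 1) ∧ 1 / ((m : ℝ) + 1) ≤ 1 := fun m =>
    ⟨by positivity, by
      rw [div_le_one (by positivity)]
      have : (0 : ℝ) ≤ m := Nat.cast_nonneg m
      linarith⟩
  have hpi : (1 : ℝ) < Real.pi / 2 := by
    have := Real.pi_gt_three
    linarith
  -- The squared cosines increase strictly with the index, so the values closest to the one at `n`
  -- are those of its neighbours.
  have hmono : StrictMono c := fun m k hmk => by
    have h1 : 1 / ((k : ℝ) + 1) < 1 / ((m : ℝ) + 1) := by
      have : (m : ℝ) < k := Nat.cast_lt.2 hmk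
      exact one_div_lt_one_div_of_lt (by positivity) (by linarith)
    have h2 : Real.cos (1 / ((m : ℝ) + 1)) < Real.cos (1 / ((k : ℝ) + 1)) :=
      Real.cos_lt_cos_of_nonneg_of_le_pi_div_two (hmem k).1.le ((hmem m).2.trans hpi.le) h1
    have h3 : 0 < Real.cos (1 / ((m : ℝ) + 1)) :=
      Real.cos_pos_of_mem_Ioo ⟨by linarith [(hmem m).1], (hmem m).2.trans_lt hpi⟩
    exact pow_lt_pow_left₀ h2 h3.le two_ne_zero
  have h1 : 0 < (c (n + 1) - c n) ^ 2 := pow_pos (sub_pos.2 (hmono n.lt_succ_self)) 2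
  have hup : ∀ m, n < m → (c (n + 1) - c n) ^ 2 ≤ (c m - c n) ^ 2 := fun m hm =>
    pow_le_pow_left₀ (sub_pos.2 (hmono n.lt_succ_self)).le
      (sub_le_sub_right (hmono.monotone hm) _) 2
  rcases Nat.eq_zero_or_pos n with rfl | hn
  · exact ⟨_, h1, fun m hm => hup m (Nat.pos_of_ne_zero hm)⟩
  · have h2 : 0 < c n - c (n - 1) := sub_pos.2 (hmono (Nat.sub_lt hn one_pos))
    refine ⟨min ((c (n + 1) - c n) ^ 2) ((c n - c (n - 1)) ^ 2), lt_min h1 (pow_pos h2 2),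
      fun m hm => ?_⟩
    rcases lt_or_gt_of_ne hm with h | h
    · refine (min_le_right _ _).trans ?_
      rw [← neg_sq (c m - c n), neg_sub]
      exact pow_le_pow_left₀ h2.le (sub_le_sub_left (hmono.monotone (Nat.le_sub_one_of_lt h)) _) 2
    · exact (min_le_left _ _).trans (hup m h)

/-- At index `m` the element `p q p` is `cos²(1/(m+1)) P_0`, and these values are separated from the
one at `n`. So `y = p - (p q p - cos²(1/(n+1)) p)²` is `P_0` at `n` and a multiple of `P_0` with
factor uniformly below `1` elsewhere; its powers converge to the projection at `n`. -/
theorem dimSingle_lineProj_zero_mem {C : NonUnitalStarSubalgebra ℂ DimDrop}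
    (hC : IsClosed (C : Set DimDrop)) (hp : projP ∈ C) (hq : projQ ∈ C) (n : ℕ) :
    dimSingle n (lineProj 0) ∈ C := by
  set c : ℕ → ℝ := fun m => Real.cos (1 / ((m : ℝ) + 1)) ^ 2 with hc
  obtain ⟨γ, hγ, hsep⟩ := exists_cos_sq_separated n
  let x : DimDrop := projP * projQ * projP - ((c n : ℝ) : ℂ) • projP
  have hx : x ∈ C := sub_mem (mul_mem (mul_mem hp hq) hp) (SMulMemClass.smul_mem _ hp)
  have hxm : ∀ m, dimEval m x = ((c m - c n : ℝ) : ℂ) • lineProj 0 := fun m => by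
    simp only [x, map_sub, map_mul, map_smul, dimEval_projP, dimEval_projQ,
      lineProj_zero_mul_lineProj_mul, hc]
    rw [Complex.ofReal_sub, sub_smul, Complex.coe_smul, Complex.coe_smul]
  let y : DimDrop := projP - x * x
  have hy : y ∈ C := sub_mem hp (mul_mem hx hx)
  have hym : ∀ m, dimEval m y = ((1 - (c m - c n) ^ 2 : ℝ) : ℂ) • lineProj 0 := fun m => by
    simp only [y, map_sub, map_mul, hxm, dimEval_projP]
    rw [smul_mul_smul_comm, lineProj_zero_mul, ← Complex.ofReal_mul, ← sq, Complex.ofReal_sub 1,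
      sub_smul, Complex.ofReal_one, one_smul]
  -- `u k` is the power `y^(k+1)`, written without a unit.
  let u : ℕ → DimDrop := fun k => Nat.rec y (fun _ v => v * y) k
  have hu : ∀ k, u k ∈ C := fun k => by
    induction k with
    | zero => exact hy
    | succ k ih => exact mul_mem ih hy
  have hum : ∀ k m, dimEval m (u k) = ((1 - (c m - c n) ^ 2 : ℝ) : ℂ) ^ (k + 1) • lineProj 0 := by
    intro k m
    induction k with
    | zero => rw [zero_add, pow_one]; exact hym m
    | succ k ih =>
      change dimEval m (u k * y) = _
      rw [map_mul, ih, hym, smul_mul_smul_comm, lineProj_zero_mul, ← pow_succ]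
  have hcm : ∀ m, 0 ≤ c m ∧ c m ≤ 1 := fun m => ⟨sq_nonneg _, Real.cos_sq_le_one _⟩
  -- The minimum with `1` keeps the ratio in `[0, 1)`.
  have hle : ∀ k, ‖dimSingle n (lineProj 0) - u k‖ ≤ |1 - min γ 1| ^ (k + 1) := fun k => by
    refine dimDrop_norm_le (by positivity) fun m => ?_
    rw [map_sub, hum]
    by_cases hm : m = n
    · subst hm
      rw [dimEval_dimSingle_self]
      simp
    · rw [dimEval_dimSingle_of_ne hm, zero_sub, norm_neg, norm_smul, norm_pow, Complex.norm_real,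
        Real.norm_eq_abs]
      have h1 : ‖lineProj 0‖ ≤ 1 := (isStarProjection_lineProj 0).norm_le_one
      have h2 := hsep m hm
      have h3 : (c m - c n) ^ 2 ≤ 1 := by
        have := hcm m
        have := hcm n
        nlinarith
      have h4 : |1 - (c m - c n) ^ 2| ≤ |1 - min γ 1| := by
        rw [abs_of_nonneg (by linarith), abs_of_nonneg (by linarith [min_le_right γ 1])]
        linarith [min_le_left γ 1]
      calc _ ≤ |1 - (c m - c n) ^ 2| ^ (k + 1) * 1 := by gcongr
        _ ≤ |1 - min γ 1| ^ (k + 1) := by rw [mul_one]; gcongr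
  have hlt : |1 - min γ 1| < 1 := by
    rw [abs_of_nonneg (by linarith [min_le_right γ 1])]
    linarith [lt_min hγ one_pos]
  have htend : Tendsto u atTop (𝓝 (dimSingle n (lineProj 0))) := by
    refine (tendsto_iff_norm_sub_tendsto_zero (E := DimDrop)).2 ?_
    refine squeeze_zero (fun _ => norm_nonneg _) (fun k => ?_)
      ((tendsto_pow_atTop_nhds_zero_of_lt_one (abs_nonneg _) hlt).comp (tendsto_add_atTop_nat 1))
    exact (norm_sub_rev (E := DimDrop) _ _).trans_le (hle k)
  exact hC.mem_of_tendsto htend (Eventually.of_forall hu)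

/-- `D` is generated by `p` and `q`. -/
theorem mem_of_projP_mem_of_projQ_mem {C : NonUnitalStarSubalgebra ℂ DimDrop}
    (hC : IsClosed (C : Set DimDrop)) (hp : projP ∈ C) (hq : projQ ∈ C) (d : DimDrop) : d ∈ C := by
  refine mem_of_dimSingle_mem (K := C.toNonUnitalSubalgebra.toSubmodule) hC hp (fun n m => ?_) d
  have h0 := dimSingle_lineProj_zero_mem hC hp hq n
  have hpos : 0 < 1 / ((n : ℝ) + 1) := by positivity
  have hle : 1 / ((n : ℝ) + 1) ≤ 1 := by
    rw [div_le_one (by positivity)]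
    have : (0 : ℝ) ≤ n := Nat.cast_nonneg n
    linarith
  have hpi := Real.pi_gt_three
  change m ∈ C.comap (dimSingle n)
  refine mem_of_lineProj_mem (θ := 1 / ((n : ℝ) + 1))
    (Real.sin_pos_of_pos_of_lt_pi hpos (by linarith)).ne'
    (Real.cos_pos_of_mem_Ioo ⟨by linarith, by linarith⟩).ne' h0 ?_ m
  change dimSingle n (lineProj 0 * lineProj (1 / ((n : ℝ) + 1))) ∈ C
  rw [← dimEval_projQ, ← dimSingle_mul]
  exact mul_mem h0 hq

/-- No finite-dimensional subalgebra of `D` contains both `p` and `q`. -/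
theorem not_projP_mem_and_projQ_mem (C : NonUnitalStarSubalgebra ℂ DimDrop)
    [FiniteDimensional ℂ C] : ¬ (projP ∈ C ∧ projQ ∈ C) := by
  rintro ⟨hp, hq⟩
  have hclosed : IsClosed (C : Set DimDrop) := by
    have : FiniteDimensional ℂ C.toNonUnitalSubalgebra.toSubmodule := ‹FiniteDimensional ℂ C›
    exact Submodule.closed_of_finiteDimensional C.toNonUnitalSubalgebra.toSubmodule
  refine not_finiteDimensional_dimDrop ?_
  let g : C →ₗ[ℂ] DimDrop :=
    { toFun := Subtype.val, map_add' := fun _ _ => rfl, map_smul' := fun _ _ => rfl }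
  exact Module.Finite.of_surjective g fun d =>
    ⟨⟨d, mem_of_projP_mem_of_projQ_mem hclosed hp hq d⟩, rfl⟩

/-- The corner of `D` at `p` is `ℂ p` modulo the minimal projections below `p`. -/
theorem exists_projP_mul_mul_projP_sub_mem {K : Submodule ℂ DimDrop}
    (hK : IsClosed (K : Set DimDrop)) (hs : ∀ n, dimSingle n (lineProj 0) ∈ K) (d : DimDrop) :
    ∃ z : ℂ, projP * d * projP - z • projP ∈ K := by
  obtain ⟨z, hz⟩ := exists_dimDrop_limit d
  refine ⟨z, ?_⟩
  set e := projP * d * projP - z • projP with he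
  have hen : ∀ n, dimEval n e = (dimEval n d 1 1 - z) • lineProj 0 := fun n => by
    rw [he, map_sub, map_mul, map_mul, map_smul, dimEval_projP, lineProj_zero_mul_mul, sub_smul]
  have hen' : ∀ n, ‖dimEval n e‖ ≤ ‖dimEval n d - z • lineProj 0‖ := fun n => by
    have h : dimEval n e = lineProj 0 * (dimEval n d - z • lineProj 0) * lineProj 0 := by
      rw [he, map_sub, map_mul, map_mul, map_smul, dimEval_projP, mul_sub, sub_mul, mul_smul_comm,
        smul_mul_assoc, lineProj_zero_mul, lineProj_zero_mul]
    rw [h]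
    have h1 : ‖lineProj 0‖ ≤ 1 := (isStarProjection_lineProj 0).norm_le_one
    exact (norm_mul_le_of_le_one_right h1).trans (norm_mul_le_of_le_one_left h1)
  rw [← SetLike.mem_coe, ← hK.closure_eq, Metric.mem_closure_iff]
  intro ε hε
  obtain ⟨N, hN⟩ := hz (ε / 2) (half_pos hε)
  refine ⟨(0 : ℂ) • projP + ∑ n ∈ Finset.range N, dimSingle n (dimEval n e - (0 : ℂ) • lineProj 0),
    ?_, ?_⟩
  · rw [zero_smul, zero_add]
    refine K.sum_mem fun n _ => ?_
    rw [zero_smul, sub_zero, hen, map_smul]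
    exact K.smul_mem _ (hs n)
  · refine lt_of_eq_of_lt (dist_eq_norm (E := DimDrop) e _) ?_
    refine (norm_sub_truncation_le (half_pos hε).le fun n hn => ?_).trans_lt (half_lt_self hε)
    rw [zero_smul, sub_zero]
    exact (hen' n).trans (hN n hn).le

end Generation

/-! ### Symbols of families on a grid. -/

section Symbol

attribute [local instance] instModuleDimDrop instSMulDimDrop instNonUnitalRingDimDrop
  instAddCommGroupDimDrop instAddGroupDimDrop instAddCommMonoidDimDrop instAddZeroClassDimDrop
  instAddDimDrop instMulDimDrop instDistribMulActionDimDrop instDistribSMulDimDrop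
  instNonUnitalCStarAlgebraDimDrop instNormedAddCommGroupDimDrop instSeminormedAddGroupDimDrop

variable {Y Z : Type*}

theorem norm_projP_le : ‖projP‖ ≤ 1 :=
  dimDrop_norm_le zero_le_one fun _ => (isStarProjection_lineProj 0).norm_le_one

theorem norm_projQ_le : ‖projQ‖ ≤ 1 :=
  dimDrop_norm_le zero_le_one fun _ => (isStarProjection_lineProj _).norm_le_one

theorem IsStarProjection.one_le_norm {A : Type*} [NonUnitalCStarAlgebra A] {p : A}
    (hp : IsStarProjection p) (h0 : p ≠ 0) : 1 ≤ ‖p‖ := by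
  have h : ‖p‖ * ‖p‖ = ‖p‖ := by
    rw [← CStarRing.norm_star_mul_self, hp.isSelfAdjoint.star_eq, hp.isIdempotentElem.eq]
  have h1 : 0 < ‖p‖ := norm_pos_iff.2 h0
  nlinarith

theorem projQ_ne_zero : projQ ≠ 0 := fun h => by
  have h1 := congrFun (congrFun (congrArg (dimEval 0) h) 1) 1
  have h2 : Real.cos (1 / ((0 : ℕ) + 1)) ≠ 0 := (Real.cos_pos_of_mem_Ioo
    ⟨by norm_num; linarith [Real.pi_gt_three], by norm_num; linarith [Real.pi_gt_three]⟩).ne'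
  rw [map_zero, dimEval_projQ] at h1
  exact h2 (by simpa [lineProj, ← Complex.ofReal_cos] using h1)

theorem norm_smul_projP (c : ℂ) : ‖c • projP‖ = ‖c‖ := by
  have h : ‖projP‖ = 1 :=
    le_antisymm norm_projP_le (isStarProjection_projP.one_le_norm projP_ne_zero)
  rw [norm_smul, h, mul_one]

theorem norm_smul_projQ (c : ℂ) : ‖c • projQ‖ = ‖c‖ := by
  have h : ‖projQ‖ = 1 :=
    le_antisymm norm_projQ_le (isStarProjection_projQ.one_le_norm projQ_ne_zero)
  rw [norm_smul, h, mul_one]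

theorem norm_smul_add_smul_le (a b : ℂ) : ‖a • projP + b • projQ‖ ≤ ‖a‖ + ‖b‖ := by
  rw [← norm_smul_projP a, ← norm_smul_projQ b]
  exact norm_add_le (E := DimDrop) _ _

/-- The family `(y, z) ↦ c_y p + c_z q`. -/
noncomputable def rowCol : lp (fun _ : Y ⊕ Z => ℂ) ∞ →ₗ[ℂ] BoundedFun (Y × Z) where
  toFun c := ⟨fun t => c (Sum.inl t.1) • projP + c (Sum.inr t.2) • projQ, by
    refine memℓp_infty ⟨‖c‖ + ‖c‖, ?_⟩
    rintro _ ⟨t, rfl⟩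
    exact (norm_smul_add_smul_le _ _).trans (add_le_add
      (lp.norm_apply_le_norm ENNReal.top_ne_zero c _)
      (lp.norm_apply_le_norm ENNReal.top_ne_zero c _))⟩
  map_add' c d := lp.ext (funext fun t => by
    change (c _ + d _) • projP + (c _ + d _) • projQ
      = (c _ • projP + c _ • projQ) + (d _ • projP + d _ • projQ)
    rw [add_smul, add_smul]
    abel)
  map_smul' z c := lp.ext (funext fun t => by
    change (z * c _) • projP + (z * c _) • projQ = z • (c _ • projP + c _ • projQ)
    rw [smul_add, smul_smul, smul_smul])

theorem rowCol_apply (c : lp (fun _ : Y ⊕ Z => ℂ) ∞) (t : Y × Z) :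
    rowCol c t = c (Sum.inl t.1) • projP + c (Sum.inr t.2) • projQ := rfl

theorem norm_rowCol_le (c : lp (fun _ : Y ⊕ Z => ℂ) ∞) :
    ‖(rowCol c : BoundedFun (Y × Z))‖ ≤ 2 * ‖c‖ := by
  refine lp.norm_le_of_forall_le (by positivity) fun t => ?_
  rw [two_mul]
  exact (norm_smul_add_smul_le _ _).trans (add_le_add
      (lp.norm_apply_le_norm ENNReal.top_ne_zero c _)
      (lp.norm_apply_le_norm ENNReal.top_ne_zero c _))

theorem star_rowCol (c : lp (fun _ : Y ⊕ Z => ℂ) ∞) :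
    star (rowCol c : BoundedFun (Y × Z)) = rowCol (star c) := by
  refine lp.ext (funext fun t => ?_)
  change star (c _ • projP + c _ • projQ) = star (c _) • projP + star (c _) • projQ
  rw [star_add, star_smul, star_smul, isStarProjection_projP.isSelfAdjoint.star_eq,
    isStarProjection_projQ.isSelfAdjoint.star_eq]

/-- Each summand of the bound contains a row coefficient and a column coefficient, so it can be
large only on the product of a finite set of rows with a finite set of columns. -/
theorem mem_c0Sum_of_norm_le {f : BoundedFun (Y × Z)} {c d : lp (fun _ : Y ⊕ Z => ℂ) ∞}
    (hc : c ∈ c0Sum (Y ⊕ Z) ℂ) (hd : d ∈ c0Sum (Y ⊕ Z) ℂ)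
    (h : ∀ t, ‖f t‖ ≤ ‖c (Sum.inl t.1)‖ * ‖d (Sum.inr t.2)‖
      + ‖c (Sum.inr t.2)‖ * ‖d (Sum.inl t.1)‖) : f ∈ c0Sum (Y × Z) DimDrop := by
  rw [mem_c0Sum_iff_finite] at *
  intro ε hε
  set r := 2 * (1 + ‖c‖ + ‖d‖) with hr
  have hr0 : 0 < r := by positivity
  set G := {i | ε / r ≤ ‖c i‖} ∪ {i | ε / r ≤ ‖d i‖} with hG
  have hGf : G.Finite := (hc _ (by positivity)).union (hd _ (by positivity))
  refine ((hGf.preimage Sum.inl_injective.injOn).prod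
    (hGf.preimage Sum.inr_injective.injOn)).subset fun t ht => ?_
  have hcn : ∀ i, ‖c i‖ ≤ ‖c‖ := fun i => lp.norm_apply_le_norm ENNReal.top_ne_zero c i
  have hdn : ∀ i, ‖d i‖ ≤ ‖d‖ := fun i => lp.norm_apply_le_norm ENNReal.top_ne_zero d i
  have key : ∀ i j, i ∉ G → ‖c i‖ * ‖d j‖ + ‖c j‖ * ‖d i‖ < ε := fun i j hi => by
    have h1 : ‖c i‖ < ε / r := not_le.1 fun h => hi (Or.inl h)
    have h2 : ‖d i‖ < ε / r := not_le.1 fun h => hi (Or.inr h)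
    calc ‖c i‖ * ‖d j‖ + ‖c j‖ * ‖d i‖ ≤ (ε / r) * ‖d‖ + ‖c‖ * (ε / r) := by
          gcongr
          · exact hdn j
          · exact hcn j
      _ = ε * ((‖c‖ + ‖d‖) / r) := by ring
      _ < ε * 1 := by
          gcongr
          rw [div_lt_one hr0, hr]
          linarith [norm_nonneg c, norm_nonneg d]
      _ = ε := mul_one ε
  have ht' : ε ≤ ‖f t‖ := ht
  refine ⟨?_, ?_⟩
  · by_contra hn
    have := key (Sum.inl t.1) (Sum.inr t.2) hn
    linarith [h t]
  · by_contra hn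
    have := key (Sum.inr t.2) (Sum.inl t.1) hn
    linarith [h t]

/-- `rowCol` is multiplicative up to the cross terms in `p q` and `q p`, whose coefficients vanish
at infinity on the grid. -/
theorem rowCol_mul_sub_mem (c d : c0Sum (Y ⊕ Z) ℂ) :
    (rowCol c.1 : BoundedFun (Y × Z)) * rowCol d.1 - rowCol (c.1 * d.1)
      ∈ c0Sum (Y × Z) DimDrop := by
  refine mem_c0Sum_of_norm_le c.2 d.2 fun t => ?_
  have hp := isStarProjection_projP.isIdempotentElem.eq
  have hq := isStarProjection_projQ.isIdempotentElem.eq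
  generalize hf : ((rowCol c.1 : BoundedFun (Y × Z)) * rowCol d.1 - rowCol (c.1 * d.1)) t = f
  replace hf : (c.1 (Sum.inl t.1) • projP + c.1 (Sum.inr t.2) • projQ)
      * (d.1 (Sum.inl t.1) • projP + d.1 (Sum.inr t.2) • projQ)
      - ((c.1 (Sum.inl t.1) * d.1 (Sum.inl t.1)) • projP
        + (c.1 (Sum.inr t.2) * d.1 (Sum.inr t.2)) • projQ) = f := hf
  generalize c.1 (Sum.inl t.1) = c₁ at *
  generalize c.1 (Sum.inr t.2) = c₂ at *
  generalize d.1 (Sum.inl t.1) = d₁ at *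
  generalize d.1 (Sum.inr t.2) = d₂ at *
  have e : f = (c₁ * d₂) • (projP * projQ) + (c₂ * d₁) • (projQ * projP) := by
    rw [← hf, add_mul, mul_add, mul_add, smul_mul_smul_comm, smul_mul_smul_comm,
      smul_mul_smul_comm, smul_mul_smul_comm, hp, hq]
    abel
  have h1 : ‖projP * projQ‖ ≤ 1 := (norm_mul_le _ _).trans
    (mul_le_one₀ norm_projP_le (norm_nonneg _) norm_projQ_le)
  have h2 : ‖projQ * projP‖ ≤ 1 := (norm_mul_le _ _).trans
    (mul_le_one₀ norm_projQ_le (norm_nonneg _) norm_projP_le)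
  rw [e, ← norm_mul, ← norm_mul]
  refine (norm_add_le (E := DimDrop) _ _).trans (add_le_add ?_ ?_) <;> rw [norm_smul]
  · exact mul_le_of_le_one_right (norm_nonneg _) h1
  · exact mul_le_of_le_one_right (norm_nonneg _) h2

/-- `a` is the family `(y, z) ↦ c_y p + c_z q` up to a family vanishing at infinity. -/
def IsSymbol (a : BoundedFun (Y × Z)) (c : c0Sum (Y ⊕ Z) ℂ) : Prop :=
  a - rowCol c.1 ∈ c0Sum (Y × Z) DimDrop

namespace IsSymbol

variable {a b : BoundedFun (Y × Z)} {c d : c0Sum (Y ⊕ Z) ℂ}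

theorem add (ha : IsSymbol a c) (hb : IsSymbol b d) : IsSymbol (a + b) (c + d) := by
  have e : a + b - rowCol (c + d).1 = (a - rowCol c.1) + (b - rowCol d.1) := by
    rw [show (c + d).1 = c.1 + d.1 from rfl, map_add]; abel
  rw [IsSymbol, e]
  exact add_mem ha hb

theorem smul (z : ℂ) (ha : IsSymbol a c) : IsSymbol (z • a) (z • c) := by
  have e : z • a - rowCol (z • c).1 = z • (a - rowCol c.1) := by
    rw [show (z • c).1 = z • c.1 from rfl, map_smul, smul_sub]
  rw [IsSymbol, e]
  exact SMulMemClass.smul_mem z ha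

theorem star (ha : IsSymbol a c) : IsSymbol (star a) (star c) := by
  have e : Star.star a - rowCol (Star.star c).1 = Star.star (a - rowCol c.1) := by
    rw [star_sub, star_rowCol]; rfl
  rw [IsSymbol, e]
  exact star_mem ha

theorem mul (ha : IsSymbol a c) (hb : IsSymbol b d) : IsSymbol (a * b) (c * d) := by
  have e : a * b - rowCol (c * d).1 = (a - rowCol c.1) * b + rowCol c.1 * (b - rowCol d.1)
      + (rowCol c.1 * rowCol d.1 - rowCol (c.1 * d.1)) := by
    rw [show (c * d).1 = c.1 * d.1 from rfl, sub_mul, mul_sub]; abel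
  rw [IsSymbol, e]
  exact add_mem (add_mem (mul_mem_c0Sum_right _ ha) (mul_mem_c0Sum_left _ hb))
    (rowCol_mul_sub_mem c d)

theorem of_rowCol (c : c0Sum (Y ⊕ Z) ℂ) : IsSymbol (rowCol c.1 : BoundedFun (Y × Z)) c := by
  rw [IsSymbol, sub_self]
  exact zero_mem _

theorem zero_iff : IsSymbol a 0 ↔ a ∈ c0Sum (Y × Z) DimDrop := by
  rw [IsSymbol, show (0 : c0Sum (Y ⊕ Z) ℂ).1 = 0 from rfl, map_zero, sub_zero]

/-- Along a row the column coefficients and the vanishing part tend to `0`, so the symbol can be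
read off as a limit. -/
theorem tendsto_row (ha : IsSymbol a c) (y : Y) :
    Tendsto (fun z => a (y, z)) cofinite (𝓝 (c.1 (Sum.inl y) • projP)) := by
  have h1 : Tendsto (fun z => (a - rowCol c.1) (y, z)) cofinite (𝓝 0) :=
    ha.comp (Prod.mk_right_injective y).tendsto_cofinite
  have h2 : Tendsto (fun z => c.1 (Sum.inr z)) cofinite (𝓝 0) :=
    Tendsto.comp c.2 Sum.inr_injective.tendsto_cofinite
  have h3 := h1.add ((h2.smul_const projQ).const_add (c.1 (Sum.inl y) • projP))
  rw [zero_smul, add_zero, zero_add] at h3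
  refine h3.congr fun z => ?_
  exact sub_add_cancel (a (y, z)) (c.1 (Sum.inl y) • projP + c.1 (Sum.inr z) • projQ)

theorem tendsto_col (ha : IsSymbol a c) (z : Z) :
    Tendsto (fun y => a (y, z)) cofinite (𝓝 (c.1 (Sum.inr z) • projQ)) := by
  have h1 : Tendsto (fun y => (a - rowCol c.1) (y, z)) cofinite (𝓝 0) :=
    ha.comp (Prod.mk_left_injective z).tendsto_cofinite
  have h2 : Tendsto (fun y => c.1 (Sum.inl y)) cofinite (𝓝 0) :=
    Tendsto.comp c.2 Sum.inl_injective.tendsto_cofinite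
  have h3 := h1.add ((h2.smul_const projP).add_const (c.1 (Sum.inr z) • projQ))
  rw [zero_smul, zero_add, zero_add] at h3
  refine h3.congr fun y => ?_
  exact sub_add_cancel (a (y, z)) (c.1 (Sum.inl y) • projP + c.1 (Sum.inr z) • projQ)

variable [Infinite Y] [Infinite Z]

/-- Each coefficient is a limit of values of `a`; infinite rows and columns make the cofinite filter
nontrivial. Uniqueness of the symbol follows. -/
theorem norm_le (ha : IsSymbol a c) : ‖c‖ ≤ ‖a‖ := by
  refine lp.norm_le_of_forall_le (f := c.1) (norm_nonneg a) fun i => ?_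
  have hle : ∀ t, ‖a t‖ ≤ ‖a‖ := fun t => lp.norm_apply_le_norm ENNReal.top_ne_zero a t
  rcases i with y | z
  · rw [← norm_smul_projP]
    exact le_of_tendsto (ha.tendsto_row y).norm (Eventually.of_forall fun z => hle (y, z))
  · rw [← norm_smul_projQ]
    exact le_of_tendsto (ha.tendsto_col z).norm (Eventually.of_forall fun y => hle (y, z))

theorem unique (ha : IsSymbol a c) (hb : IsSymbol a d) : c = d := by
  have h := (ha.add (hb.smul (-1))).norm_le
  rw [neg_one_smul, neg_one_smul, add_neg_cancel, norm_zero, ← sub_eq_add_neg] at h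
  exact sub_eq_zero.1 (norm_le_zero_iff.1 h)

end IsSymbol

variable [Infinite Y] [Infinite Z]

/-- The set is the range of the sum map on two complete spaces. The symbol bound gives `‖x.1‖ ≤ ‖f
x‖`, hence `‖x.2‖ ≤ 3 ‖f x‖`, so the map is bounded below and its range is closed. -/
theorem isClosed_setOf_isSymbol :
    IsClosed {a : BoundedFun (Y × Z) | ∃ c, IsSymbol a c} := by
  let f : c0Sum (Y ⊕ Z) ℂ × c0Sum (Y × Z) DimDrop →+ BoundedFun (Y × Z) :=
    { toFun := fun x => rowCol x.1.1 + x.2.1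
      map_zero' := by
        change rowCol 0 + 0 = 0
        rw [map_zero, add_zero]
      map_add' := fun x x' => by
        change rowCol (x.1.1 + x'.1.1) + (x.2.1 + x'.2.1) = _
        rw [map_add]
        abel }
  have hsym : ∀ x, IsSymbol (f x) x.1 := fun x => by
    change rowCol x.1.1 + x.2.1 - rowCol x.1.1 ∈ _
    rw [add_sub_cancel_left]
    exact x.2.2
  have hrange : {a : BoundedFun (Y × Z) | ∃ c, IsSymbol a c} = Set.range f := by
    ext a
    constructor
    · rintro ⟨c, hc⟩
      exact ⟨(c, ⟨_, hc⟩), add_sub_cancel _ _⟩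
    · rintro ⟨x, rfl⟩
      exact ⟨_, hsym x⟩
  have hanti : AntilipschitzWith 3 f := by
    refine AddMonoidHomClass.antilipschitz_of_bound f fun x => ?_
    have h1 : ‖x.1‖ ≤ ‖f x‖ := (hsym x).norm_le
    have h2 : ‖x.2‖ ≤ ‖f x‖ + 2 * ‖x.1‖ := by
      have e : x.2.1 = f x - rowCol x.1.1 := (add_sub_cancel_left _ _).symm
      have := norm_sub_le (f x) (rowCol x.1.1)
      rw [← e] at this
      exact this.trans (add_le_add le_rfl (norm_rowCol_le _))
    rw [Prod.norm_def]
    refine max_le ?_ ?_ <;> push_cast <;> linarith [norm_nonneg (f x)]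
  have hunif : UniformContinuous f := by
    refine AddMonoidHomClass.uniformContinuous_of_bound f 3 fun x => ?_
    have h1 := norm_add_le (rowCol x.1.1) x.2.1
    have h2 := norm_rowCol_le (Y := Y) (Z := Z) x.1.1
    have h3 : ‖x.1.1‖ ≤ ‖x‖ := norm_fst_le x
    have h4 : ‖x.2.1‖ ≤ ‖x‖ := norm_snd_le x
    exact h1.trans (by linarith)
  rw [hrange]
  exact hanti.isClosed_range hunif

end Symbol

/-! ### The extension, and the counting argument against AF. -/

section SymbolAlgebra

attribute [local instance] instModuleDimDrop instSMulDimDrop instNonUnitalRingDimDrop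
  instAddCommGroupDimDrop instAddGroupDimDrop instAddCommMonoidDimDrop instAddZeroClassDimDrop
  instAddDimDrop instMulDimDrop instDistribMulActionDimDrop instDistribSMulDimDrop
  instNonUnitalCStarAlgebraDimDrop instNormedAddCommGroupDimDrop instSeminormedAddGroupDimDrop

variable {Y Z : Type*} [Infinite Y] [Infinite Z]
  {T : NonUnitalStarSubalgebra ℂ (BoundedFun (Y × Z))}

/-- The symbol is a `*`-homomorphism. -/
theorem exists_symbolHom (hT : ∀ a, a ∈ T ↔ ∃ c, IsSymbol a c) :
    ∃ σ : T →⋆ₙₐ[ℂ] c0Sum (Y ⊕ Z) ℂ, ∀ a : T, IsSymbol (a : BoundedFun (Y × Z)) (σ a) := by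
  choose f hf using fun a : T => (hT a).1 a.2
  exact ⟨{
    toFun := f
    map_smul' := fun z a => (hf (z • a)).unique ((hf a).smul z)
    map_zero' := (hf 0).unique (IsSymbol.zero_iff.2 (zero_mem _))
    map_add' := fun a b => (hf (a + b)).unique ((hf a).add (hf b))
    map_mul' := fun a b => (hf (a * b)).unique ((hf a).mul (hf b))
    map_star' := fun a => (hf (star a)).unique (hf a).star }, hf⟩

theorem isExtension_of_isSymbol [IsClosed (T : Set (BoundedFun (Y × Z)))]
    (hT : ∀ a, a ∈ T ↔ ∃ c, IsSymbol a c) :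
    IsExtension (c0Sum (Y × Z) DimDrop) T (c0Sum (Y ⊕ Z) ℂ) := by
  obtain ⟨σ, hσ⟩ := exists_symbolHom hT
  have hJ : ∀ a ∈ c0Sum (Y × Z) DimDrop, a ∈ T := fun a ha =>
    (hT a).2 ⟨0, IsSymbol.zero_iff.2 ha⟩
  let i : c0Sum (Y × Z) DimDrop →⋆ₙₐ[ℂ] T := NonUnitalStarAlgHom.codRestrict
    (NonUnitalStarSubalgebraClass.subtype (c0Sum (Y × Z) DimDrop)) T fun a => hJ a a.2
  refine ⟨i, σ, fun a b hab => Subtype.ext (congrArg (fun x : T => x.1) hab), fun c => ?_, fun a => ?_⟩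
  · have hc := IsSymbol.of_rowCol c
    exact ⟨⟨_, (hT _).2 ⟨c, hc⟩⟩, (hσ _).unique hc⟩
  · constructor
    · intro h
      have h1 := hσ a
      rw [h] at h1
      exact ⟨⟨a, IsSymbol.zero_iff.1 h1⟩, rfl⟩
    · rintro ⟨b, rfl⟩
      exact (hσ _).unique (IsSymbol.zero_iff.2 b.2)

/-- The point `b` is the intersection of countably many neighbourhoods, each missed by only finitely
many values. This upgrades convergence to equality off a countable set. -/
theorem countable_setOf_ne_of_tendsto {α β : Type*} [TopologicalSpace β] [FirstCountableTopology β]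
    [T1Space β] {f : α → β} {b : β} (h : Tendsto f cofinite (𝓝 b)) : {x | f x ≠ b}.Countable := by
  have := h.countable_compl_preimage_ker
  rwa [ker_nhds] at this

open Cardinal in
/-- If `Y` is uncountable and `Z` is larger, the algebra is not AF. -/
theorem not_isAF_of_isSymbol {Y Z : Type} [Uncountable Y] [Infinite Z] (hYZ : #Y < #Z)
    {T : NonUnitalStarSubalgebra ℂ (BoundedFun (Y × Z))} [IsClosed (T : Set (BoundedFun (Y × Z)))]
    (hT : ∀ a, a ∈ T ↔ ∃ c, IsSymbol a c) : ¬ IsAF T := by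
  rintro ⟨S, -, hdir, hfin, hdense⟩
  obtain ⟨σ, hσ⟩ := exists_symbolHom hT
  -- An element within `1/2` of the projection of row or column `i` has nonzero symbol at `i`,
  -- because the symbol is contractive.
  have key : ∀ i : Y ⊕ Z, ∃ B ∈ S, ∃ b ∈ B, (σ b).1 i ≠ 0 := by
    intro i
    have hc := IsSymbol.of_rowCol (Y := Y) (Z := Z) ⟨lpSingle i (1 : ℂ), lpSingle_mem_c0Sum i 1⟩
    let e : T := ⟨_, (hT _).2 ⟨_, hc⟩⟩
    have he : σ e = ⟨lpSingle i (1 : ℂ), lpSingle_mem_c0Sum i 1⟩ := (hσ e).unique hc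
    obtain ⟨b, hb1, hb2⟩ := Metric.dense_iff.1 hdense e (1 / 2) one_half_pos
    simp only [Set.mem_iUnion] at hb2
    obtain ⟨B, hB, hbB⟩ := hb2
    refine ⟨B, hB, b, hbB, fun h0 => ?_⟩
    have h1 : ‖(σ (b - e)).1 i‖ ≤ ‖b - e‖ := (lp.norm_apply_le_norm ENNReal.top_ne_zero
      (σ (b - e)).1 i).trans (NonUnitalStarAlgHom.norm_apply_le σ (b - e))
    have h2 : (σ (b - e)).1 i = -1 := by
      rw [map_sub, he]
      change (σ b).1 i - lpSingle i (1 : ℂ) i = -1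
      rw [h0, lpSingle_apply_self, zero_sub]
    have h3 : ‖b - e‖ < 1 / 2 := lt_of_eq_of_lt (dist_eq_norm b e).symm hb1
    rw [h2, norm_neg, norm_one] at h1
    linarith
  choose B hB b hbB hb using key
  have hrow : ∀ y, {z | (b (Sum.inl y) : BoundedFun (Y × Z)) (y, z)
      ≠ (σ (b (Sum.inl y))).1 (Sum.inl y) • projP}.Countable := fun y =>
    countable_setOf_ne_of_tendsto ((hσ _).tendsto_row y)
  have hcol : ∀ z, {y | (b (Sum.inr z) : BoundedFun (Y × Z)) (y, z)
      ≠ (σ (b (Sum.inr z))).1 (Sum.inr z) • projQ}.Countable := fun z =>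
    countable_setOf_ne_of_tendsto ((hσ _).tendsto_col z)
  -- The order of choice matters. The exceptional sets of all rows together have at most `#Y · ℵ₀ =
  -- #Y < #Z` elements, so one column avoids them all; that column then excludes only countably many
  -- rows.
  obtain ⟨z, hz⟩ : ∃ z, z ∉ ⋃ y, {z | (b (Sum.inl y) : BoundedFun (Y × Z)) (y, z)
      ≠ (σ (b (Sum.inl y))).1 (Sum.inl y) • projP} := by
    by_contra! h
    have h1 := mk_iUnion_le_sum_mk (f := fun y => {z | (b (Sum.inl y) : BoundedFun (Y × Z)) (y, z)
      ≠ (σ (b (Sum.inl y))).1 (Sum.inl y) • projP})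
    rw [Set.eq_univ_of_forall h, mk_univ] at h1
    have h2 := h1.trans (sum_le_sum _ _ fun y => (hrow y).le_aleph0)
    rw [sum_const', mul_aleph0_eq (aleph0_le_mk Y)] at h2
    exact absurd hYZ (not_lt.2 h2)
  obtain ⟨y, hy⟩ : ∃ y, y ∉ {y | (b (Sum.inr z) : BoundedFun (Y × Z)) (y, z)
      ≠ (σ (b (Sum.inr z))).1 (Sum.inr z) • projQ} := by
    by_contra! h
    have h1 := hcol z
    rw [Set.eq_univ_of_forall h] at h1
    exact Set.not_countable_univ h1
  have hy' := not_not.1 hy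
  have hz' := not_not.1 fun h => hz (Set.mem_iUnion.2 ⟨y, h⟩)
  -- A common finite-dimensional algebra has nonzero multiples of both `p` and `q` among its values
  -- at `(y, z)`.
  obtain ⟨C, hC, h1, h2⟩ := hdir _ (hB (Sum.inl y)) _ (hB (Sum.inr z))
  have := hfin C hC
  let ev : T →⋆ₙₐ[ℂ] DimDrop := (lpEval (y, z)).comp (NonUnitalStarSubalgebraClass.subtype T)
  have hfd := finiteDimensional_nonUnitalStarSubalgebra_map ev C
  have hmem : ∀ {c : ℂ} {d : DimDrop} {a : T}, a ∈ C → c ≠ 0 → ev a = c • d → d ∈ C.map ev := by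
    intro c d a ha hc had
    have : d = c⁻¹ • ev a := by rw [had, smul_smul, inv_mul_cancel₀ hc, one_smul]
    rw [this]
    exact SMulMemClass.smul_mem _ ⟨a, ha, rfl⟩
  exact not_projP_mem_and_projQ_mem (C.map ev)
    ⟨hmem (h1 (hbB _)) (hb _) hz', hmem (h2 (hbB _)) (hb _) hy'⟩

end SymbolAlgebra

/-! ### Scatteredness. -/

section Scattered

attribute [local instance] instModuleDimDrop instSMulDimDrop instNonUnitalRingDimDrop
  instAddCommGroupDimDrop instAddGroupDimDrop instAddCommMonoidDimDrop instAddZeroClassDimDrop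
  instAddDimDrop instMulDimDrop instDistribMulActionDimDrop instDistribSMulDimDrop
  instNonUnitalCStarAlgebraDimDrop instNormedAddCommGroupDimDrop instSeminormedAddGroupDimDrop

/-- The projection onto a row or a column. -/
noncomputable def lineProjection {Y Z : Type*} (i : Y ⊕ Z) : BoundedFun (Y × Z) :=
  rowCol (lpSingle i (1 : ℂ))

theorem isStarProjection_lineProjection {Y Z : Type*} (i : Y ⊕ Z) :
    IsStarProjection (lineProjection i : BoundedFun (Y × Z)) := by
  refine ⟨lp.ext (funext fun t => ?_), ?_⟩
  · change (lpSingle i (1 : ℂ) (Sum.inl t.1) • projP + lpSingle i (1 : ℂ) (Sum.inr t.2) • projQ)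
      * (lpSingle i (1 : ℂ) (Sum.inl t.1) • projP + lpSingle i (1 : ℂ) (Sum.inr t.2) • projQ)
      = lpSingle i (1 : ℂ) (Sum.inl t.1) • projP + lpSingle i (1 : ℂ) (Sum.inr t.2) • projQ
    rcases i with y | z
    · rw [lpSingle_apply_of_ne (x := Sum.inl y) (t := Sum.inr t.2) (by simp), zero_smul, add_zero]
      by_cases h : t.1 = y
      · rw [h, lpSingle_apply_self, one_smul, isStarProjection_projP.isIdempotentElem.eq]
      · rw [lpSingle_apply_of_ne (by simpa using h), zero_smul, mul_zero]
    · rw [lpSingle_apply_of_ne (x := Sum.inr z) (t := Sum.inl t.1) (by simp), zero_smul, zero_add]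
      by_cases h : t.2 = z
      · rw [h, lpSingle_apply_self, one_smul, isStarProjection_projQ.isIdempotentElem.eq]
      · rw [lpSingle_apply_of_ne (by simpa using h), zero_smul, mul_zero]
  · rw [IsSelfAdjoint, lineProjection, star_rowCol, ← map_star, star_one]

theorem isSymbol_lineProjection {Y Z : Type*} (i : Y ⊕ Z) :
    IsSymbol (lineProjection i : BoundedFun (Y × Z))
      ⟨lpSingle i (1 : ℂ), lpSingle_mem_c0Sum i 1⟩ := by
  rw [lineProjection]
  exact IsSymbol.of_rowCol (Y := Y) (Z := Z) ⟨lpSingle i (1 : ℂ), lpSingle_mem_c0Sum i 1⟩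

/-- The part of a concrete C*-algebra which is killed by a `*`-homomorphism. -/
def kerSubmodule {A Q : Type*} [NonUnitalCStarAlgebra A] [NonUnitalCStarAlgebra Q]
    {T : NonUnitalStarSubalgebra ℂ A} (π : T →⋆ₙₐ[ℂ] Q) : Submodule ℂ A where
  carrier := {a | ∃ h : a ∈ T, π ⟨a, h⟩ = 0}
  add_mem' := by
    rintro a b ⟨ha, ha'⟩ ⟨hb, hb'⟩
    exact ⟨add_mem ha hb, (map_add π ⟨a, ha⟩ ⟨b, hb⟩).trans (by rw [ha', hb', add_zero])⟩
  zero_mem' := ⟨zero_mem T, map_zero π⟩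
  smul_mem' := by
    rintro z a ⟨ha, ha'⟩
    exact ⟨SMulMemClass.smul_mem z ha, (map_smul π z ⟨a, ha⟩).trans (by rw [ha', smul_zero])⟩

section KerSubmodule

variable {A Q : Type*} [NonUnitalCStarAlgebra A] [NonUnitalCStarAlgebra Q]
    {T : NonUnitalStarSubalgebra ℂ A} {π : T →⋆ₙₐ[ℂ] Q}

theorem mul_mem_kerSubmodule {a b : A} (ha : a ∈ T) (hb : b ∈ kerSubmodule π) :
    a * b ∈ kerSubmodule π := by
  obtain ⟨hb, hb'⟩ := hb
  exact ⟨mul_mem ha hb, (map_mul π ⟨a, ha⟩ ⟨b, hb⟩).trans (by rw [hb', mul_zero])⟩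

theorem mul_mem_kerSubmodule' {a b : A} (ha : a ∈ kerSubmodule π) (hb : b ∈ T) :
    a * b ∈ kerSubmodule π := by
  obtain ⟨ha, ha'⟩ := ha
  exact ⟨mul_mem ha hb, (map_mul π ⟨a, ha⟩ ⟨b, hb⟩).trans (by rw [ha', zero_mul])⟩

theorem isClosed_kerSubmodule [IsClosed (T : Set A)] (π : T →⋆ₙₐ[ℂ] Q) :
    IsClosed (kerSubmodule π : Set A) := by
  have hπ : Continuous π :=
    AddMonoidHomClass.continuous_of_bound π 1 fun a => by
      rw [one_mul]; exact NonUnitalStarAlgHom.norm_apply_le π a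
  have h := (IsClosed.isClosedEmbedding_subtypeVal ‹IsClosed (T : Set A)›).isClosedMap _
    (isClosed_singleton (x := (0 : Q)) |>.preimage hπ)
  convert h using 1
  ext a
  constructor
  · rintro ⟨ha, ha'⟩
    exact ⟨⟨a, ha⟩, ha', rfl⟩
  · rintro ⟨b, hb, rfl⟩
    exact ⟨b.2, hb⟩

/-- A projection whose corner is one-dimensional modulo the kernel is killed or becomes minimal. -/
theorem mem_kerSubmodule_of_corner (hπ : Function.Surjective π)
    (hmin : ¬ ∃ p : Q, IsMinimalProjection p) {e : A} (he : IsStarProjection e) (heT : e ∈ T)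
    (hcorner : ∀ a ∈ T, ∃ z : ℂ, e * a * e - z • e ∈ kerSubmodule π) : e ∈ kerSubmodule π := by
  by_contra h
  let e' : T := ⟨e, heT⟩
  refine hmin ⟨π e', ⟨?_, ?_⟩, fun h0 => h ⟨heT, h0⟩, fun q => ?_⟩
  · rw [IsIdempotentElem, ← map_mul]
    exact congrArg π (Subtype.ext he.isIdempotentElem.eq)
  · rw [IsSelfAdjoint, ← map_star]
    exact congrArg π (Subtype.ext he.isSelfAdjoint.star_eq)
  · obtain ⟨a, rfl⟩ := hπ q
    obtain ⟨z, hz, hz'⟩ := hcorner a a.2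
    refine ⟨z, sub_eq_zero.1 ?_⟩
    rw [← map_mul, ← map_mul, ← map_smul, ← map_sub]
    exact hz'

end KerSubmodule

/-- If no minimal projection survives, then the `c₀`-sum of copies of `D` is killed. -/
theorem mem_kerSubmodule_of_mem_c0Sum {X : Type*} {Q : Type*} [NonUnitalCStarAlgebra Q]
    {T : NonUnitalStarSubalgebra ℂ (BoundedFun X)} [IsClosed (T : Set (BoundedFun X))]
    {π : T →⋆ₙₐ[ℂ] Q} (hπ : Function.Surjective π) (hmin : ¬ ∃ p : Q, IsMinimalProjection p)
    (hJ : ∀ a ∈ c0Sum X DimDrop, a ∈ T) {a : BoundedFun X} (ha : a ∈ c0Sum X DimDrop) :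
    a ∈ kerSubmodule π := by
  have hsT : ∀ x d, lpSingle x d ∈ T := fun x d => hJ _ (lpSingle_mem_c0Sum x d)
  set K := kerSubmodule π with hK
  have hKc : IsClosed (K : Set (BoundedFun (X))) := isClosed_kerSubmodule π
  let L : X → Submodule ℂ DimDrop := fun x =>
    K.comap ({ toFun := lpSingle x, map_add' := map_add _, map_smul' := map_smul _ } :
      DimDrop →ₗ[ℂ] BoundedFun (X))
  have hLc : ∀ x, IsClosed (L x : Set DimDrop) := fun x =>
    hKc.preimage (AddMonoidHomClass.continuous_of_bound (lpSingle (D := DimDrop) x) 1 fun a => by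
      rw [one_mul]; exact NonUnitalStarAlgHom.norm_apply_le (lpSingle (D := DimDrop) x) a)
  have hmin0 : ∀ x n, dimSingle n (lineProj 0) ∈ L x := by
    intro x n
    have hp : IsStarProjection (lpSingle x (dimSingle n (lineProj 0))) := by
      refine ⟨?_, ?_⟩
      · rw [IsIdempotentElem, ← map_mul, ← map_mul, lineProj_zero_mul]
      · rw [IsSelfAdjoint, ← map_star, ← map_star, lineProj_star]
    change lpSingle x (dimSingle n (lineProj 0)) ∈ K
    refine mem_kerSubmodule_of_corner hπ hmin hp (hsT _ _) fun a _ =>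
      ⟨dimEval n (a x) 1 1, ?_⟩
    rw [lpSingle_mul_mul_lpSingle, dimSingle_mul, ← map_mul, lineProj_zero_mul_mul, map_smul,
      map_smul, sub_self]
    exact zero_mem _
  have hp : ∀ x, projP ∈ L x := by
    intro x
    have hp : IsStarProjection (lpSingle x projP) := by
      refine ⟨?_, ?_⟩
      · rw [IsIdempotentElem, ← map_mul, isStarProjection_projP.isIdempotentElem.eq]
      · rw [IsSelfAdjoint, ← map_star, isStarProjection_projP.isSelfAdjoint.star_eq]
    change lpSingle x projP ∈ K
    -- With the minimal projections `dimSingle n (lineProj 0)` already killed, the corner at `p` is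
    -- one-dimensional modulo the kernel.
    refine mem_kerSubmodule_of_corner hπ hmin hp (hsT _ _) fun a _ => ?_
    obtain ⟨z, hz⟩ := exists_projP_mul_mul_projP_sub_mem (hLc x) (hmin0 x) (a x)
    refine ⟨z, ?_⟩
    rw [lpSingle_mul_mul_lpSingle, ← map_smul, ← map_sub]
    exact hz
  have hall : ∀ x n m, dimSingle n m ∈ L x := by
    intro x n m
    have h : ∀ a b : M2, dimSingle n (a * lineProj 0 * b) ∈ L x := fun a b => by
      change lpSingle x (dimSingle n (a * lineProj 0 * b)) ∈ K
      rw [map_mul, map_mul, map_mul, map_mul]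
      exact mul_mem_kerSubmodule' (mul_mem_kerSubmodule (hsT _ _) (hmin0 x n)) (hsT _ _)
    -- `P_0` generates `M₂` as an ideal: the identity is `P_0` plus a product with `P_0` in the
    -- middle.
    have e : m = m * lineProj 0 * 1 + (m * !![0, 1; 0, 0]) * lineProj 0 * !![0, 0; 1, 0] := by
      rw [lineProj_zero]
      ext i j
      fin_cases j <;> simp [Matrix.mul_apply]
    rw [e, map_add]
    exact add_mem (h _ _) (h _ _)
  exact mem_of_mem_c0Sum hKc (fun x d => mem_of_dimSingle_mem (hLc x) (hp x) (hall x) d) ha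

/-- In a quotient without minimal projections, the `c₀`-sum of copies of `D` is killed, then the row
and column projections, whose corners are one-dimensional modulo that sum. These span the rest
densely, so the quotient is zero. -/
theorem isScattered_of_isSymbol {Y Z : Type} [Infinite Y] [Infinite Z]
    {T : NonUnitalStarSubalgebra ℂ (BoundedFun (Y × Z))} [IsClosed (T : Set (BoundedFun (Y × Z)))]
    (hT : ∀ a, a ∈ T ↔ ∃ c, IsSymbol a c) : IsScattered T := by
  intro Q _ π hπ hQ
  by_contra hmin
  have hJ : ∀ a ∈ c0Sum (Y × Z) DimDrop, a ∈ T := fun a ha =>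
    (hT a).2 ⟨0, IsSymbol.zero_iff.2 ha⟩
  set K := kerSubmodule π with hK
  have hKc : IsClosed (K : Set (BoundedFun (Y × Z))) := isClosed_kerSubmodule π
  have hJK : ∀ a ∈ c0Sum (Y × Z) DimDrop, a ∈ K := fun a ha =>
    mem_kerSubmodule_of_mem_c0Sum hπ hmin hJ ha
  have hline : ∀ i, lineProjection i ∈ K := by
    intro i
    have hi := isSymbol_lineProjection (Y := Y) (Z := Z) i
    refine mem_kerSubmodule_of_corner hπ hmin (isStarProjection_lineProjection i)
      ((hT _).2 ⟨_, hi⟩) fun a ha => ?_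
    obtain ⟨c, hc⟩ := (hT a).1 ha
    -- Compressing `a` by the projection of `i` leaves the symbol `c_i` at `i` and `0` elsewhere, so
    -- the difference from `c_i` times that projection has symbol `0`.
    refine ⟨c.1 i, hJK _ ?_⟩
    have h1 := ((hi.mul hc).mul hi).add ((hi.smul (c.1 i)).smul (-1))
    rw [neg_one_smul, ← sub_eq_add_neg] at h1
    rw [← IsSymbol.zero_iff]
    convert h1
    refine (add_neg_eq_zero.2 ?_).symm.trans (congrArg _ (neg_one_smul ℂ _).symm)
    refine Subtype.ext ?_
    change lpSingle i (1 : ℂ) * c.1 * lpSingle i (1 : ℂ) = c.1 i • lpSingle i (1 : ℂ)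
    rw [lpSingle_mul_mul_lpSingle, one_mul, mul_one, ← map_smul, smul_eq_mul, mul_one]
  have hrc : ∀ c ∈ c0Sum (Y ⊕ Z) ℂ, rowCol c ∈ K := fun c hc =>
    mem_of_mem_c0Sum (K := K.comap rowCol)
      (hKc.preimage (AddMonoidHomClass.continuous_of_bound rowCol 2 norm_rowCol_le))
      (fun i z => by
        have h : lpSingle i z = z • lpSingle i (1 : ℂ) := by
          rw [← map_smul, smul_eq_mul, mul_one]
        rw [h]
        exact Submodule.smul_mem _ z (hline i)) hc
  obtain ⟨q, hq⟩ := exists_ne (0 : Q)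
  obtain ⟨a, rfl⟩ := hπ q
  obtain ⟨c, hc⟩ := (hT a).1 a.2
  obtain ⟨_, h⟩ : (a : BoundedFun (Y × Z)) ∈ K := by
    have := K.add_mem (hJK _ hc) (hrc c.1 c.2)
    rwa [sub_add_cancel] at this
  exact hq h

end Scattered

/-! ### The family of rows, columns and points generates the algebra of symbols. -/

section RowColumnFamily

attribute [local instance] instModuleDimDrop instSMulDimDrop instNonUnitalRingDimDrop
  instAddCommGroupDimDrop instAddGroupDimDrop instAddCommMonoidDimDrop instAddZeroClassDimDrop
  instAddDimDrop instMulDimDrop instDistribMulActionDimDrop instDistribSMulDimDrop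
  instNonUnitalCStarAlgebraDimDrop instNormedAddCommGroupDimDrop instSeminormedAddGroupDimDrop

variable {Y Z : Type*}

/-- The first sets of the pairs in the family of all rows, columns and points. -/
def rowColLeft : Y ⊕ Z ⊕ (Y × Z) ⊕ (Y × Z) → Set (Y × Z) :=
  Sum.elim (fun y => {t | t.1 = y}) (Sum.elim (fun _ => ∅) (Sum.elim (fun x => {x}) fun _ => ∅))

/-- The second sets of the pairs in the family of all rows, columns and points. -/
def rowColRight : Y ⊕ Z ⊕ (Y × Z) ⊕ (Y × Z) → Set (Y × Z) :=
  Sum.elim (fun _ => ∅) (Sum.elim (fun z => {t | t.2 = z}) (Sum.elim (fun _ => ∅) fun x => {x}))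

theorem disjoint_rowCol (i : Y ⊕ Z ⊕ (Y × Z) ⊕ (Y × Z)) :
    Disjoint (rowColLeft i) (rowColRight i) := by
  rcases i with y | z | x | x <;> simp [rowColLeft, rowColRight]

theorem pairProj_apply_left {X : Type*} {A B : Set X} {t : X} (h : t ∈ A) :
    pairProj A B t = projP := if_pos h

theorem pairProj_apply_right {X : Type*} {A B : Set X} {t : X} (hA : t ∉ A) (hB : t ∈ B) :
    pairProj A B t = projQ := (if_neg hA).trans (if_pos hB)

theorem pairProj_apply_of_notMem {X : Type*} {A B : Set X} {t : X} (hA : t ∉ A) (hB : t ∉ B) :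
    pairProj A B t = 0 := (if_neg hA).trans (if_neg hB)

theorem pairProj_row (y : Y) :
    pairProj {t : Y × Z | t.1 = y} ∅ = lineProjection (Sum.inl y) := by
  refine lp.ext (funext fun t => ?_)
  rw [lineProjection, rowCol_apply,
    lpSingle_apply_of_ne (x := Sum.inl y) (t := Sum.inr t.2) (by simp), zero_smul, add_zero]
  by_cases h : t.1 = y
  · rw [pairProj_apply_left (A := {t : Y × Z | t.1 = y}) (t := t) h, h, lpSingle_apply_self,
      one_smul]
  · rw [pairProj_apply_of_notMem (A := {t : Y × Z | t.1 = y}) (t := t) h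
      (Set.notMem_empty t), lpSingle_apply_of_ne (by simpa using h),
      zero_smul]

theorem pairProj_column (z : Z) :
    pairProj ∅ {t : Y × Z | t.2 = z} = lineProjection (Sum.inr z) := by
  refine lp.ext (funext fun t => ?_)
  rw [lineProjection, rowCol_apply,
    lpSingle_apply_of_ne (x := Sum.inr z) (t := Sum.inl t.1) (by simp), zero_smul, zero_add]
  by_cases h : t.2 = z
  · rw [pairProj_apply_right (B := {t : Y × Z | t.2 = z}) (t := t)
      (Set.notMem_empty t) h, h, lpSingle_apply_self, one_smul]
  · rw [pairProj_apply_of_notMem (B := {t : Y × Z | t.2 = z}) (t := t)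
      (Set.notMem_empty t) h, lpSingle_apply_of_ne (by simpa using h),
      zero_smul]

theorem pairProj_singleton_left {X : Type*} (x : X) : pairProj {x} ∅ = lpSingle x projP := by
  refine lp.ext (funext fun t => ?_)
  by_cases h : t = x
  · rw [pairProj_apply_left (A := {x}) (t := t) h, h, lpSingle_apply_self]
  · rw [pairProj_apply_of_notMem (A := {x}) (t := t) h
      (Set.notMem_empty t), lpSingle_apply_of_ne h]

theorem pairProj_singleton_right {X : Type*} (x : X) : pairProj ∅ {x} = lpSingle x projQ := by
  refine lp.ext (funext fun t => ?_)
  by_cases h : t = x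
  · rw [pairProj_apply_right (B := {x}) (t := t) (Set.notMem_empty t) h, h, lpSingle_apply_self]
  · rw [pairProj_apply_of_notMem (B := {x}) (t := t) (Set.notMem_empty t) h, lpSingle_apply_of_ne h]

theorem pairProj_mem_familyAlgebra {X ι : Type*} (A B : ι → Set X) (i : ι) :
    pairProj (A i) (B i) ∈ familyAlgebra A B :=
  NonUnitalStarSubalgebra.le_topologicalClosure _
    (NonUnitalStarAlgebra.subset_adjoin ℂ _ ⟨i, rfl⟩)

theorem exists_isSymbol_pairProj (i : Y ⊕ Z ⊕ (Y × Z) ⊕ (Y × Z)) :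
    ∃ c, IsSymbol (pairProj (rowColLeft i) (rowColRight i)) c := by
  rcases i with y | z | x | x
  · exact ⟨_, (pairProj_row (Z := Z) y).symm ▸ isSymbol_lineProjection (Sum.inl y)⟩
  · exact ⟨_, (pairProj_column (Y := Y) z).symm ▸ isSymbol_lineProjection (Sum.inr z)⟩
  · exact ⟨0, (pairProj_singleton_left x).symm ▸ IsSymbol.zero_iff.2 (lpSingle_mem_c0Sum x _)⟩
  · exact ⟨0, (pairProj_singleton_right x).symm ▸ IsSymbol.zero_iff.2 (lpSingle_mem_c0Sum x _)⟩

/-- The elements of `ℓ_∞(D)` which have a symbol. -/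
def symbolAlgebra (Y Z : Type*) : NonUnitalStarSubalgebra ℂ (BoundedFun (Y × Z)) where
  carrier := {a | ∃ c, IsSymbol a c}
  add_mem' := by
    rintro a b ⟨c, hc⟩ ⟨d, hd⟩
    exact ⟨_, hc.add hd⟩
  zero_mem' := ⟨0, IsSymbol.zero_iff.2 (zero_mem _)⟩
  mul_mem' := by
    rintro a b ⟨c, hc⟩ ⟨d, hd⟩
    exact ⟨_, hc.mul hd⟩
  smul_mem' := by
    rintro z a ⟨c, hc⟩
    exact ⟨_, hc.smul z⟩
  star_mem' := by
    rintro a ⟨c, hc⟩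
    exact ⟨_, hc.star⟩

/-- Each point occurs in the family once with `p` and once with `q`, and these generate the copy of
`D` at that point. -/
theorem lpSingle_mem_familyAlgebra (x : Y × Z) (d : DimDrop) :
    lpSingle x d ∈ familyAlgebra (rowColLeft (Y := Y) (Z := Z)) rowColRight := by
  have hcont : Continuous (lpSingle (D := DimDrop) x) :=
    AddMonoidHomClass.continuous_of_bound (lpSingle (D := DimDrop) x) 1 fun a => by
      rw [one_mul]; exact NonUnitalStarAlgHom.norm_apply_le (lpSingle (D := DimDrop) x) a
  refine mem_of_projP_mem_of_projQ_mem (C := (familyAlgebra (rowColLeft (Y := Y) (Z := Z))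
    rowColRight).comap (lpSingle x)) ((instIsClosedFamilyAlgebra _ _).preimage hcont) ?_ ?_ d
  · have := pairProj_mem_familyAlgebra (rowColLeft (Y := Y) (Z := Z)) rowColRight
      (Sum.inr (Sum.inr (Sum.inl x)))
    change pairProj {x} ∅ ∈ _ at this
    rwa [pairProj_singleton_left] at this
  · have := pairProj_mem_familyAlgebra (rowColLeft (Y := Y) (Z := Z)) rowColRight
      (Sum.inr (Sum.inr (Sum.inr x)))
    change pairProj ∅ {x} ∈ _ at this
    rwa [pairProj_singleton_right] at this

theorem lineProjection_mem_familyAlgebra (i : Y ⊕ Z) :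
    lineProjection i ∈ familyAlgebra (rowColLeft (Y := Y) (Z := Z)) rowColRight := by
  rcases i with y | z
  · rw [← pairProj_row]
    exact pairProj_mem_familyAlgebra _ _ (Sum.inl y)
  · rw [← pairProj_column]
    exact pairProj_mem_familyAlgebra _ _ (Sum.inr (Sum.inl z))

theorem rowCol_mem_familyAlgebra (c : c0Sum (Y ⊕ Z) ℂ) :
    rowCol c.1 ∈ familyAlgebra (rowColLeft (Y := Y) (Z := Z)) rowColRight := by
  refine mem_of_mem_c0Sum (K := (familyAlgebra (rowColLeft (Y := Y) (Z := Z))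
    rowColRight).toNonUnitalSubalgebra.toSubmodule.comap rowCol)
    ((instIsClosedFamilyAlgebra _ _).preimage
      (AddMonoidHomClass.continuous_of_bound rowCol 2 norm_rowCol_le)) (fun i z => ?_) c.2
  have h : lpSingle i z = z • lpSingle i (1 : ℂ) := by
    rw [← map_smul, smul_eq_mul, mul_one]
  rw [h]
  exact Submodule.smul_mem _ z (lineProjection_mem_familyAlgebra i)

/-- The elements with a symbol form a closed algebra containing the generators. Conversely, the
points supply the part vanishing at infinity, and the rows and columns supply `rowCol c`. -/
theorem mem_familyAlgebra_iff [Infinite Y] [Infinite Z] (a : BoundedFun (Y × Z)) :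
    a ∈ familyAlgebra (rowColLeft (Y := Y) (Z := Z)) rowColRight ↔ ∃ c, IsSymbol a c := by
  constructor
  · intro ha
    refine NonUnitalStarSubalgebra.topologicalClosure_minimal _ (t := symbolAlgebra Y Z) ?_
      isClosed_setOf_isSymbol ha
    refine NonUnitalStarAlgebra.adjoin_le ?_
    rintro _ ⟨i, rfl⟩
    exact exists_isSymbol_pairProj i
  · rintro ⟨c, hc⟩
    have h := add_mem (mem_of_mem_c0Sum (K := (familyAlgebra (rowColLeft (Y := Y) (Z := Z))
      rowColRight).toNonUnitalSubalgebra.toSubmodule) (instIsClosedFamilyAlgebra _ _)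
      lpSingle_mem_familyAlgebra hc) (rowCol_mem_familyAlgebra c)
    rwa [sub_add_cancel] at h

end RowColumnFamily

theorem theorem1p12 :
    -- there are extensions of AF algebras by AF algebras that are not AF,
    -- namely among the scattered algebras generated by families of pairs of disjoint sets
    (∃ (X ι : Type) (A B : ι → Set X),
      (∀ i, Disjoint (A i) (B i)) ∧
      IsScattered (familyAlgebra A B) ∧
      (∃ (I Q : Type) (_ : NonUnitalCStarAlgebra I) (_ : NonUnitalCStarAlgebra Q),
        IsExtension I (familyAlgebra A B) Q ∧ IsAF I ∧ IsAF Q) ∧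
      ¬ IsAF (familyAlgebra A B)) ∧
    -- every extension of an LF algebra by an LF algebra is LF
    (∀ (I : Type*) (E : Type*) (Q : Type*) [NonUnitalCStarAlgebra I] [NonUnitalCStarAlgebra E]
      [NonUnitalCStarAlgebra Q], IsExtension I E Q → IsLF I → IsLF Q → IsLF E) := by
  -- The grid needs an uncountable set and a strictly larger one: `ℝ` and its power set, by Cantor's
  -- theorem.
  refine ⟨⟨ℝ × Set ℝ, ℝ ⊕ Set ℝ ⊕ (ℝ × Set ℝ) ⊕ (ℝ × Set ℝ), rowColLeft, rowColRight,
    disjoint_rowCol, isScattered_of_isSymbol mem_familyAlgebra_iff,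
    ⟨c0Sum (ℝ × Set ℝ) DimDrop, c0Sum (ℝ ⊕ Set ℝ) ℂ, inferInstance, inferInstance,
      isExtension_of_isSymbol mem_familyAlgebra_iff, isAF_dimDrop.c0Sum,
      isAF_of_finiteDimensional.c0Sum⟩,
    not_isAF_of_isSymbol ?_ mem_familyAlgebra_iff⟩, fun I E Q _ _ _ h hI hQ => h.isLF hI hQ⟩
  rw [Cardinal.mk_set]
  exact Cardinal.cantor _
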